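/- **Notation.** $B_r(x)\subset\mathbb R^2$ is the open disc, $B_r=B_r(0)$; for $E\subset\mathbb R^2$, $\overline B_r(E)$ is the closed $r$-neighbourhood of $E$; $f_s(x)=s^{-2}f(x/s)$; $G(x)=(2\pi)^{-1}e^{-|x|^2/2}$. $BV(\mathcal D)$ is the space of $u\in L^1(\mathcal D)$ with finite total variation $|Du|(\mathcal D)$, and $d_{st}(u,v)=\int_{\mathcal D}|u-v|+\big||Du|(\mathcal D)-|Dv|(\mathcal D)\big|$. The norm of $C^{1,\alpha}(\mathbb R^2)$ is $\sup|f|+\sup|\nabla f|+[\nabla f]_\alpha$, where $[\cdot]_\alpha$ is the Hölder seminorm. A bounded open set $\Omega\subset\mathbb R^2$ is *Lipschitz with constants $r,L$* if for every $x\in\partial\Omega$ there are a rigid motion taking $x$ to $0$ (with new coordinates $(y_1,y_2)$ and coordinate vectors $e_1,e_2$) and a function $\varphi:\mathbb R\to\mathbb R$ with Lipschitz constant at most $L$ and $\varphi(0)=0$ such that, for $y\in B_r(x)$, $y\in\Omega$ if and only if $y_2<\varphi(y_1)$. Such a pair is called a chart at $x$. **Constants depending on $L$.** Given $L>0$, constants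 $\delta_1,\delta_2,m_1,R_0,\tilde h,a_1$ are called *admissible for $L$* if $0<\delta_2\le\delta_1\le 1/2$, $0<m_1\le1$, $R_0\ge1$, $0<\tilde h\le1/24$, $a_1>0$ and the following hold. (i) Let $r>0$, let $\Omega$ be Lipschitz with constants $r,L$, and take any chart at any $x\in\partial\Omega$; put $M_\delta(x)=\{|y_1|\le\delta r,\ y_2=\varphi(y_1)\}$ and $N_\delta(x)=\{|y_1|\le\delta_1r,\ |y_2-\varphi(y_1)|\le\delta r\}$. Then for $0<\delta\le\delta_2$: $N_\delta(x)\subset B_{r/2}(x)\cap\overline B_{\delta r}(\partial\Omega)$; $\overline B_{m_1\delta r}(M_{\delta_1/2}(x))\subset N_\delta(x)$; and no point $y$ with $|y_1|\le\delta_1r/2$ and $y_2=\varphi(y_1)\pm\delta r$ lies in $\overline B_{m_1\delta r}(\partial\Omega)$. (ii) Put $\delta=\delta_2/4$. Let $D$ be Lipschitz with constants $R_0,L$ and $v=\chi_D*G$. If $\tilde h<v(x)<1-\tilde h$, then $x\in\overline B_{m_1\delta R_0}(\partial D)$; and for every $x\in\partial D$, every chart at $x$ and every $y\in N_\delta(x)$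 (taken with $r=R_0$), $\nabla v(y)\cdot(-e_2)\ge a_1$. Moreover $\|\nabla G\|_{L^1(\mathbb R^2\setminus B_{R_0/2})}\le a_1/12$. **Mask model.** $A=\{u\in L^1(\mathbb R^2): u=0 \text{ a.e. outside } B_R,\ 0\le u\le1\text{ a.e. in }B_R\}$. For given $r,L,R,\gamma$, $\mathcal A_\gamma$ is the set of $u\in A$ with $\|u-\chi_D\|_{L^1(B_R)}\le\gamma$ for some open $D\subset B_R$ which is Lipschitz with constants $r,L$. Let $\hat T$ be a real radial function in $C^\infty_0(\mathbb R^2)$ with $\hat T\equiv1$ on $B_{s_0}$, and let $T(x)=(2\pi)^{-2}\int\hat T(\xi)e^{-i\xi\cdot x}\,d\xi$. Let $J(x)=2J_1(\sigma|x|/s)/(\sigma|x|/s)$, $J(0)=1$, where $J_1$ is the Bessel function of order $1$, and $$I_{s,\sigma}(u)(x)=\int_{\mathbb R^2}\int_{\mathbb R^2}u(\xi)\,T_{ss_0}(x-\xi)\,J(\xi-\eta)\,T_{ss_0}(x-\eta)\,u(\eta)\,d\xi\,d\eta .$$ Let $\phi\in C^\infty(\mathbb R)$ be nondecreasing with $\phi(t)=0$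 for $t\le-1/2$ and $\phi(t)=1$ for $t\ge1/2$. Put $$\mathcal W(u)=\chi_{\{I_{s,\sigma}(u)>h\}},\qquad \Phi_\eta(u)=\phi\Big(\frac{I_{s,\sigma}(u)-h}{\eta}\Big).$$ **Proposition.** For every $L>0$ there are constants $\delta_1,\delta_2,m_1,R_0,\tilde h,a_1$ admissible for $L$ (thus depending on $L$ only) with the following property. Let $R\ge10R_0$, $p>4$, $\alpha=1-4/p$, $M\ge0$ and $0<\rho\le1$. Then there are $\tilde\sigma_0\in(0,1]$ and $\gamma_0>0$, depending on $L,R,p,M,\rho$ only, such that the following holds for all $\tilde\delta$ with $0<\tilde\delta\le\min\{\tilde h,a_1/2\}$, all $0<s_0\le1$, all $\hat T$ as above with $\|T-G\|_{W^{1,1}(\mathbb R^2)}\le\tilde\delta$ and $\|D^2(T-G)\|_{L^1(\mathbb R^2)}\le M$, all $0<s\le 1/s_0$ with $ss_0=\rho$, all $0<\sigma\le\tilde\sigma_0s$, all $0<\gamma\le\gamma_0$, all $h\in[1/3,2/3]$ and all $\phi$ as above. Let $\mathcal A_\gamma$ be taken with $r=ss_0R_0$ and let $\tilde R=R+2m_1\delta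 R_0$, where $\delta=\delta_2/4$. 1. For every $\eta>0$, $\Phi_\eta$ maps $A$ into $C^{1,\alpha}(\mathbb R^2)$. For every $0<\eta\le h$ it is Hölder continuous with exponent $1/p$ from $A$, with the $L^1(B_R)$ norm, into $C^{1,\alpha}(\mathbb R^2)$: there is a constant $C$ (which may depend on $\eta$) with $\|\Phi_\eta(u_1)-\Phi_\eta(u_2)\|_{C^{1,\alpha}(\mathbb R^2)}\le C\|u_1-u_2\|_{L^1(B_R)}^{1/p}$ for all $u_1,u_2\in A$. 2. $\mathcal W$ and $\Phi_\eta$ ($\eta>0$) map $\mathcal A_\gamma$ into $BV(B_{\tilde R})$, and $\Phi_\eta$ converges to $\mathcal W$ uniformly on $\mathcal A_\gamma$ with respect to $d_{st}$ on $BV(B_{\tilde R})$: $$\lim_{\eta\to0^+}\ \sup_{u\in\mathcal A_\gamma}d_{st}\big(\mathcal W(u),\Phi_\eta(u)\big)=0 .$$ -/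

import Mathlib

open MeasureTheory Metric
open scoped ContDiff ENNReal NNReal

namespace Litho

noncomputable section

/-- The Euclidean plane; `x 0` and `x 1` are the two coordinates. -/
abbrev Plane := EuclideanSpace ℝ (Fin 2)

/-- The second vector of the canonical basis. -/
def e2 : Plane := EuclideanSpace.single 1 1

/-! ### Functions on the plane, norms -/

/-- `f_s(x) = s⁻² f(x / s)`. -/
def dilate (f : Plane → ℝ) (s : ℝ) (x : Plane) : ℝ := (s ^ 2)⁻¹ * f (s⁻¹ • x)

/-- The `W^{1,1}` norm of a differentiable function, `‖f‖_{L¹} + ‖∇f‖_{L¹}`. -/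
def w11Norm (f : Plane → ℝ) : ℝ≥0∞ := (∫⁻ x, ‖f x‖ₑ) + ∫⁻ x, ‖fderiv ℝ f x‖ₑ

/-- `‖D² f‖_{L¹}` for a twice differentiable function. -/
def hessL1Norm (f : Plane → ℝ) : ℝ≥0∞ := ∫⁻ x, ‖iteratedFDeriv ℝ 2 f x‖ₑ

/-- The norm of `C^{1,α}(ℝ²)`: `sup |f| + sup |∇f| + [∇f]_α`. -/
def c1AlphaNorm (α : ℝ) (f : Plane → ℝ) : ℝ≥0∞ :=
  (⨆ x, ‖f x‖ₑ) + (⨆ x, ‖fderiv ℝ f x‖ₑ) + eHolderNorm α.toNNReal (fderiv ℝ f)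

/-- Membership in `C^{1,α}(ℝ²)`. -/
def MemC1Alpha (α : ℝ) (f : Plane → ℝ) : Prop := ContDiff ℝ 1 f ∧ c1AlphaNorm α f < ⊤

/-! ### Functions of bounded variation -/

/-- The divergence of a vector field. -/
def divergence (X : Plane → Plane) (x : Plane) : ℝ :=
  ∑ i : Fin 2, (fderiv ℝ X x (EuclideanSpace.single i 1)) i

/-- `|Du|(D)`, the total variation in the open set `D` of the distributional derivative of `u`:
the supremum of `∫_D u div X` over the `C¹` vector fields `X` with compact support in `D` and
`|X| ≤ 1`. -/
def totalVar (D : Set Plane) (u : Plane → ℝ) : ℝ≥0∞ :=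
  ⨆ (X : Plane → Plane) (_ : ContDiff ℝ 1 X) (_ : HasCompactSupport X) (_ : tsupport X ⊆ D)
    (_ : ∀ x, ‖X x‖ ≤ 1), ENNReal.ofReal (∫ x in D, u x * divergence X x)

/-- `u ∈ BV(D)`. -/
def MemBV (D : Set Plane) (u : Plane → ℝ) : Prop := IntegrableOn u D ∧ totalVar D u < ⊤

/-- The distance inducing strict convergence in `BV(D)` (meant for `u, v ∈ BV(D)`). -/
def dSt (D : Set Plane) (u v : Plane → ℝ) : ℝ :=
  (∫ x in D, |u x - v x|) + |(totalVar D u).toReal - (totalVar D v).toReal|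

/-! ### Lipschitz open sets -/

/-- The pair `(Q, φ)` is a Lipschitz chart of `Ω` at `x` with constants `r`, `L`: in the
coordinates `z = Q (y - x)`, with `Q` a linear isometry, and inside the ball `B_r(x)`,
the set `Ω` is the strict subgraph of `φ`, and `φ 0 = 0`. -/
structure IsLipChart (Ω : Set Plane) (r L : ℝ) (x : Plane) (Q : Plane ≃ₗᵢ[ℝ] Plane)
    (φ : ℝ → ℝ) : Prop where
  lip : LipschitzWith L.toNNReal φ
  zero : φ 0 = 0
  mem_iff : ∀ y ∈ ball x r, y ∈ Ω ↔ Q (y - x) 1 < φ (Q (y - x) 0)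

/-- `Ω` is a bounded open set which is Lipschitz with constants `r` and `L`. -/
structure IsLipDomain (Ω : Set Plane) (r L : ℝ) : Prop where
  isOpen : IsOpen Ω
  isBounded : Bornology.IsBounded Ω
  chart : ∀ x ∈ frontier Ω, ∃ Q φ, IsLipChart Ω r L x Q φ

/-- `M_δ(x)`, relative to a chart at `x`; here `a = δ r`. -/
def graphPiece (x : Plane) (Q : Plane ≃ₗᵢ[ℝ] Plane) (φ : ℝ → ℝ) (a : ℝ) : Set Plane :=
  {y | |Q (y - x) 0| ≤ a ∧ Q (y - x) 1 = φ (Q (y - x) 0)}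

/-- `N_δ(x)`, relative to a chart at `x`; here `a = δ₁ r` and `b = δ r`. -/
def graphStrip (x : Plane) (Q : Plane ≃ₗᵢ[ℝ] Plane) (φ : ℝ → ℝ) (a b : ℝ) : Set Plane :=
  {y | |Q (y - x) 0| ≤ a ∧ φ (Q (y - x) 0) - b ≤ Q (y - x) 1 ∧
    Q (y - x) 1 ≤ φ (Q (y - x) 0) + b}

/-- The requirements on the geometric constants `δ₁`, `δ₂`, `m₁` belonging to `L`. -/
structure GeomConstants (L δ₁ δ₂ m₁ : ℝ) : Prop where
  δ₁_pos : 0 < δ₁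
  δ₁_le : δ₁ ≤ 1 / 2
  δ₂_pos : 0 < δ₂
  δ₂_le : δ₂ ≤ δ₁
  m₁_pos : 0 < m₁
  m₁_le : m₁ ≤ 1
  strip : ∀ (r : ℝ) (Ω : Set Plane) (x : Plane) (Q : Plane ≃ₗᵢ[ℝ] Plane) (φ : ℝ → ℝ) (δ : ℝ),
    0 < r → IsLipDomain Ω r L → x ∈ frontier Ω → IsLipChart Ω r L x Q φ → 0 < δ → δ ≤ δ₂ →
      graphStrip x Q φ (δ₁ * r) (δ * r) ⊆ ball x (r / 2) ∧
      graphStrip x Q φ (δ₁ * r) (δ * r) ⊆ cthickening (δ * r) (frontier Ω) ∧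
      cthickening (m₁ * δ * r) (graphPiece x Q φ (δ₁ / 2 * r)) ⊆
        graphStrip x Q φ (δ₁ * r) (δ * r) ∧
      ∀ y : Plane, |Q (y - x) 0| ≤ δ₁ * r / 2 →
        (Q (y - x) 1 = φ (Q (y - x) 0) + δ * r ∨ Q (y - x) 1 = φ (Q (y - x) 0) - δ * r) →
          y ∉ cthickening (m₁ * δ * r) (frontier Ω)

/-! ### Convolution of characteristic functions with the Gaussian -/

/-- The Gaussian `G(x) = (2π)⁻¹ exp(-|x|² / 2)`. -/
def gauss (x : Plane) : ℝ := (2 * Real.pi)⁻¹ * Real.exp (-(‖x‖ ^ 2) / 2)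

/-- `χ_D ∗ G`. -/
def blur (D : Set Plane) (x : Plane) : ℝ := ∫ y in D, gauss (x - y)

/-- The requirements on the constants `R₀`, `h'`, `a₁` belonging to `L`, with `δ = δ₂ / 4`. -/
structure GaussConstants (L δ₁ δ₂ m₁ R₀ h' a₁ : ℝ) : Prop where
  R₀_ge : 1 ≤ R₀
  h'_pos : 0 < h'
  h'_le : h' ≤ 1 / 24
  a₁_pos : 0 < a₁
  near_boundary : ∀ D : Set Plane, IsLipDomain D R₀ L → ∀ x : Plane,
    h' < blur D x → blur D x < 1 - h' → x ∈ cthickening (m₁ * (δ₂ / 4) * R₀) (frontier D)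
  gradient : ∀ D : Set Plane, IsLipDomain D R₀ L → ∀ x ∈ frontier D,
    ∀ (Q : Plane ≃ₗᵢ[ℝ] Plane) (φ : ℝ → ℝ), IsLipChart D R₀ L x Q φ →
      ∀ y ∈ graphStrip x Q φ (δ₁ * R₀) (δ₂ / 4 * R₀),
        a₁ ≤ fderiv ℝ (blur D) y (-(Q.symm e2))
  gauss_tail : ∫⁻ x in (ball (0 : Plane) (R₀ / 2))ᶜ, ‖fderiv ℝ gauss x‖ₑ ≤
    ENNReal.ofReal (1 / 12 * a₁)

/-! ### The optical model -/

/-- `T = (2π)⁻² ∫ That(ξ) exp(-i ξ·x) dξ`. (For radial real `That` the integral is real.) -/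
def pointSpread (That : Plane → ℝ) (x : Plane) : ℝ :=
  ((2 * Real.pi) ^ 2)⁻¹ *
    (∫ ξ : Plane, (That ξ : ℂ) * Complex.exp (-(Complex.I * (inner ℝ ξ x : ℝ)))).re

/-- `That` is a radial function in `C₀^∞(ℝ²)`, identically `1` on the ball `B_{s₀}`. -/
structure IsAperture (That : Plane → ℝ) (s₀ : ℝ) : Prop where
  smooth : ContDiff ℝ ∞ That
  compact : HasCompactSupport That
  radial : ∀ x y : Plane, ‖x‖ = ‖y‖ → That x = That y
  eq_one : ∀ x ∈ ball (0 : Plane) s₀, That x = 1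

/-- The Bessel function `J₁`, through Bessel's integral. -/
def besselJ1 (t : ℝ) : ℝ := Real.pi⁻¹ * ∫ τ in (0 : ℝ)..Real.pi, Real.cos (τ - t * Real.sin τ)

/-- The mutual intensity function `J(x) = 2 J₁(κ|x|) / (κ|x|)`, continuously extended by
`J(0) = 1`. -/
def mutualIntensity (κ : ℝ) (x : Plane) : ℝ :=
  if x = 0 then 1 else 2 * besselJ1 (κ * ‖x‖) / (κ * ‖x‖)

/-- The image intensity
`∫∫ u(ξ) K(x - ξ) J(ξ - η) K(x - η) u(η) dξ dη`. -/
def hopkins (K J u : Plane → ℝ) (x : Plane) : ℝ :=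
  ∫ ξ : Plane, ∫ η : Plane, u ξ * K (x - ξ) * J (ξ - η) * K (x - η) * u η

/-- `I_{s,σ}(u)`, with point spread function `T_{s s₀}` and, since `s = (k NA)⁻¹`,
with `k σ NA = σ / s` in the mutual intensity function. -/
def intensity (That : Plane → ℝ) (s₀ s σ : ℝ) (u : Plane → ℝ) : Plane → ℝ :=
  hopkins (dilate (pointSpread That) (s * s₀)) (mutualIntensity (σ / s)) u

/-- `A = {u ∈ L¹(B_R) : 0 ≤ u ≤ 1 a.e.}`, the functions being extended by zero. -/
def maskSet (R : ℝ) : Set (Plane → ℝ) :=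
  {u | Integrable u ∧ (∀ᵐ x, x ∉ ball (0 : Plane) R → u x = 0) ∧
    ∀ᵐ x, x ∈ ball (0 : Plane) R → 0 ≤ u x ∧ u x ≤ 1}

/-- The `L¹(B_R)` distance. -/
def l1Dist (R : ℝ) (u v : Plane → ℝ) : ℝ := ∫ x in ball (0 : Plane) R, |u x - v x|

/-- `𝒜_γ`: the functions in `A` at `L¹(B_R)` distance at most `γ` from the characteristic function
of an open set contained in `B_R` which is Lipschitz with constants `r` and `L`. -/
def nearMaskSet (r L R γ : ℝ) : Set (Plane → ℝ) :=
  {u | u ∈ maskSet R ∧ ∃ D : Set Plane, D ⊆ ball 0 R ∧ IsLipDomain D r L ∧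
    l1Dist R u (D.indicator 1) ≤ γ}

/-- The hard threshold: `H_h(I)`, the characteristic function of `{I > h}`. -/
def hardThreshold (h : ℝ) (I : Plane → ℝ) : Plane → ℝ := {x | h < I x}.indicator 1

/-- `φ` is a smooth nondecreasing approximate Heaviside function. -/
structure IsSmoothStep (φ : ℝ → ℝ) : Prop where
  smooth : ContDiff ℝ ∞ φ
  mono : Monotone φ
  zero : ∀ t, t ≤ -(1 / 2) → φ t = 0
  one : ∀ t, 1 / 2 ≤ t → φ t = 1

/-- The smoothed threshold: `φ((I - h) / η)`. -/
def softThreshold (φ : ℝ → ℝ) (h η : ℝ) (I : Plane → ℝ) (x : Plane) : ℝ := φ ((I x - h) / η)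

end

end Litho

open MeasureTheory Metric
open scoped ContDiff ENNReal NNReal
open Filter Topology

namespace Litho

set_option maxSynthPendingDepth 3


/-! The convergence of thresholds rests on one transversality fact: there are a band |I - h| < 1/100
and a lower bound a₁/4 for |∇I| on it that serve every mask in 𝒜_γ, and the intensities of all masks
in A share one C² bound.

From transversality to strict convergence. The two thresholds differ only where |I - h| ≤ η/2. The
field X = -∇I/|∇I|, cut off inside the band, has |X| ≤ 1 and div X bounded uniformly in the mask
(`exists_calibration`). It calibrates: by the divergence theorem the supremum defining the total
variation of Φ_η(u) is attained at X for all small η, and, letting η → 0, so is that of 𝒲(u). Hence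
both parts of d_st are at most a constant times the area of {|I - h| ≤ η/2}. That area is O(η), by
testing X against arctan((I - h)/η) (`band_area_le`). No coarea formula and no regularity of the
level set is used; see `exists_dSt_threshold_le`.

Transversality. For u = χ_D and J = 1 the intensity is the square (χ_D * K)², with K = T_ρ. Scaling
by ρ turns D into a domain E that is Lipschitz at scale R₀, and χ_E * T is within δ' of the Gaussian
blur χ_E * G in C¹. Where the blur is neither near 0 nor near 1 the boundary is close, E is a
subgraph up to a Gaussian tail, and the derivative of the blur along the chart axis is an explicit
positive integral (`exists_gaussConstants`, `le_norm_fderiv_coherent`). To return to general u and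
J, |J(x) - 1| ≤ 2(σ/s)|x| controls the change of J. The change of mask, small in L¹ and bounded by
1, is controlled by L² norms of K and ∇K; these come from the embedding of W^{1,1} into L² in the
plane, which is why the bound M on D²(T - G) is needed (`norm_integral_hopkinsWeight_sub_le`,
`exists_transversality`).

Hölder continuity needs no transversality. The map u ↦ I(u) is Lipschitz from L¹ to C¹ and bounded
in C², so Φ_η is too; interpolating between C¹ and C² gives the exponent 1 - α = 4/p for the
seminorm, and as the L¹ distance d is bounded on A, d^(4/p) is at most a constant times d^(1/p). -/

/-! ### Lipschitz charts and the geometric constants -/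

theorem abs_coord_le_norm (v : Plane) (i : Fin 2) : |v i| ≤ ‖v‖ := by
  simpa using PiLp.norm_apply_le v i

theorem norm_le_abs_add_abs (v : Plane) : ‖v‖ ≤ |v 0| + |v 1| := by
  rw [EuclideanSpace.norm_eq, Real.sqrt_le_left (by positivity)]
  simp only [Fin.sum_univ_two, Real.norm_eq_abs]
  nlinarith [abs_nonneg (v 0), abs_nonneg (v 1)]

theorem abs_chart_coord_sub_le (x y z : Plane) (Q : Plane ≃ₗᵢ[ℝ] Plane) (i : Fin 2) :
    |Q (y - x) i - Q (z - x) i| ≤ dist y z := by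
  have h := abs_coord_le_norm (Q (y - x) - Q (z - x)) i
  rw [← map_sub, Q.norm_map, sub_sub_sub_cancel_right, map_sub] at h
  simpa [dist_eq_norm] using h

theorem IsLipChart.abs_sub_le {Ω : Set Plane} {r L : ℝ} {x : Plane} {Q : Plane ≃ₗᵢ[ℝ] Plane}
    {φ : ℝ → ℝ} (hc : IsLipChart Ω r L x Q φ) (hL : 0 ≤ L) (a b : ℝ) :
    |φ a - φ b| ≤ L * |a - b| := by
  simpa [Real.dist_eq, hL] using hc.lip.dist_le_mul a b

theorem continuous_chart_coord (x : Plane) (Q : Plane ≃ₗᵢ[ℝ] Plane) (i : Fin 2) :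
    Continuous fun y : Plane => Q (y - x) i := by
  have := Q.continuous
  fun_prop

/-- The region strictly above the graph is open and misses Ω, so the closure of Ω stays below or on
the graph; conversely a graph point is the limit of the points of Ω directly beneath it along the
chart axis. -/
theorem IsLipChart.mem_frontier_iff {Ω : Set Plane} {r L : ℝ} {x : Plane}
    {Q : Plane ≃ₗᵢ[ℝ] Plane} {φ : ℝ → ℝ} (hc : IsLipChart Ω r L x Q φ) (hΩ : IsOpen Ω)
    {z : Plane} (hz : z ∈ ball x r) : z ∈ frontier Ω ↔ Q (z - x) 1 = φ (Q (z - x) 0) := by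
  rw [hΩ.frontier_eq]
  have hφ : Continuous fun y : Plane => φ (Q (y - x) 0) :=
    hc.lip.continuous.comp (continuous_chart_coord x Q 0)
  have h1 := continuous_chart_coord x Q 1
  constructor
  · rintro ⟨hcl, hn⟩
    rw [hc.mem_iff z hz, not_lt] at hn
    refine le_antisymm ?_ hn
    by_contra! hlt
    have ho : IsOpen (ball x r ∩ {y | φ (Q (y - x) 0) < Q (y - x) 1}) :=
      isOpen_ball.inter (isOpen_lt hφ h1)
    obtain ⟨y, ⟨hy, hy'⟩, hyΩ⟩ := mem_closure_iff.1 hcl _ ho ⟨hz, hlt⟩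
    rw [hc.mem_iff y hy] at hyΩ
    exact lt_asymm hyΩ hy'
  · intro he
    refine ⟨?_, by rw [hc.mem_iff z hz, he]; exact lt_irrefl _⟩
    have hlim : Tendsto (fun t : ℝ => z - t • Q.symm e2) (𝓝[>] 0) (𝓝 z) := by
      have : Continuous fun t : ℝ => z - t • Q.symm e2 := by fun_prop
      simpa using (this.tendsto 0).mono_left nhdsWithin_le_nhds
    refine mem_closure_of_tendsto hlim ?_
    filter_upwards [hlim (isOpen_ball.mem_nhds hz), self_mem_nhdsWithin] with t ht ht0
    have : Q (z - t • Q.symm e2 - x) = Q (z - x) - t • e2 := by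
      rw [sub_right_comm, map_sub, map_smul, Q.apply_symm_apply]
    rw [hc.mem_iff _ ht, this]
    have h0 : (Q (z - x) - t • e2) 0 = Q (z - x) 0 := by simp [e2]
    have h1 : (Q (z - x) - t • e2) 1 = Q (z - x) 1 - t := by simp [e2]
    rw [h0, h1, he]
    exact sub_lt_self _ ht0

theorem exists_dist_lt_of_mem_cthickening {E : Set Plane} {a b : ℝ} {y : Plane} (hb : 0 < b)
    (hab : a < b) (hy : y ∈ cthickening a E) : ∃ z ∈ E, dist y z < b :=
  mem_thickening_iff.1 (cthickening_subset_thickening' hb hab E hy)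

theorem norm_lt_of_mem_graphStrip {Ω : Set Plane} {r L : ℝ} {x : Plane} {Q : Plane ≃ₗᵢ[ℝ] Plane}
    {φ : ℝ → ℝ} (hc : IsLipChart Ω r L x Q φ) (hL : 0 < L) {a b : ℝ} {y : Plane}
    (hy : y ∈ graphStrip x Q φ a b) : dist y x ≤ (1 + L) * a + b := by
  obtain ⟨h0, h1, h2⟩ := hy
  have h3 := hc.abs_sub_le hL.le (Q (y - x) 0) 0
  rw [hc.zero, sub_zero, sub_zero] at h3
  have h4 := norm_le_abs_add_abs (Q (y - x))
  rw [Q.norm_map, ← dist_eq_norm] at h4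
  have h5 : L * |Q (y - x) 0| ≤ L * a := by gcongr
  have h6 := abs_le.1 h3
  have h7 : |Q (y - x) 1| ≤ L * a + b := abs_le.2 ⟨by linarith, by linarith⟩
  linarith

/-- The value of δ₁ is fixed by (2 + L)δ₁ = 1/8, which keeps the strip inside B_{r/8}(x). That of m₁
is fixed by (1 + L)m₁ = 1/4: moving a point by t changes its height above the graph by at most (1 +
L)t, so a move of 2m₁δr changes it by at most half the strip's half-width δr. -/
theorem geomConstants {L δ₁ δ₂ m₁ : ℝ} (hL : 0 < L) (h₁ : δ₁ = 1 / (8 * (2 + L))) (h₂ : δ₂ = δ₁)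
    (hm : m₁ = 1 / (4 * (1 + L))) : GeomConstants L δ₁ δ₂ m₁ := by
  have h1pos : 0 < δ₁ := by rw [h₁]; positivity
  have hmpos : 0 < m₁ := by rw [hm]; positivity
  have h1e : (2 + L) * δ₁ = 1 / 8 := by rw [h₁]; field_simp
  have hme : (1 + L) * m₁ = 1 / 4 := by rw [hm]; field_simp
  have h1le : δ₁ ≤ 1 / 16 := by nlinarith
  have hmle : m₁ ≤ 1 / 4 := by nlinarith
  subst h₂
  refine ⟨h1pos, by linarith, h1pos, le_rfl, hmpos, by linarith, ?_⟩
  intro r Ω x Q φ δ hr hΩ hx hc hδ hδle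
  have hsub : graphStrip x Q φ (δ₂ * r) (δ * r) ⊆ ball x (r / 2) := by
    intro y hy
    have := norm_lt_of_mem_graphStrip hc hL hy
    rw [mem_ball]
    nlinarith
  have hmδ : 2 * m₁ * δ ≤ δ / 2 := by nlinarith
  have hmδr : 2 * m₁ * δ * r ≤ δ / 2 * r := by gcongr
  -- The radius is doubled because the closed thickening of a set that is not assumed compact yields
  -- a nearby point only at any larger radius.
  have hlt : m₁ * δ * r < 2 * m₁ * δ * r := by
    have : 0 < m₁ * δ * r := by positivity
    linarith
  have hδr : δ * r ≤ δ₂ * r := by gcongr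
  have hLm : (1 + L) * (2 * m₁ * δ * r) = δ * r / 2 := by
    linear_combination (2 * δ * r) * hme
  refine ⟨hsub, ?_, ?_, ?_⟩
  · intro y hy
    -- Sliding y vertically by its height t over the graph lands on the graph, hence on the
    -- frontier, after a move of length |t| ≤ δr.
    set t : ℝ := Q (y - x) 1 - φ (Q (y - x) 0) with ht
    have habs : |t| ≤ δ * r := abs_le.2 ⟨by linarith [hy.2.1], by linarith [hy.2.2]⟩
    have hq : Q (y - t • Q.symm e2 - x) = Q (y - x) - t • e2 := by
      rw [sub_right_comm, map_sub, map_smul, Q.apply_symm_apply]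
    have hd : dist y (y - t • Q.symm e2) = |t| := by
      rw [dist_eq_norm, sub_sub_cancel, norm_smul, Q.symm.norm_map]
      simp [e2]
    refine mem_cthickening_of_dist_le y (y - t • Q.symm e2) _ _ ?_ (hd.trans_le habs)
    have hy2 := mem_ball.1 (hsub hy)
    have hz : y - t • Q.symm e2 ∈ ball x r := by
      rw [mem_ball]
      have := dist_triangle (y - t • Q.symm e2) y x
      rw [dist_comm _ y, hd] at this
      nlinarith
    rw [hc.mem_frontier_iff hΩ.isOpen hz, hq]
    simp [e2, ht]
  · intro y hy
    obtain ⟨z, ⟨hz0, hz1⟩, hyz⟩ := exists_dist_lt_of_mem_cthickening (by positivity) hlt hy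
    have h0 := (abs_chart_coord_sub_le x y z Q 0).trans hyz.le
    have h1 := (abs_chart_coord_sub_le x y z Q 1).trans hyz.le
    have h2 := hc.abs_sub_le hL.le (Q (y - x) 0) (Q (z - x) 0)
    have h3 : L * |Q (y - x) 0 - Q (z - x) 0| ≤ L * (2 * m₁ * δ * r) := by gcongr
    have h4 := abs_le.1 (h2.trans h3)
    have h1' := abs_le.1 h1
    have h0' := abs_le.1 h0
    have hz0' := abs_le.1 hz0
    have hδr0 : 0 < δ * r := by positivity
    refine ⟨abs_le.2 ⟨by linarith, by linarith⟩, ?_, ?_⟩ <;> linarith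
  · intro y hy0 hy1 hmem
    obtain ⟨z, hzf, hyz⟩ := exists_dist_lt_of_mem_cthickening (by positivity) hlt hmem
    have hδr0 : 0 < δ * r := by positivity
    have hδ2r0 : 0 < δ₂ * r := by positivity
    have hys : y ∈ graphStrip x Q φ (δ₂ * r) (δ * r) :=
      ⟨by linarith, by rcases hy1 with h | h <;> linarith, by rcases hy1 with h | h <;> linarith⟩
    have hyb := mem_ball.1 (hsub hys)
    have hz : z ∈ ball x r := by
      rw [mem_ball]
      have := dist_triangle z y x
      rw [dist_comm z y] at this
      nlinarith
    rw [hc.mem_frontier_iff hΩ.isOpen hz] at hzf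
    have h1 := (abs_chart_coord_sub_le x y z Q 1).trans hyz.le
    have h0 := (abs_chart_coord_sub_le x y z Q 0).trans hyz.le
    have h2 := hc.abs_sub_le hL.le (Q (y - x) 0) (Q (z - x) 0)
    have h3 : L * |Q (y - x) 0 - Q (z - x) 0| ≤ L * (2 * m₁ * δ * r) := by gcongr
    have h4 := abs_le.1 (h2.trans h3)
    have h1' := abs_le.1 h1
    rcases hy1 with h | h <;> linarith


/-! ### C² bounds for integrals depending on a parameter -/

section ParametricIntegrals

set_option linter.unusedSectionVars false

variable {E F Z : Type*} [NormedAddCommGroup E] [NormedSpace ℝ E] [NormedAddCommGroup F]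
  [NormedSpace ℝ F] [NormedAddCommGroup Z] [NormedSpace ℝ Z]

/-- A `C²` function which, together with its first two derivatives, is bounded by `C`. -/
structure BddC2 (C : ℝ) (f : E → F) : Prop where
  contDiff : ContDiff ℝ 2 f
  bound : ∀ x, ‖f x‖ ≤ C
  bound_fderiv : ∀ x, ‖fderiv ℝ f x‖ ≤ C
  bound_fderiv_two : ∀ x, ‖fderiv ℝ (fderiv ℝ f) x‖ ≤ C

theorem BddC2.nonneg {C : ℝ} {f : E → F} (h : BddC2 C f) : 0 ≤ C :=
  (norm_nonneg _).trans (h.bound 0)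

theorem BddC2.mono {C C' : ℝ} {f : E → F} (h : BddC2 C f) (hC : C ≤ C') : BddC2 C' f :=
  ⟨h.contDiff, fun x => (h.bound x).trans hC, fun x => (h.bound_fderiv x).trans hC,
    fun x => (h.bound_fderiv_two x).trans hC⟩

theorem BddC2.differentiable {C : ℝ} {f : E → F} (h : BddC2 C f) : Differentiable ℝ f :=
  h.contDiff.differentiable (by norm_num)

theorem BddC2.contDiff_fderiv {C : ℝ} {f : E → F} (h : BddC2 C f) : ContDiff ℝ 1 (fderiv ℝ f) :=
  h.contDiff.fderiv_right (by norm_num)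

theorem BddC2.comp_sub_right {C : ℝ} {f : E → F} (h : BddC2 C f) (a : E) :
    BddC2 C fun x => f (x - a) := by
  have h1 : fderiv ℝ (fun x => f (x - a)) = fun x => fderiv ℝ f (x - a) := by
    ext1 x; exact fderiv_comp_sub a
  refine ⟨h.contDiff.comp (contDiff_id.sub contDiff_const), fun x => h.bound _, fun x => ?_,
    fun x => ?_⟩
  · rw [h1]; exact h.bound_fderiv _
  · rw [h1, fderiv_comp_sub]; exact h.bound_fderiv_two _

theorem BddC2.mul {C D : ℝ} {f g : E → ℝ} (hf : BddC2 C f) (hg : BddC2 D g) :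
    BddC2 (4 * (C * D)) fun x => f x * g x := by
  have hC := hf.nonneg
  have hD := hg.nonneg
  have hCD : 0 ≤ C * D := mul_nonneg hC hD
  have h1 : fderiv ℝ (fun x => f x * g x) =
      fun x => f x • fderiv ℝ g x + g x • fderiv ℝ f x := by
    ext1 x; exact fderiv_fun_mul (hf.differentiable x) (hg.differentiable x)
  have hf' := hf.contDiff_fderiv.differentiable (by norm_num)
  have hg' := hg.contDiff_fderiv.differentiable (by norm_num)
  have h2 : ∀ x, fderiv ℝ (fderiv ℝ fun x => f x * g x) x =
      (f x • fderiv ℝ (fderiv ℝ g) x + (fderiv ℝ f x).smulRight (fderiv ℝ g x)) +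
      (g x • fderiv ℝ (fderiv ℝ f) x + (fderiv ℝ g x).smulRight (fderiv ℝ f x)) := by
    intro x
    rw [h1, fderiv_fun_add ((hf.differentiable x).fun_smul (hg' x))
      ((hg.differentiable x).fun_smul (hf' x)),
      fderiv_fun_smul (hf.differentiable x) (hg' x), fderiv_fun_smul (hg.differentiable x) (hf' x)]
  have e1 : ∀ x, ‖f x * g x‖ ≤ C * D := fun x => by
    rw [norm_mul]; exact mul_le_mul (hf.bound x) (hg.bound x) (norm_nonneg _) hC
  have tri : ∀ a b c d : E →L[ℝ] E →L[ℝ] ℝ, ‖a + b + (c + d)‖ ≤ ‖a‖ + ‖b‖ + (‖c‖ + ‖d‖) :=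
    fun a b c d => (norm_add_le (a + b) (c + d)).trans
      (add_le_add (norm_add_le a b) (norm_add_le c d))
  refine ⟨hf.contDiff.mul hg.contDiff, fun x => (e1 x).trans (by linarith), fun x => ?_,
    fun x => ?_⟩
  · rw [h1]
    refine (norm_add_le _ _).trans ?_
    rw [norm_smul, norm_smul, mul_comm ‖g x‖]
    have a1 := mul_le_mul (hf.bound x) (hg.bound_fderiv x) (norm_nonneg _) hC
    have a2 := mul_le_mul (hf.bound_fderiv x) (hg.bound x) (norm_nonneg _) hC
    linarith
  · rw [h2]
    refine (tri _ _ _ _).trans ?_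
    rw [norm_smul, norm_smul, ContinuousLinearMap.norm_smulRight_apply,
      ContinuousLinearMap.norm_smulRight_apply, mul_comm ‖g x‖, mul_comm ‖fderiv ℝ g x‖]
    have a1 := mul_le_mul (hf.bound x) (hg.bound_fderiv_two x) (norm_nonneg _) hC
    have a2 := mul_le_mul (hf.bound_fderiv_two x) (hg.bound x) (norm_nonneg _) hC
    have a3 := mul_le_mul (hf.bound_fderiv x) (hg.bound_fderiv x) (norm_nonneg _) hC
    linarith

variable [MeasurableSpace Z] [BorelSpace Z] [SecondCountableTopology Z] {μ : Measure Z}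

theorem integrable_smul_of_bound {w : Z → ℝ} (hw : Integrable w μ) {g : Z → F}
    (hg : Continuous g) {C : ℝ} (hC : ∀ z, ‖g z‖ ≤ C) : Integrable (fun z => w z • g z) μ :=
  (hw.smul_bdd C hg.aestronglyMeasurable (ae_of_all _ hC))

theorem norm_integral_smul_le {w : Z → ℝ} (hw : Integrable w μ) {g : Z → F}
    {C : ℝ} (hC : ∀ z, ‖g z‖ ≤ C) : ‖∫ z, w z • g z ∂μ‖ ≤ (∫ z, |w z| ∂μ) * C := by
  rw [← integral_mul_const]
  refine norm_integral_le_of_norm_le (hw.abs.mul_const C) (ae_of_all _ fun z => ?_)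
  rw [norm_smul, Real.norm_eq_abs]
  exact mul_le_mul_of_nonneg_left (hC z) (abs_nonneg _)

theorem continuous_integral_smul {w : Z → ℝ} (hw : Integrable w μ) {k : Z → E → F}
    (hk : Continuous (Function.uncurry k)) {C : ℝ} (hC : ∀ z x, ‖k z x‖ ≤ C) :
    Continuous fun x => ∫ z, w z • k z x ∂μ := by
  refine continuous_of_dominated (bound := fun z => |w z| * C) (fun x => ?_)
    (fun x => ae_of_all _ fun z => ?_) (hw.abs.mul_const C) (ae_of_all _ fun z => ?_)
  · exact (integrable_smul_of_bound hw (hk.comp (Continuous.prodMk_left x))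
      (hC · x)).aestronglyMeasurable
  · rw [norm_smul, Real.norm_eq_abs]
    exact mul_le_mul_of_nonneg_left (hC z x) (abs_nonneg _)
  · exact (hk.comp (Continuous.prodMk_right z)).const_smul _

theorem hasFDerivAt_integral_smul {w : Z → ℝ} (hw : Integrable w μ) {k : Z → E → F}
    (hk : ContDiff ℝ 1 (Function.uncurry k)) {C : ℝ} (hC : ∀ z x, ‖k z x‖ ≤ C)
    (hC' : ∀ z x, ‖fderiv ℝ (k z) x‖ ≤ C) (x : E) :
    HasFDerivAt (fun x => ∫ z, w z • k z x ∂μ) (∫ z, w z • fderiv ℝ (k z) x ∂μ) x := by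
  have hd : ∀ z, Differentiable ℝ (k z) := fun z =>
    (hk.comp (contDiff_const.prodMk contDiff_id)).differentiable (by norm_num)
  have hk' : Continuous fun z => fderiv ℝ (k z) x :=
    (hk.fderiv (contDiff_const (c := x)) (n := 0) (by norm_num)).continuous
  refine hasFDerivAt_integral_of_dominated_of_fderiv_le (s := Set.univ)
    (F' := fun x z => w z • fderiv ℝ (k z) x) (bound := fun z => |w z| * C) univ_mem
    (Eventually.of_forall fun y => ?_) ?_ ?_ (ae_of_all _ fun z y _ => ?_)
    (hw.abs.mul_const C) (ae_of_all _ fun z y _ => ?_)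
  · exact (integrable_smul_of_bound hw (hk.continuous.comp (Continuous.prodMk_left y))
      (hC · y)).aestronglyMeasurable
  · exact integrable_smul_of_bound hw (hk.continuous.comp (Continuous.prodMk_left x)) (hC · x)
  · exact (integrable_smul_of_bound hw hk' (hC' · x)).aestronglyMeasurable
  · rw [norm_smul, Real.norm_eq_abs]
    exact mul_le_mul_of_nonneg_left (hC' z y) (abs_nonneg _)
  · exact (hd z y).hasFDerivAt.const_smul _

/-- Differentiation under the integral sign, twice. The weight enters the bound only through its L¹
norm, which is what makes the C² bound of the intensity uniform over all masks. -/
theorem BddC2.integral_smul {w : Z → ℝ} (hw : Integrable w μ) {k : Z → E → F}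
    (hk : ContDiff ℝ 2 (Function.uncurry k)) {C : ℝ} (hC : ∀ z, BddC2 C (k z)) :
    BddC2 ((∫ z, |w z| ∂μ) * C) fun x => ∫ z, w z • k z x ∂μ := by
  have hk' : ContDiff ℝ 1 (Function.uncurry fun z x => fderiv ℝ (k z) x) :=
    ContDiff.fderiv (f := fun (p : Z × E) => k p.1)
      (hk.comp ((contDiff_fst.comp contDiff_fst).prodMk contDiff_snd)) contDiff_snd (by norm_num)
  have hk'' : Continuous (Function.uncurry fun z x => fderiv ℝ (fderiv ℝ (k z)) x) :=
    (ContDiff.fderiv (f := fun (p : Z × E) => fderiv ℝ (k p.1)) (n := 0)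
      (hk'.comp ((contDiff_fst.comp contDiff_fst).prodMk contDiff_snd)) contDiff_snd
      (by norm_num)).continuous
  have h1 := hasFDerivAt_integral_smul hw (hk.of_le (by norm_num)) (fun z => (hC z).bound)
    (fun z => (hC z).bound_fderiv)
  have h2 := hasFDerivAt_integral_smul hw hk' (fun z => (hC z).bound_fderiv)
    (fun z => (hC z).bound_fderiv_two)
  have e1 : fderiv ℝ (fun x => ∫ z, w z • k z x ∂μ) = fun x => ∫ z, w z • fderiv ℝ (k z) x ∂μ :=
    funext fun x => (h1 x).fderiv
  have e2 := fun x => (h2 x).fderiv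
  refine ⟨?_, fun x => norm_integral_smul_le hw fun z => (hC z).bound x, fun x => ?_, fun x => ?_⟩
  · rw [show (2 : WithTop ℕ∞) = 1 + 1 by norm_num, contDiff_succ_iff_fderiv, e1]
    refine ⟨fun x => (h1 x).differentiableAt, by simp, ?_⟩
    rw [contDiff_one_iff_fderiv]
    refine ⟨fun x => (h2 x).differentiableAt, ?_⟩
    rw [funext e2]
    exact continuous_integral_smul hw hk'' fun z => (hC z).bound_fderiv_two
  · rw [e1]; exact norm_integral_smul_le hw fun z => (hC z).bound_fderiv x
  · rw [e1, e2]; exact norm_integral_smul_le hw fun z => (hC z).bound_fderiv_two x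

end ParametricIntegrals


/-! ### The Gaussian and its tails -/

theorem gauss_pos (x : Plane) : 0 < gauss x := by
  unfold gauss; positivity

theorem hasFDerivAt_gauss (x : Plane) : HasFDerivAt gauss (-(gauss x) • innerSL ℝ x) x := by
  have h1 : HasFDerivAt (fun x : Plane => -(‖x‖ ^ 2) / 2) (-innerSL ℝ x) x := by
    have h2 := ((hasStrictFDerivAt_norm_sq x).hasFDerivAt.neg).mul_const (2⁻¹ : ℝ)
    simp only [div_eq_mul_inv]
    refine h2.congr_fderiv ?_
    ext v
    simp
  refine (h1.exp.const_mul ((2 * Real.pi)⁻¹)).congr_fderiv ?_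
  ext v
  simp [gauss]
  ring

theorem fderiv_gauss (x : Plane) : fderiv ℝ gauss x = -(gauss x) • innerSL ℝ x :=
  (hasFDerivAt_gauss x).fderiv

theorem contDiff_gauss : ContDiff ℝ ∞ gauss := by
  unfold gauss
  exact contDiff_const.mul (((contDiff_norm_sq ℝ).neg.div_const 2).exp)

theorem norm_fderiv_gauss (x : Plane) : ‖fderiv ℝ gauss x‖ = gauss x * ‖x‖ := by
  rw [fderiv_gauss, norm_smul, norm_neg, innerSL_apply_norm, Real.norm_of_nonneg (gauss_pos x).le]

theorem mul_exp_neg_sq_le (t : ℝ) : t * Real.exp (-(t ^ 2) / 8) ≤ 2 := by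
  have h := Real.add_one_le_exp (t ^ 2 / 8)
  rw [show -(t ^ 2) / 8 = -(t ^ 2 / 8) by ring, Real.exp_neg, ← div_eq_mul_inv,
    div_le_iff₀ (Real.exp_pos _)]
  nlinarith [sq_nonneg (t - 2)]

/-- A Gaussian dominating `G` and `∇G`. -/
noncomputable def wideGauss (x : Plane) : ℝ := Real.exp (-(‖x‖ ^ 2) / 8)

theorem wideGauss_nonneg (x : Plane) : 0 ≤ wideGauss x := (Real.exp_pos _).le

theorem wideGauss_eq : wideGauss = fun x : Plane => Real.exp (-(1 / 8) * ‖x‖ ^ 2) := by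
  funext x; unfold wideGauss; congr 1; ring

theorem integrable_wideGauss : Integrable wideGauss := by
  rw [wideGauss_eq]
  have h := GaussianFourier.integrable_cexp_neg_mul_sq_norm_add (V := Plane) (b := (1 / 8 : ℂ))
    (by norm_num) 0 0
  refine (h.norm).congr (ae_of_all _ fun x => ?_)
  simp only [Complex.norm_exp]
  congr 1
  have : (-(1 / 8 : ℂ) * (‖x‖ : ℂ) ^ 2) = ((-(1 / 8) * ‖x‖ ^ 2 : ℝ) : ℂ) := by push_cast; ring
  simp only [zero_mul, add_zero]
  rw [this, Complex.ofReal_re]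

theorem integral_wideGauss : ∫ x, wideGauss x = 8 * Real.pi := by
  rw [wideGauss_eq, GaussianFourier.integral_rexp_neg_mul_sq_norm (by norm_num)]
  simp
  ring

theorem integral_gauss : ∫ x, gauss x = 1 := by
  have h : gauss = fun x : Plane => (2 * Real.pi)⁻¹ * Real.exp (-(1 / 2) * ‖x‖ ^ 2) := by
    funext x; unfold gauss; congr 2; ring
  rw [h, integral_const_mul, GaussianFourier.integral_rexp_neg_mul_sq_norm (by norm_num)]
  have := Real.pi_ne_zero
  simp
  field_simp

theorem gauss_le_of_le_norm {a : ℝ} (ha : 0 ≤ a) {x : Plane} (hx : a ≤ ‖x‖) :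
    gauss x ≤ Real.exp (-(a ^ 2) / 4) * wideGauss x := by
  have hpi : (2 * Real.pi)⁻¹ ≤ 1 := inv_le_one_of_one_le₀ (by linarith [Real.pi_gt_three])
  have h1 : a ^ 2 ≤ ‖x‖ ^ 2 := by gcongr
  unfold gauss wideGauss
  rw [← Real.exp_add]
  calc (2 * Real.pi)⁻¹ * Real.exp (-(‖x‖ ^ 2) / 2) ≤ 1 * Real.exp (-(‖x‖ ^ 2) / 2) := by gcongr
    _ ≤ _ := by
      rw [one_mul]
      refine Real.exp_le_exp.2 ?_
      nlinarith

/-- The exponent 1/2 is split as 1/8 + 1/4 + 1/8: the first factor absorbs |x|, the second gives the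
decay in a, and the third remains as an integrable majorant. -/
theorem gauss_mul_norm_le_of_le_norm {a : ℝ} (ha : 0 ≤ a) {x : Plane} (hx : a ≤ ‖x‖) :
    gauss x * ‖x‖ ≤ Real.exp (-(a ^ 2) / 4) * wideGauss x := by
  have hpi : (2 * Real.pi)⁻¹ * 2 ≤ 1 := by
    rw [mul_inv, mul_comm, mul_inv_cancel_left₀ two_ne_zero]
    exact inv_le_one_of_one_le₀ (by linarith [Real.pi_gt_three])
  have h1 : a ^ 2 ≤ ‖x‖ ^ 2 := by gcongr
  have h2 := mul_exp_neg_sq_le ‖x‖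
  have h3 : Real.exp (-(‖x‖ ^ 2) / 2) =
      Real.exp (-(‖x‖ ^ 2) / 8) * Real.exp (-(‖x‖ ^ 2) / 4) * Real.exp (-(‖x‖ ^ 2) / 8) := by
    rw [← Real.exp_add, ← Real.exp_add]; congr 1; ring
  unfold gauss wideGauss
  rw [h3]
  calc _ = ((2 * Real.pi)⁻¹ * (‖x‖ * Real.exp (-(‖x‖ ^ 2) / 8))) *
        (Real.exp (-(‖x‖ ^ 2) / 4) * Real.exp (-(‖x‖ ^ 2) / 8)) := by ring
    _ ≤ ((2 * Real.pi)⁻¹ * 2) * (Real.exp (-(a ^ 2) / 4) * Real.exp (-(‖x‖ ^ 2) / 8)) := by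
      gcongr
    _ ≤ 1 * (Real.exp (-(a ^ 2) / 4) * Real.exp (-(‖x‖ ^ 2) / 8)) := by gcongr
    _ = _ := one_mul _

theorem gauss_le_wideGauss (x : Plane) : gauss x ≤ wideGauss x := by
  simpa using gauss_le_of_le_norm le_rfl (norm_nonneg x)

theorem gauss_mul_norm_le_wideGauss (x : Plane) : gauss x * ‖x‖ ≤ wideGauss x := by
  simpa using gauss_mul_norm_le_of_le_norm le_rfl (norm_nonneg x)

theorem wideGauss_le_one (x : Plane) : wideGauss x ≤ 1 :=
  Real.exp_le_one_iff.2 (by have := sq_nonneg ‖x‖; linarith)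

theorem integrable_gauss : Integrable gauss :=
  integrable_wideGauss.mono' contDiff_gauss.continuous.aestronglyMeasurable
    (ae_of_all _ fun x => by
      rw [Real.norm_of_nonneg (gauss_pos x).le]; exact gauss_le_wideGauss x)

theorem continuous_fderiv_gauss : Continuous (fderiv ℝ gauss) :=
  contDiff_gauss.continuous_fderiv (by simp)

theorem integrable_fderiv_gauss : Integrable (fderiv ℝ gauss) :=
  integrable_wideGauss.mono' continuous_fderiv_gauss.aestronglyMeasurable
    (ae_of_all _ fun x => by rw [norm_fderiv_gauss]; exact gauss_mul_norm_le_wideGauss x)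

theorem norm_gauss_le_one (x : Plane) : ‖gauss x‖ ≤ 1 := by
  rw [Real.norm_of_nonneg (gauss_pos x).le]
  exact (gauss_le_wideGauss x).trans (wideGauss_le_one x)

theorem norm_fderiv_gauss_le_one (x : Plane) : ‖fderiv ℝ gauss x‖ ≤ 1 := by
  rw [norm_fderiv_gauss]
  exact (gauss_mul_norm_le_wideGauss x).trans (wideGauss_le_one x)

theorem setIntegral_le_of_le_wideGauss {a : ℝ} {f : Plane → ℝ} (hf : Integrable f)
    (h : ∀ x, a ≤ ‖x‖ → f x ≤ Real.exp (-(a ^ 2) / 4) * wideGauss x) :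
    ∫ x in (ball (0 : Plane) a)ᶜ, f x ≤ 8 * Real.pi * Real.exp (-(a ^ 2) / 4) := by
  have hw : Integrable fun x : Plane => Real.exp (-(a ^ 2) / 4) * wideGauss x :=
    integrable_wideGauss.const_mul _
  calc ∫ x in (ball (0 : Plane) a)ᶜ, f x
      ≤ ∫ x in (ball (0 : Plane) a)ᶜ, Real.exp (-(a ^ 2) / 4) * wideGauss x := by
        refine setIntegral_mono_on hf.integrableOn hw.integrableOn
          measurableSet_ball.compl fun x hx => h x ?_
        simpa using hx
    _ ≤ ∫ x : Plane, Real.exp (-(a ^ 2) / 4) * wideGauss x :=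
        setIntegral_le_integral hw
          (ae_of_all _ fun x => mul_nonneg (Real.exp_pos _).le (wideGauss_nonneg x))
    _ = _ := by rw [integral_const_mul, integral_wideGauss]; ring

theorem gauss_tail_le {a : ℝ} (ha : 0 ≤ a) :
    ∫ x in (ball (0 : Plane) a)ᶜ, gauss x ≤ 8 * Real.pi * Real.exp (-(a ^ 2) / 4) :=
  setIntegral_le_of_le_wideGauss integrable_gauss fun _ hx => gauss_le_of_le_norm ha hx

theorem gauss_mul_norm_tail_le {a : ℝ} (ha : 0 ≤ a) :
    ∫ x in (ball (0 : Plane) a)ᶜ, gauss x * ‖x‖ ≤ 8 * Real.pi * Real.exp (-(a ^ 2) / 4) :=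
  setIntegral_le_of_le_wideGauss
    (integrable_fderiv_gauss.norm.congr (ae_of_all _ fun x => norm_fderiv_gauss x))
    fun _ hx => gauss_mul_norm_le_of_le_norm ha hx


/-! ### The Gaussian blur of a Lipschitz domain -/

theorem hasFDerivAt_setIntegral_sub {F : Type*} [NormedAddCommGroup F] [NormedSpace ℝ F]
    {D : Set Plane} (hD : volume D ≠ ⊤) {g : Plane → F} (hg : ContDiff ℝ 1 g) {C : ℝ}
    (hC : ∀ x, ‖g x‖ ≤ C) (hC' : ∀ x, ‖fderiv ℝ g x‖ ≤ C) (x : Plane) :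
    HasFDerivAt (fun x => ∫ z in D, g (x - z)) (∫ z in D, fderiv ℝ g (x - z)) x := by
  have : IsFiniteMeasure (volume.restrict D) := ⟨by simpa using hD.lt_top⟩
  have h1 : ∀ z x, fderiv ℝ (fun x => g (x - z)) x = fderiv ℝ g (x - z) := fun z x =>
    fderiv_comp_sub z
  have h := hasFDerivAt_integral_smul (μ := volume.restrict D) (w := fun _ => 1)
    (integrable_const 1) (k := fun z x => g (x - z))
    (hg.comp (contDiff_snd.sub contDiff_fst)) (C := C) (fun z x => hC _)
    (fun z x => by rw [h1]; exact hC' _) x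
  simpa only [one_smul, h1] using h

theorem fderiv_blur {D : Set Plane} (hD : volume D ≠ ⊤) (x : Plane) :
    fderiv ℝ (blur D) x = ∫ z in D, fderiv ℝ gauss (x - z) :=
  (hasFDerivAt_setIntegral_sub hD (contDiff_gauss.of_le (by simp)) norm_gauss_le_one
    norm_fderiv_gauss_le_one x).fderiv

theorem IsLipDomain.volume_ne_top {D : Set Plane} {r L : ℝ} (hD : IsLipDomain D r L) :
    volume D ≠ ⊤ := hD.isBounded.measure_lt_top.ne

theorem integrable_gauss_sub (x : Plane) : Integrable fun z => gauss (x - z) :=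
  integrable_gauss.comp_sub_left x

theorem setIntegral_gauss_sub_compl_ball (x : Plane) (a : ℝ) :
    ∫ z in (ball x a)ᶜ, gauss (x - z) = ∫ w in (ball (0 : Plane) a)ᶜ, gauss w := by
  rw [← integral_indicator measurableSet_ball.compl, ← integral_indicator measurableSet_ball.compl,
    ← integral_sub_left_eq_self (fun w => (ball (0 : Plane) a)ᶜ.indicator gauss w) volume x]
  refine integral_congr_ae (ae_of_all _ fun z => ?_)
  classical
  simp only [Set.indicator_apply, Set.mem_compl_iff, mem_ball, dist_eq_norm, sub_zero,
    norm_sub_rev z x]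

/-- A disc about x that misses the frontier is connected, so it lies in D or outside the closure of
D. The blur at x then differs from 1 or from 0 by at most the Gaussian mass outside the disc. -/
theorem mem_cthickening_of_blur {D : Set Plane} (hD : IsOpen D) {h d : ℝ}
    (hd : 0 ≤ d) (hh : 8 * Real.pi * Real.exp (-(d ^ 2) / 4) ≤ h) {x : Plane}
    (h1 : h < blur D x) (h2 : blur D x < 1 - h) : x ∈ cthickening d (frontier D) := by
  by_contra hx
  have htail := (setIntegral_gauss_sub_compl_ball x d).trans_le ((gauss_tail_le hd).trans hh)
  have hint := integrable_gauss_sub x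
  have hnn : ∀ z, 0 ≤ gauss (x - z) := fun z => (gauss_pos _).le
  have hsub : ball x d ⊆ D ∪ (closure D)ᶜ := by
    intro z hz
    by_contra hz'
    rw [Set.mem_union, not_or, Set.mem_compl_iff, not_not] at hz'
    refine hx (mem_cthickening_of_dist_le x z d _ ?_ (by rw [dist_comm]; exact (mem_ball.1 hz).le))
    rw [hD.frontier_eq]
    exact ⟨hz'.2, hz'.1⟩
  rcases (convex_ball x d).isPreconnected.subset_or_subset hD isClosed_closure.isOpen_compl
    (Set.disjoint_left.2 fun z hz hz' => hz' (subset_closure hz)) hsub with hs | hs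
  · have e1 := integral_add_compl (measurableSet_ball (x := x) (ε := d)) hint
    have e2 : ∫ z, gauss (x - z) = 1 :=
      (integral_sub_left_eq_self gauss volume x).trans integral_gauss
    have e3 : ∫ z in ball x d, gauss (x - z) ≤ blur D x :=
      setIntegral_mono_set hint.integrableOn (ae_of_all _ hnn) (ae_of_all _ hs)
    linarith
  · have hs' : D ⊆ (ball x d)ᶜ := fun z hz hz' => hs hz' (subset_closure hz)
    have e3 : blur D x ≤ ∫ z in (ball x d)ᶜ, gauss (x - z) :=
      setIntegral_mono_set hint.integrableOn (ae_of_all _ hnn) (ae_of_all _ hs')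
    linarith

theorem integral_Ioi_mul_exp_neg_sq (a : ℝ) :
    ∫ s in Set.Ioi a, s * Real.exp (-(s ^ 2) / 2) = Real.exp (-(a ^ 2) / 2) := by
  have hd : ∀ s ∈ Set.Ici a, HasDerivAt (fun s => -Real.exp (-(s ^ 2) / 2))
      (s * Real.exp (-(s ^ 2) / 2)) s := by
    intro s _
    have h := ((((hasDerivAt_id s).pow 2).neg.div_const 2).exp).neg
    refine h.congr_deriv ?_
    simp
    ring
  have hi : Integrable fun s : ℝ => s * Real.exp (-(s ^ 2) / 2) := by
    refine (integrable_mul_exp_neg_mul_sq (b := 1 / 2) (by norm_num)).congr (ae_of_all _ fun s => ?_)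
    simp only
    congr 2
    ring
  have hl : Tendsto (fun s : ℝ => -Real.exp (-(s ^ 2) / 2)) atTop (𝓝 0) := by
    have : Tendsto (fun s : ℝ => -(s ^ 2) / 2) atTop atBot := by
      have h2 := (tendsto_pow_atTop (α := ℝ) two_ne_zero).atTop_div_const (r := 2) (by norm_num)
      refine (tendsto_neg_atTop_atBot.comp h2).congr fun s => ?_
      simp only [Function.comp_apply]
      ring
    simpa using (Real.tendsto_exp_atBot.comp this).neg
  rw [integral_Ioi_of_hasDerivAt_of_tendsto' hd hi.integrableOn hl]
  ring

theorem measurePreserving_coord :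
    MeasurePreserving (fun w : Plane => (w 0, w 1)) volume (volume.prod volume) :=
  (volume_preserving_finTwoArrow ℝ).comp (PiLp.volume_preserving_ofLp (Fin 2))

theorem measurableEmbedding_coord : MeasurableEmbedding fun w : Plane => (w 0, w 1) :=
  (MeasurableEquiv.finTwoArrow (α := ℝ)).measurableEmbedding.comp
    (MeasurableEquiv.toLp 2 (Fin 2 → ℝ)).symm.measurableEmbedding

theorem gauss_eq_mul (w : Plane) : gauss w =
    (2 * Real.pi)⁻¹ * (Real.exp (-(w 0 ^ 2) / 2) * Real.exp (-(w 1 ^ 2) / 2)) := by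
  rw [gauss, EuclideanSpace.norm_sq_eq, ← Real.exp_add]
  simp only [Fin.sum_univ_two, Real.norm_eq_abs, sq_abs]
  congr 2
  ring

theorem integrable_coord_mul_gauss : Integrable fun w : Plane => w 1 * gauss w := by
  refine integrable_wideGauss.mono' ?_ (ae_of_all _ fun x => ?_)
  · have := contDiff_gauss.continuous
    exact Continuous.aestronglyMeasurable (by fun_prop)
  · rw [norm_mul, Real.norm_of_nonneg (gauss_pos x).le, mul_comm]
    exact (mul_le_mul_of_nonneg_left (abs_coord_le_norm x 1) (gauss_pos x).le).trans
      (gauss_mul_norm_le_wideGauss x)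

/-- The inner integral in the vertical variable is exact, because s·exp(-s²/2) is a derivative: it
leaves exp(-ψ(t)²/2), a positive integrand in t. Only |t| ≤ 1 is kept, an interval of length 2. -/
theorem le_flux_gauss {ψ : ℝ → ℝ} (hψ : Continuous ψ) {B : ℝ} (hB : ∀ t, |t| ≤ 1 → |ψ t| ≤ B) :
    Real.pi⁻¹ * Real.exp (-(1 + B ^ 2) / 2) ≤
      ∫ w in {w : Plane | ψ (w 0) < w 1}, w 1 * gauss w := by
  let f : ℝ × ℝ → ℝ := fun p => {p : ℝ × ℝ | ψ p.1 < p.2}.indicator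
    (fun p => p.2 * ((2 * Real.pi)⁻¹ * (Real.exp (-(p.1 ^ 2) / 2) * Real.exp (-(p.2 ^ 2) / 2)))) p
  have hm : MeasurableSet {w : Plane | ψ (w 0) < w 1} := by
    have : Continuous fun w : Plane => ψ (w 0) := hψ.comp (by fun_prop)
    exact measurableSet_lt this.measurable (by fun_prop)
  have hfc : (fun w : Plane => f (w 0, w 1)) =
      {w : Plane | ψ (w 0) < w 1}.indicator fun w => w 1 * gauss w := by
    funext w
    simp only [f, Set.indicator_apply, Set.mem_ofPred_eq, gauss_eq_mul]
  have hfi : Integrable f (volume.prod volume) := by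
    rw [← measurePreserving_coord.integrable_comp_emb measurableEmbedding_coord]
    change Integrable (fun w : Plane => f (w 0, w 1))
    rw [hfc]
    exact integrable_coord_mul_gauss.indicator hm
  have hinner : ∀ t, ∫ s, f (t, s) =
      (2 * Real.pi)⁻¹ * (Real.exp (-(t ^ 2) / 2) * Real.exp (-(ψ t ^ 2) / 2)) := by
    intro t
    rw [← integral_Ioi_mul_exp_neg_sq (ψ t), ← integral_const_mul, ← integral_const_mul,
      ← integral_indicator measurableSet_Ioi]
    refine integral_congr_ae (ae_of_all _ fun s => ?_)
    simp only [f, Set.indicator_apply, Set.mem_ofPred_eq, Set.mem_Ioi]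
    split_ifs <;> ring
  rw [← integral_indicator hm, ← hfc,
    measurePreserving_coord.integral_comp measurableEmbedding_coord f, integral_prod _ hfi]
  have hF := hfi.integral_prod_left
  simp only [hinner] at hF ⊢
  calc Real.pi⁻¹ * Real.exp (-(1 + B ^ 2) / 2)
      = ∫ t in Set.Icc (-1 : ℝ) 1, (2 * Real.pi)⁻¹ * Real.exp (-(1 + B ^ 2) / 2) := by
        rw [setIntegral_const]
        simp
        ring
    _ ≤ ∫ t in Set.Icc (-1 : ℝ) 1,
          (2 * Real.pi)⁻¹ * (Real.exp (-(t ^ 2) / 2) * Real.exp (-(ψ t ^ 2) / 2)) := by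
        refine setIntegral_mono_on (integrableOn_const (by simp)) hF.integrableOn measurableSet_Icc fun t ht => ?_
        rw [← Real.exp_add]
        have ht1 : |t| ≤ 1 := abs_le.2 ht
        have h1 : t ^ 2 ≤ 1 := by rw [← sq_abs]; nlinarith [abs_nonneg t]
        have h2 : ψ t ^ 2 ≤ B ^ 2 := by rw [← sq_abs]; gcongr; exact hB t ht1
        gcongr
        linarith
    _ ≤ _ := setIntegral_le_integral hF (ae_of_all _ fun t => by positivity)

theorem measurePreserving_rotate_sub (Q : Plane ≃ₗᵢ[ℝ] Plane) (y : Plane) :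
    MeasurePreserving (fun z : Plane => Q (y - z)) :=
  Q.measurePreserving.comp (Measure.measurePreserving_sub_left volume y)

theorem measurableEmbedding_rotate_sub (Q : Plane ≃ₗᵢ[ℝ] Plane) (y : Plane) :
    MeasurableEmbedding fun z : Plane => Q (y - z) :=
  Q.toHomeomorph.measurableEmbedding.comp (Homeomorph.subLeft y).measurableEmbedding

theorem fderiv_gauss_apply_neg_symm_e2 (Q : Plane ≃ₗᵢ[ℝ] Plane) (w : Plane) :
    fderiv ℝ gauss w (-(Q.symm e2)) = Q w 1 * gauss w := by
  have : inner ℝ w (Q.symm e2) = Q w 1 := by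
    rw [← Q.inner_map_map, Q.apply_symm_apply, e2, EuclideanSpace.inner_single_right]
    simp
  rw [fderiv_gauss]
  simp [this]
  ring

theorem gauss_isometry (Q : Plane ≃ₗᵢ[ℝ] Plane) (w : Plane) : gauss (Q w) = gauss w := by
  simp [gauss]

/-- Inside B_{R₀}(x) the domain is the subgraph of φ, and y is within R₀/2 of x. Replacing D by the
full subgraph therefore changes the integral only where |y - z| ≥ R₀/2, at the cost of a Gaussian
tail, and for the full subgraph `le_flux_gauss` applies in the chart's coordinates. -/
theorem le_fderiv_blur {D : Set Plane} {R₀ L δ₁ δ₂ b : ℝ} (hL : 0 < L) (hR : 1 ≤ R₀)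
    (hδ : (1 + L) * δ₁ + δ₂ / 4 ≤ 1 / 2)
    (hD : IsLipDomain D R₀ L) {x : Plane} {Q : Plane ≃ₗᵢ[ℝ] Plane}
    {φ : ℝ → ℝ} (hc : IsLipChart D R₀ L x Q φ) {y : Plane}
    (hy : y ∈ graphStrip x Q φ (δ₁ * R₀) (δ₂ / 4 * R₀))
    (hb : b = Real.pi⁻¹ * Real.exp (-(1 + (δ₂ / 4 * R₀ + L) ^ 2) / 2)) :
    b - 8 * Real.pi * Real.exp (-((R₀ / 2) ^ 2) / 4) ≤ fderiv ℝ (blur D) y (-(Q.symm e2)) := by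
  have hyx := norm_lt_of_mem_graphStrip hc hL hy
  have hyx' : dist y x ≤ R₀ / 2 := by nlinarith
  have hi' : Integrable fun z => fderiv ℝ gauss (y - z) := integrable_fderiv_gauss.comp_sub_left y
  rw [fderiv_blur hD.volume_ne_top, ContinuousLinearMap.integral_apply hi'.integrableOn]
  simp only [fderiv_gauss_apply_neg_symm_e2]
  set F : Plane → ℝ := fun z => Q (y - z) 1 * gauss (y - z) with hF
  have hFi : Integrable F := by
    have h := (measurePreserving_rotate_sub Q y).integrable_comp_of_integrable
      integrable_coord_mul_gauss
    simpa only [Function.comp_def, gauss_isometry] using h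
  set S : Set Plane := {z | Q (z - x) 1 < φ (Q (z - x) 0)} with hS
  have hφ : Continuous fun y : Plane => φ (Q (y - x) 0) :=
    hc.lip.continuous.comp (continuous_chart_coord x Q 0)
  have hSm : MeasurableSet S :=
    measurableSet_lt (continuous_chart_coord x Q 1).measurable hφ.measurable
  have hDm := hD.isOpen.measurableSet
  -- In the variable w = Q(y - z), the condition that z lies below the graph of φ becomes ψ(w 0) < w
  -- 1.
  set ψ : ℝ → ℝ := fun t => Q (y - x) 1 - φ (Q (y - x) 0 - t) with hψ
  have hψc : Continuous ψ := by
    have := hc.lip.continuous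
    fun_prop
  have hψB : ∀ t, |t| ≤ 1 → |ψ t| ≤ δ₂ / 4 * R₀ + L := by
    intro t ht
    have h1 := hc.abs_sub_le hL.le (Q (y - x) 0) (Q (y - x) 0 - t)
    rw [sub_sub_cancel] at h1
    have h2 : L * |t| ≤ L * 1 := by gcongr
    have h3 := abs_le.1 (h1.trans h2)
    obtain ⟨_, h4, h5⟩ := hy
    exact abs_le.2 ⟨by simp only [hψ]; linarith, by simp only [hψ]; linarith⟩
  have hflux := le_flux_gauss hψc hψB
  have hSF : ∫ z in S, F z = ∫ w in {w : Plane | ψ (w 0) < w 1}, w 1 * gauss w := by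
    have h := (measurePreserving_rotate_sub Q y).setIntegral_preimage_emb
      (measurableEmbedding_rotate_sub Q y) (fun w => w 1 * gauss w) {w : Plane | ψ (w 0) < w 1}
    rw [← h]
    have hpre : (fun z : Plane => Q (y - z)) ⁻¹' {w : Plane | ψ (w 0) < w 1} = S := by
      ext z
      simp only [Set.mem_preimage, Set.mem_ofPred_eq, hS, hψ]
      have e : ∀ i, Q (z - x) i = Q (y - x) i - Q (y - z) i := fun i => by
        have : Q (z - x) = Q (y - x) - Q (y - z) := by rw [← map_sub, sub_sub_sub_cancel_left]
        rw [this]; rfl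
      rw [e 0, e 1]
      constructor <;> intro h <;> linarith
    rw [hpre]
    simp only [gauss_isometry, hF]
  have hdiff : |(∫ z in D, F z) - ∫ z in S, F z| ≤
      8 * Real.pi * Real.exp (-((R₀ / 2) ^ 2) / 4) := by
    rw [← integral_indicator hDm, ← integral_indicator hSm,
      ← integral_sub (hFi.indicator hDm) (hFi.indicator hSm)]
    have hgn : Integrable fun w : Plane => gauss w * ‖w‖ :=
      integrable_fderiv_gauss.norm.congr (ae_of_all _ fun x => norm_fderiv_gauss x)
    refine le_trans ?_ (gauss_mul_norm_tail_le (a := R₀ / 2) (by linarith))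
    rw [← integral_indicator measurableSet_ball.compl,
      ← integral_sub_left_eq_self (fun w => (ball (0 : Plane) (R₀ / 2))ᶜ.indicator
        (fun w => gauss w * ‖w‖) w) volume y]
    rw [← Real.norm_eq_abs]
    refine norm_integral_le_of_norm_le
      ((hgn.indicator measurableSet_ball.compl).comp_sub_left y) (ae_of_all _ fun z => ?_)
    by_cases hz : z ∈ ball x R₀
    · have hDS : z ∈ D ↔ z ∈ S := hc.mem_iff z hz
      have : D.indicator F z - S.indicator F z = 0 := by
        classical simp only [Set.indicator_apply, hDS, sub_self]
      rw [this, norm_zero]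
      exact Set.indicator_nonneg (fun w _ => mul_nonneg (gauss_pos w).le (norm_nonneg w)) _
    · have hz' : y - z ∈ (ball (0 : Plane) (R₀ / 2))ᶜ := by
        rw [Set.mem_compl_iff, mem_ball_zero_iff, ← dist_eq_norm]
        intro h
        apply hz
        rw [mem_ball]
        have := dist_triangle z y x
        rw [dist_comm z y] at this
        linarith
      rw [Set.indicator_of_mem hz']
      have hFz : ‖F z‖ ≤ gauss (y - z) * ‖y - z‖ := by
        simp only [hF]
        rw [norm_mul, Real.norm_of_nonneg (gauss_pos _).le, mul_comm]
        refine mul_le_mul_of_nonneg_left ?_ (gauss_pos _).le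
        have := abs_coord_le_norm (Q (y - z)) 1
        rwa [Q.norm_map] at this
      refine le_trans ?_ hFz
      classical
      simp only [Set.indicator_apply]
      split_ifs <;> simp
  have := (abs_le.1 hdiff).1
  linarith

theorem exists_forall_ge_exp_neg_sq_le {c : ℝ} (hc : 0 < c) (K : ℝ) {ε : ℝ} (hε : 0 < ε) :
    ∃ R₁ : ℝ, ∀ R, R₁ ≤ R → K * Real.exp (-(c * R ^ 2)) ≤ ε := by
  have h1 : Tendsto (fun R : ℝ => c * R ^ 2) atTop atTop :=
    (tendsto_pow_atTop two_ne_zero).const_mul_atTop hc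
  have h2 := (Real.tendsto_exp_neg_atTop_nhds_zero.comp h1).const_mul K
  rw [mul_zero] at h2
  exact eventually_atTop.1 (h2.eventually (ge_mem_nhds hε))

/-- The flux bound b itself decays with R₀, since the strip has width proportional to R₀. The tail
exp(-R₀²/16) still wins: (δ₂R₀/4 + L)² ≤ 2(δ₂R₀/4)² + 2L² and δ₂ ≤ 1/2 bound the decay of b by
exp(-R₀²/32) up to a constant depending on L. -/
theorem exists_gaussConstants {L δ₁ δ₂ m₁ : ℝ} (hL : 0 < L) (hδ₂ : 0 < δ₂) (hm₁ : 0 < m₁)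
    (hδ₂' : δ₂ ≤ 1 / 2) (hδ : (1 + L) * δ₁ + δ₂ / 4 ≤ 1 / 2) :
    ∃ R₀ h' a₁ : ℝ, GaussConstants L δ₁ δ₂ m₁ R₀ h' a₁ := by
  have hpi := Real.pi_pos
  obtain ⟨R₁, hR₁⟩ := exists_forall_ge_exp_neg_sq_le (c := (m₁ * (δ₂ / 4)) ^ 2 / 4) (by positivity)
    (8 * Real.pi) (ε := 1 / 24) (by norm_num)
  obtain ⟨R₂, hR₂⟩ := exists_forall_ge_exp_neg_sq_le (c := 1 / 32) (by norm_num)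
    (8 * Real.pi) (ε := Real.pi⁻¹ * Real.exp (-(1 + 2 * L ^ 2) / 2) / 24) (by positivity)
  set R₀ : ℝ := max 1 (max R₁ R₂) with hR₀
  have h1 : 1 ≤ R₀ := le_max_left _ _
  set b : ℝ := Real.pi⁻¹ * Real.exp (-(1 + (δ₂ / 4 * R₀ + L) ^ 2) / 2) with hb
  have hbpos : 0 < b := by positivity
  have htail : 8 * Real.pi * Real.exp (-((R₀ / 2) ^ 2) / 4) ≤ b / 24 := by
    have h2 := hR₂ R₀ ((le_max_right _ _).trans (le_max_right _ _))
    have h3 : Real.exp (-((R₀ / 2) ^ 2) / 4) =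
        Real.exp (-(1 / 32 * R₀ ^ 2)) * Real.exp (-(1 / 32 * R₀ ^ 2)) := by
      rw [← Real.exp_add]; congr 1; ring
    have h4 : Real.pi⁻¹ * Real.exp (-(1 + 2 * L ^ 2) / 2) * Real.exp (-(1 / 32 * R₀ ^ 2)) ≤ b := by
      rw [mul_assoc, ← Real.exp_add, hb]
      gcongr
      nlinarith [sq_nonneg (δ₂ / 4 * R₀ - L), mul_le_mul hδ₂' hδ₂' hδ₂.le (by norm_num),
        sq_nonneg R₀, mul_nonneg (sub_nonneg.2 (mul_le_mul hδ₂' hδ₂' hδ₂.le (by norm_num)))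
          (sq_nonneg R₀)]
    rw [h3, ← mul_assoc]
    have h5 := mul_le_mul_of_nonneg_right h2 (Real.exp_pos (-(1 / 32 * R₀ ^ 2))).le
    linarith
  -- With a₁ = b/2 the tail bound b/24 is exactly a₁/12, and the gradient bound b - b/24 exceeds a₁.
  refine ⟨R₀, 1 / 24, b / 2, h1, by norm_num, le_rfl, by positivity, ?_, ?_, ?_⟩
  · intro D hD x hx1 hx2
    refine mem_cthickening_of_blur hD.isOpen (by positivity) ?_ hx1 hx2
    have := hR₁ R₀ ((le_max_left _ _).trans (le_max_right _ _))
    convert this using 3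
    ring
  · intro D hD x _ Q φ hc y hy
    have := le_fderiv_blur hL h1 hδ hD hc hy hb
    linarith
  · have hgn : Integrable fun w : Plane => gauss w * ‖w‖ :=
      integrable_fderiv_gauss.norm.congr (ae_of_all _ fun x => norm_fderiv_gauss x)
    have e : ∀ x : Plane, ‖fderiv ℝ gauss x‖ₑ = ENNReal.ofReal (gauss x * ‖x‖) := fun x => by
      rw [← norm_fderiv_gauss, ofReal_norm]
    simp only [e]
    rw [← ofReal_integral_eq_lintegral_ofReal hgn.integrableOn
      (ae_of_all _ fun x => mul_nonneg (gauss_pos x).le (norm_nonneg x))]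
    refine ENNReal.ofReal_le_ofReal ?_
    have := gauss_mul_norm_tail_le (a := R₀ / 2) (by linarith)
    linarith


/-! ### Total variation and integration by parts -/

section TotalVariation

variable {D : Set Plane} {u : Plane → ℝ} {X : Plane → Plane}

theorem le_totalVar (h1 : ContDiff ℝ 1 X) (h2 : HasCompactSupport X) (h3 : tsupport X ⊆ D)
    (h4 : ∀ x, ‖X x‖ ≤ 1) :
    ENNReal.ofReal (∫ x in D, u x * divergence X x) ≤ totalVar D u :=
  le_iSup_of_le X (le_iSup_of_le h1 (le_iSup_of_le h2 (le_iSup_of_le h3 (le_iSup_of_le h4 le_rfl))))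

theorem totalVar_le {a : ℝ} (h : ∀ X : Plane → Plane, ContDiff ℝ 1 X → HasCompactSupport X →
    tsupport X ⊆ D → (∀ x, ‖X x‖ ≤ 1) → ∫ x in D, u x * divergence X x ≤ a) :
    totalVar D u ≤ ENNReal.ofReal a :=
  iSup_le fun X => iSup_le fun h1 => iSup_le fun h2 => iSup_le fun h3 => iSup_le fun h4 =>
    ENNReal.ofReal_le_ofReal (h X h1 h2 h3 h4)

theorem fderiv_coord (hX : ContDiff ℝ 1 X) (x v : Plane) (i : Fin 2) :
    fderiv ℝ (fun y => X y i) x v = fderiv ℝ X x v i := by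
  have h := (EuclideanSpace.proj (𝕜 := ℝ) i).hasFDerivAt.comp x
    (hX.differentiable (by norm_num) x).hasFDerivAt
  have h' : HasFDerivAt (fun y => X y i)
    ((EuclideanSpace.proj (𝕜 := ℝ) i).comp (fderiv ℝ X x)) x := h
  rw [h'.fderiv]
  rfl

theorem continuous_divergence (hX : ContDiff ℝ 1 X) : Continuous (divergence X) := by
  have := hX.continuous_fderiv (by norm_num)
  unfold divergence
  fun_prop

theorem divergence_eq_zero {x : Plane} (hx : x ∉ tsupport X) : divergence X x = 0 := by
  have : fderiv ℝ X x = 0 := by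
    by_contra h
    exact hx (support_fderiv_subset ℝ h)
  simp [divergence, this]

theorem hasCompactSupport_divergence (hX : HasCompactSupport X) :
    HasCompactSupport (divergence X) :=
  HasCompactSupport.intro hX fun _ hx => divergence_eq_zero hx

theorem abs_divergence_le (x : Plane) : |divergence X x| ≤ 2 * ‖fderiv ℝ X x‖ := by
  have h : ∀ i : Fin 2, |fderiv ℝ X x (EuclideanSpace.single i 1) i| ≤ ‖fderiv ℝ X x‖ := fun i =>
    (abs_coord_le_norm _ i).trans (by
      simpa using (fderiv ℝ X x).le_opNorm (EuclideanSpace.single i 1))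
  rw [divergence, Fin.sum_univ_two]
  exact (abs_add_le _ _).trans (by linarith [h 0, h 1])

theorem integral_mul_divergence {f : Plane → ℝ} (hf : ContDiff ℝ 1 f) (hX : ContDiff ℝ 1 X)
    (hc : HasCompactSupport X) : ∫ x, f x * divergence X x = -∫ x, fderiv ℝ f x (X x) := by
  have hfc := hf.continuous
  have hf' := hf.continuous_fderiv (by norm_num)
  have hXc := hX.continuous
  have hX' := hX.continuous_fderiv (by norm_num)
  have hci : ∀ i, Continuous fun x => X x i := fun i => by fun_prop
  have hXi : ∀ i, ContDiff ℝ 1 fun x => X x i := fun i =>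
    (EuclideanSpace.proj (𝕜 := ℝ) i).contDiff.comp hX
  have hsi : ∀ i, HasCompactSupport fun x => X x i := fun i =>
    hc.comp_left (g := fun v : Plane => v i) rfl
  have i1 : ∀ i : Fin 2, Integrable fun x =>
      f x * fderiv ℝ (fun y => X y i) x (EuclideanSpace.single i 1) := fun i => by
    refine Continuous.integrable_of_hasCompactSupport ?_ ?_
    · have := (hXi i).continuous_fderiv (by norm_num)
      fun_prop
    · exact ((hsi i).fderiv_apply (𝕜 := ℝ) _).mul_left
  have i2 : ∀ i : Fin 2, Integrable fun x =>
      fderiv ℝ f x (EuclideanSpace.single i 1) * X x i := fun i => by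
    refine Continuous.integrable_of_hasCompactSupport ?_ ?_
    · fun_prop
    · exact (hsi i).mul_left
  have i3 : ∀ i : Fin 2, Integrable fun x => f x * X x i := fun i =>
    Continuous.integrable_of_hasCompactSupport (hfc.mul (hci i)) (hsi i).mul_left
  have e1 : ∀ x, f x * divergence X x =
      ∑ i : Fin 2, f x * fderiv ℝ (fun y => X y i) x (EuclideanSpace.single i 1) := fun x => by
    simp only [fderiv_coord hX, divergence, Finset.mul_sum]
  have e2 : ∀ x, fderiv ℝ f x (X x) =
      ∑ i : Fin 2, fderiv ℝ f x (EuclideanSpace.single i 1) * X x i := fun x => by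
    have : X x = ∑ i : Fin 2, X x i • EuclideanSpace.single i (1 : ℝ) := by
      ext j; fin_cases j <;> simp
    conv_lhs => rw [this]
    simp [mul_comm]
  simp only [e1, e2]
  rw [integral_finsetSum _ fun i _ => i1 i, integral_finsetSum _ fun i _ => i2 i,
    ← Finset.sum_neg_distrib]
  refine Finset.sum_congr rfl fun i _ => ?_
  exact integral_mul_fderiv_eq_neg_fderiv_mul_of_integrable (i2 i) (i1 i) (i3 i)
    (fun x _ => hf.differentiable (by norm_num) x)
    (fun x _ => (hXi i).differentiable (by norm_num) x)

theorem setIntegral_mul_divergence {f : Plane → ℝ} (hf : ContDiff ℝ 1 f) (hX : ContDiff ℝ 1 X)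
    (hc : HasCompactSupport X) (hD : tsupport X ⊆ D) :
    ∫ x in D, f x * divergence X x = -∫ x in D, fderiv ℝ f x (X x) := by
  rw [setIntegral_eq_integral_of_forall_compl_eq_zero,
    setIntegral_eq_integral_of_forall_compl_eq_zero, integral_mul_divergence hf hX hc]
  · intro x hx
    rw [image_eq_zero_of_notMem_tsupport fun h => hx (hD h), map_zero]
  · intro x hx
    rw [divergence_eq_zero fun h => hx (hD h), mul_zero]

/-- The total variation of a `C¹` function is at most the integral of its gradient. -/
theorem totalVar_le_integral_fderiv {f : Plane → ℝ} (hf : ContDiff ℝ 1 f)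
    (hi : IntegrableOn (fun x => ‖fderiv ℝ f x‖) D) :
    totalVar D f ≤ ENNReal.ofReal (∫ x in D, ‖fderiv ℝ f x‖) := by
  refine totalVar_le fun X h1 h2 h3 h4 => ?_
  rw [setIntegral_mul_divergence hf h1 h2 h3, ← integral_neg]
  have hb : ∀ x, ‖-(fderiv ℝ f x (X x))‖ ≤ ‖fderiv ℝ f x‖ := fun x => by
    rw [norm_neg]
    simpa using (fderiv ℝ f x).le_opNorm_of_le (h4 x)
  have hf' := hf.continuous_fderiv (by norm_num)
  have hXc := h1.continuous
  have hm : Continuous fun x => -(fderiv ℝ f x (X x)) := by fun_prop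
  exact integral_mono (hi.mono' hm.aestronglyMeasurable (ae_of_all _ hb)) hi
    fun x => (le_abs_self _).trans (hb x)

end TotalVariation

/-! ### Calibrating fields for level sets -/

section Calibration

/-- The Euclidean vector representing a linear form. -/
noncomputable def formVec : (Plane →L[ℝ] ℝ) →L[ℝ] Plane :=
  ∑ i : Fin 2, (ContinuousLinearMap.apply ℝ ℝ (EuclideanSpace.single i (1 : ℝ))).smulRight
    (EuclideanSpace.single i (1 : ℝ))

theorem formVec_apply (l : Plane →L[ℝ] ℝ) (i : Fin 2) :
    formVec l i = l (EuclideanSpace.single i 1) := by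
  fin_cases i <;> simp [formVec, Fin.sum_univ_two]

theorem inner_formVec (l : Plane →L[ℝ] ℝ) (v : Plane) : inner ℝ (formVec l) v = l v := by
  have : v = ∑ i : Fin 2, v i • EuclideanSpace.single i (1 : ℝ) := by
    ext j; fin_cases j <;> simp
  conv_rhs => rw [this]
  simp only [PiLp.inner_apply, formVec_apply, map_sum, map_smul]
  simp

theorem apply_formVec (l : Plane →L[ℝ] ℝ) : l (formVec l) = ‖formVec l‖ ^ 2 := by
  rw [← inner_formVec, real_inner_self_eq_norm_sq]

theorem norm_formVec (l : Plane →L[ℝ] ℝ) : ‖formVec l‖ = ‖l‖ := by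
  refine le_antisymm ?_ (l.opNorm_le_bound (norm_nonneg _) fun v => ?_)
  · rcases (norm_nonneg (formVec l)).eq_or_lt with h | h
    · rw [← h]; exact norm_nonneg _
    · have h1 := l.le_opNorm (formVec l)
      rw [apply_formVec, Real.norm_of_nonneg (sq_nonneg _), sq] at h1
      exact le_of_mul_le_mul_right h1 h
  · rw [← inner_formVec]
    exact norm_inner_le_norm _ _

/-- A smooth map which is the direction of `l` where `‖l‖ ≥ c`. -/
noncomputable def formDir (c : ℝ) (l : Plane →L[ℝ] ℝ) : Plane :=
  (Real.smoothTransition (2 * (‖formVec l‖ ^ 2 / c ^ 2) - 1) * ‖formVec l‖⁻¹) • formVec l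

/-- The norm is singular only at the zero vector, and the cutoff vanishes identically near there. -/
theorem contDiff_formDir (c : ℝ) : ContDiff ℝ 1 (formDir c) := by
  have hs : ContDiff ℝ 1 fun l : Plane →L[ℝ] ℝ =>
      Real.smoothTransition (2 * (‖formVec l‖ ^ 2 / c ^ 2) - 1) :=
    Real.smoothTransition.contDiff.comp
      ((contDiff_const.mul ((formVec.contDiff.norm_sq ℝ).div_const _)).sub contDiff_const)
  rw [contDiff_iff_contDiffAt]
  intro l
  by_cases hl : formVec l = 0
  · have hev : formDir c =ᶠ[𝓝 l] fun _ => 0 := by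
      have hcont : Continuous fun l : Plane →L[ℝ] ℝ => 2 * (‖formVec l‖ ^ 2 / c ^ 2) - 1 := by
        fun_prop
      have hlt : 2 * (‖formVec l‖ ^ 2 / c ^ 2) - 1 < 0 := by simp [hl]
      filter_upwards [hcont.continuousAt.eventually_lt continuousAt_const hlt] with k hk
      rw [formDir, Real.smoothTransition.zero_of_nonpos hk.le, zero_mul, zero_smul]
    exact contDiffAt_const.congr_of_eventuallyEq hev
  · have hn : ContDiffAt ℝ 1 (fun l : Plane →L[ℝ] ℝ => ‖formVec l‖) l :=
      formVec.contDiff.contDiffAt.norm ℝ hl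
    exact (hs.contDiffAt.mul (hn.inv (norm_ne_zero_iff.2 hl))).smul formVec.contDiff.contDiffAt

theorem norm_formDir_le (c : ℝ) (l : Plane →L[ℝ] ℝ) : ‖formDir c l‖ ≤ 1 := by
  rw [formDir, norm_smul, norm_mul, norm_inv, norm_norm,
    Real.norm_of_nonneg (Real.smoothTransition.nonneg _), mul_assoc]
  exact mul_le_one₀ (Real.smoothTransition.le_one _) (by positivity) inv_mul_le_one

theorem apply_formDir_nonneg (c : ℝ) (l : Plane →L[ℝ] ℝ) : 0 ≤ l (formDir c l) := by
  rw [formDir, map_smul, apply_formVec, smul_eq_mul]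
  have := Real.smoothTransition.nonneg (2 * (‖formVec l‖ ^ 2 / c ^ 2) - 1)
  positivity

theorem apply_formDir {c : ℝ} (hc : 0 < c) {l : Plane →L[ℝ] ℝ} (hl : c ≤ ‖l‖) :
    l (formDir c l) = ‖l‖ := by
  have h1 : 1 ≤ ‖formVec l‖ ^ 2 / c ^ 2 := by
    rw [one_le_div (by positivity), norm_formVec]; gcongr
  have h2 : ‖l‖ ≠ 0 := (hc.trans_le hl).ne'
  rw [formDir, map_smul, apply_formVec, smul_eq_mul,
    Real.smoothTransition.one_of_one_le (by linarith), norm_formVec]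
  field_simp

/-- A cutoff near the level set `{I = h}` of the normal field `-∇I/|∇I|`; it calibrates the
level sets of `I`. -/
theorem exists_calibration (B h : ℝ) {c η₁ : ℝ} (hc : 0 < c) (hη₁ : 0 < η₁) :
    ∃ S : ℝ, 0 ≤ S ∧ ∀ I : Plane → ℝ, BddC2 B I → (∀ x, |I x - h| < η₁ → c ≤ ‖fderiv ℝ I x‖) →
      ∃ X : Plane → Plane, ContDiff ℝ 1 X ∧ tsupport X ⊆ {x | |I x - h| < η₁} ∧
        (∀ x, ‖X x‖ ≤ 1) ∧ (∀ x, |divergence X x| ≤ S) ∧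
        (∀ x, |I x - h| ≤ η₁ / 2 → fderiv ℝ I x (X x) = -‖fderiv ℝ I x‖) ∧
        ∀ x, fderiv ℝ I x (X x) ≤ 0 := by
  -- The outer radius 3η₁/4 is kept below η₁ so that even the closed support of the field lies in
  -- the open band.
  let ψ : ContDiffBump h := ⟨η₁ / 2, 3 * η₁ / 4, by positivity, by linarith⟩
  let Ξ : ℝ × (Plane →L[ℝ] ℝ) → Plane := fun p => -(ψ p.1 • formDir c p.2)
  have hΞ : ContDiff ℝ 1 Ξ :=
    ((ψ.contDiff.comp contDiff_fst).smul ((contDiff_formDir c).comp contDiff_snd)).neg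
  -- The pair (I, ∇I) takes values in a fixed compact ball, on which the derivative of Ξ is bounded.
  -- Together with the C² bound on I this makes the bound on the divergence independent of I.
  obtain ⟨A, hA⟩ := ((isCompact_closedBall (0 : ℝ × (Plane →L[ℝ] ℝ)) B).image_of_continuousOn
    (hΞ.continuous_fderiv (by norm_num)).continuousOn).isBounded.exists_norm_le
  refine ⟨2 * (max A 0 * max B 0), by positivity, fun I hI hgrad => ?_⟩
  have hd' := hI.contDiff_fderiv
  have hpair : ContDiff ℝ 1 fun x => (I x, fderiv ℝ I x) :=
    (hI.contDiff.of_le (by norm_num)).prodMk hd'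
  have hval : ∀ x, fderiv ℝ I x (-(ψ (I x) • formDir c (fderiv ℝ I x))) =
      -(ψ (I x) * fderiv ℝ I x (formDir c (fderiv ℝ I x))) := fun x => by simp
  refine ⟨fun x => Ξ (I x, fderiv ℝ I x), hΞ.comp hpair, ?_, fun x => ?_, fun x => ?_,
    fun x hx => ?_, fun x => ?_⟩
  · have hcl : IsClosed {x | |I x - h| ≤ 3 * η₁ / 4} :=
      isClosed_le (hI.contDiff.continuous.sub continuous_const).abs continuous_const
    refine (closure_minimal ?_ hcl).trans fun x (hx : |I x - h| ≤ 3 * η₁ / 4) =>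
      show |I x - h| < η₁ by linarith
    intro x hx
    by_contra hx'
    refine hx ?_
    have : ψ (I x) = 0 := ψ.zero_of_le_dist (by
      rw [Real.dist_eq]; exact (not_le.1 hx').le)
    simp [Ξ, this]
  · simp only [Ξ]
    rw [norm_neg, norm_smul, Real.norm_of_nonneg ψ.nonneg]
    exact mul_le_one₀ ψ.le_one (norm_nonneg _) (norm_formDir_le _ _)
  · refine (abs_divergence_le x).trans ?_
    have hder : HasFDerivAt (fun x => Ξ (I x, fderiv ℝ I x))
        ((fderiv ℝ Ξ (I x, fderiv ℝ I x)).comp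
          ((fderiv ℝ I x).prod (fderiv ℝ (fderiv ℝ I) x))) x :=
      (hΞ.differentiable (by norm_num) _).hasFDerivAt.comp x
        ((hI.differentiable x).hasFDerivAt.prodMk
          (hd'.differentiable (by norm_num) x).hasFDerivAt)
    rw [hder.fderiv]
    have h1 : ‖fderiv ℝ Ξ (I x, fderiv ℝ I x)‖ ≤ max A 0 := by
      refine (hA _ ⟨_, ?_, rfl⟩).trans (le_max_left _ _)
      rw [mem_closedBall_zero_iff, Prod.norm_def]
      exact max_le (hI.bound x) (hI.bound_fderiv x)
    have h2 : ‖(fderiv ℝ I x).prod (fderiv ℝ (fderiv ℝ I) x)‖ ≤ max B 0 := by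
      refine ContinuousLinearMap.opNorm_le_bound _ (le_max_right _ _) fun v => ?_
      rw [ContinuousLinearMap.prod_apply, Prod.norm_def]
      have hB : B ≤ max B 0 := le_max_left _ _
      exact max_le ((fderiv ℝ I x).le_of_opNorm_le ((hI.bound_fderiv x).trans hB) v)
        ((fderiv ℝ (fderiv ℝ I) x).le_of_opNorm_le ((hI.bound_fderiv_two x).trans hB) v)
    have h3 := ContinuousLinearMap.opNorm_comp_le (fderiv ℝ Ξ (I x, fderiv ℝ I x))
      ((fderiv ℝ I x).prod (fderiv ℝ (fderiv ℝ I) x))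
    have h4 := mul_le_mul h1 h2 (norm_nonneg _) (le_max_right A 0)
    linarith
  · simp only [Ξ]
    rw [hval, apply_formDir hc (hgrad x (by linarith)),
      ψ.one_of_mem_closedBall (by rw [mem_closedBall, Real.dist_eq]; exact hx), one_mul]
  · simp only [Ξ]
    rw [hval]
    exact neg_nonpos.2 (mul_nonneg ψ.nonneg (apply_formDir_nonneg _ _))

end Calibration


/-! ### Hard and soft thresholds in BV -/

section Thresholds

variable {I : Plane → ℝ} {X : Plane → Plane} {D : Set Plane} {h η η₁ c S : ℝ} {φ : ℝ → ℝ}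

theorem measurableSet_band (hI : Continuous I) (h a : ℝ) : MeasurableSet {x | |I x - h| ≤ a} :=
  (isClosed_le (hI.sub continuous_const).abs continuous_const).measurableSet

/-- The area of the set `{|I - h| ≤ η}` is `O(η)`. -/
theorem band_area_le (hI : ContDiff ℝ 1 I) (hη : 0 < η) (hc : 0 < c) (hηη : η ≤ η₁ / 2)
    (hgrad : ∀ x, |I x - h| < η₁ → c ≤ ‖fderiv ℝ I x‖)
    (hX : ContDiff ℝ 1 X) (hXc : HasCompactSupport X) (hXD : tsupport X ⊆ D)
    (hDfin : volume D ≠ ⊤) (hband : ∀ x, |I x - h| < η₁ → x ∈ D) (hS : ∀ x, |divergence X x| ≤ S)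
    (hX1 : ∀ x, |I x - h| ≤ η₁ / 2 → fderiv ℝ I x (X x) = -‖fderiv ℝ I x‖)
    (hX2 : ∀ x, fderiv ℝ I x (X x) ≤ 0) :
    c * volume.real {x | |I x - h| ≤ η} ≤ Real.pi * S * volume.real D * η := by
  -- The function arctan((I - h)/η) is bounded by π/2 whatever η is, while its slope in I is at
  -- least 1/(2η) on the band. Integrating by parts against X thus bounds c/(2η) times the area by
  -- (π/2)·S·|D|.
  have hd : ∀ x, HasFDerivAt (fun x => Real.arctan ((I x - h) / η))
      ((1 / (1 + ((I x - h) / η) ^ 2)) • η⁻¹ • fderiv ℝ I x) x := by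
    intro x
    have h1 : HasFDerivAt (fun x => (I x - h) / η) (η⁻¹ • fderiv ℝ I x) x := by
      simp only [div_eq_mul_inv]
      exact ((hI.differentiable (by norm_num) x).hasFDerivAt.sub_const h).mul_const η⁻¹
    exact h1.arctan
  have hf : ContDiff ℝ 1 fun x => Real.arctan ((I x - h) / η) :=
    Real.contDiff_arctan.comp ((hI.sub contDiff_const).div_const _)
  have hIc := hI.continuous
  have hI' := hI.continuous_fderiv (by norm_num)
  have hXcont := hX.continuous
  have hbandm := measurableSet_band hIc h η
  have hsub : {x | |I x - h| ≤ η} ⊆ D := fun x (hx : |I x - h| ≤ η) =>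
    hband x (by linarith [abs_nonneg (I x - h)])
  have hibp := setIntegral_mul_divergence hf hX hXc hXD
  simp only [(hd _).fderiv] at hibp
  set v : Plane → ℝ := fun x => -(((1 / (1 + ((I x - h) / η) ^ 2)) • η⁻¹ • fderiv ℝ I x) (X x))
    with hv
  rw [← integral_neg] at hibp
  have hv0 : ∀ x, 0 ≤ v x := fun x => by
    have h1 : v x = 1 / (1 + ((I x - h) / η) ^ 2) * η⁻¹ * -(fderiv ℝ I x (X x)) := by
      simp [hv]; ring
    rw [h1]
    exact mul_nonneg (by positivity) (neg_nonneg.2 (hX2 x))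
  have hvb : ∀ x, |I x - h| ≤ η → c / (2 * η) ≤ v x := fun x hx => by
    have h1 : v x = 1 / (1 + ((I x - h) / η) ^ 2) * η⁻¹ * ‖fderiv ℝ I x‖ := by
      simp only [hv, smul_eq_mul, smul_apply, hX1 x (hx.trans hηη)]
      ring
    have h2 : ((I x - h) / η) ^ 2 ≤ 1 := by
      rw [sq_le_one_iff_abs_le_one, abs_div, abs_of_pos hη]
      exact (div_le_one hη).2 hx
    have h3 : (1 : ℝ) / 2 ≤ 1 / (1 + ((I x - h) / η) ^ 2) := by gcongr; linarith
    have h4 := hgrad x (by linarith [abs_nonneg (I x - h)])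
    rw [h1, show c / (2 * η) = 1 / 2 * η⁻¹ * c by field_simp]
    gcongr
  have hvi : Integrable v := by
    refine Continuous.integrable_of_hasCompactSupport ?_ ?_
    · simp only [hv]
      have : ∀ x, 1 + ((I x - h) / η) ^ 2 ≠ 0 := fun x => by positivity
      simp only [smul_apply]
      fun_prop (disch := assumption)
    · refine HasCompactSupport.intro hXc fun x hx => ?_
      simp only [hv]
      rw [image_eq_zero_of_notMem_tsupport hx, map_zero, neg_zero]
  have hlow : c / (2 * η) * volume.real {x | |I x - h| ≤ η} ≤ ∫ x in D, v x := by
    calc c / (2 * η) * volume.real {x | |I x - h| ≤ η}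
        = ∫ x in {x | |I x - h| ≤ η}, c / (2 * η) := by
          rw [setIntegral_const, smul_eq_mul, mul_comm]
      _ ≤ ∫ x in {x | |I x - h| ≤ η}, v x :=
          setIntegral_mono_on (integrableOn_const ((measure_mono hsub).trans_lt hDfin.lt_top).ne)
            hvi.integrableOn hbandm hvb
      _ ≤ ∫ x in D, v x :=
          setIntegral_mono_set hvi.integrableOn (ae_of_all _ hv0) (ae_of_all _ hsub)
  have hup : ∫ x in D, v x ≤ Real.pi / 2 * S * volume.real D := by
    rw [hv, ← hibp]
    refine (Real.le_norm_self _).trans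
      (norm_setIntegral_le_of_norm_le_const hDfin.lt_top fun x _ => ?_)
    rw [norm_mul]
    refine mul_le_mul ?_ (hS x) (norm_nonneg _) (by positivity)
    exact abs_le.2 ⟨(Real.neg_pi_div_two_lt_arctan _).le, (Real.arctan_lt_pi_div_two _).le⟩
  have h3 := hlow.trans hup
  rw [div_mul_eq_mul_div, div_le_iff₀ (by positivity)] at h3
  linarith

theorem IsSmoothStep.mem_Icc (hφ : IsSmoothStep φ) (t : ℝ) : 0 ≤ φ t ∧ φ t ≤ 1 := by
  constructor
  · rw [← hφ.zero (min t (-(1 / 2))) (min_le_right _ _)]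
    exact hφ.mono (min_le_left _ _)
  · rw [← hφ.one (max t (1 / 2)) (le_max_right _ _)]
    exact hφ.mono (le_max_left _ _)

theorem IsSmoothStep.deriv_nonneg (hφ : IsSmoothStep φ) (t : ℝ) : 0 ≤ deriv φ t :=
  hφ.mono.deriv_nonneg

theorem IsSmoothStep.deriv_eq_zero (hφ : IsSmoothStep φ) {t : ℝ} (ht : 1 / 2 < |t|) :
    deriv φ t = 0 := by
  rcases lt_abs.1 ht with h | h
  · have : φ =ᶠ[𝓝 t] fun _ => 1 := by
      filter_upwards [lt_mem_nhds h] with s hs using hφ.one s hs.le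
    rw [this.deriv_eq, deriv_const]
  · have : φ =ᶠ[𝓝 t] fun _ => 0 := by
      have h' : t < -(1 / 2) := by linarith
      filter_upwards [gt_mem_nhds h'] with s hs using hφ.zero s hs.le
    rw [this.deriv_eq, deriv_const]

theorem contDiff_softThreshold {n : WithTop ℕ∞} (hn : n ≤ ((⊤ : ℕ∞) : WithTop ℕ∞)) (hφ : IsSmoothStep φ)
    (hI : ContDiff ℝ n I) (h η : ℝ) :
    ContDiff ℝ n (softThreshold φ h η I) :=
  (hφ.smooth.of_le hn).comp ((hI.sub contDiff_const).div_const _)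

theorem fderiv_softThreshold (hφ : IsSmoothStep φ) {x : Plane} (hI : DifferentiableAt ℝ I x)
    (h η : ℝ) : fderiv ℝ (softThreshold φ h η I) x =
      (deriv φ ((I x - h) / η) * η⁻¹) • fderiv ℝ I x := by
  have h1 : HasFDerivAt (fun x => (I x - h) / η) (η⁻¹ • fderiv ℝ I x) x := by
    simp only [div_eq_mul_inv]
    exact (hI.hasFDerivAt.sub_const h).mul_const η⁻¹
  have h2 := ((hφ.smooth.differentiable (by simp)) ((I x - h) / η)).hasDerivAt
  rw [mul_smul]
  exact (h2.comp_hasFDerivAt x h1).fderiv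

theorem abs_hardThreshold_sub_softThreshold_le (hφ : IsSmoothStep φ) (hη : 0 < η) (x : Plane) :
    |hardThreshold h I x - softThreshold φ h η I x| ≤
      {x | |I x - h| ≤ η / 2}.indicator (fun _ => (1 : ℝ)) x := by
  classical
  have hm := hφ.mem_Icc ((I x - h) / η)
  by_cases hx : x ∈ {x | |I x - h| ≤ η / 2}
  · rw [Set.indicator_of_mem hx]
    simp only [hardThreshold, softThreshold, Set.indicator_apply, Set.mem_ofPred_eq, Pi.one_apply]
    split_ifs <;> exact abs_le.2 ⟨by linarith, by linarith⟩
  · rw [Set.indicator_of_notMem hx]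
    rw [Set.mem_ofPred_eq] at hx
    rcases lt_abs.1 (not_le.1 hx) with h1 | h1
    · have h2 : 1 / 2 ≤ (I x - h) / η := by rw [le_div_iff₀ hη]; linarith
      have h3 : h < I x := by linarith
      simp [hardThreshold, softThreshold, hφ.one _ h2, h3]
    · have h2 : (I x - h) / η ≤ -(1 / 2) := by rw [div_le_iff₀ hη]; linarith
      have h3 : ¬ h < I x := by linarith
      simp [hardThreshold, softThreshold, hφ.zero _ h2, h3]

theorem measurable_hardThreshold (hI : Continuous I) : Measurable (hardThreshold h I) :=
  measurable_one.indicator (isOpen_lt continuous_const hI).measurableSet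

theorem integrableOn_hardThreshold (hI : Continuous I) (hD : volume D ≠ ⊤) :
    IntegrableOn (hardThreshold h I) D := by
  refine Measure.integrableOn_of_bounded (M := 1) hD
    (measurable_hardThreshold hI).aestronglyMeasurable (ae_of_all _ fun x => ?_)
  classical
  simp only [hardThreshold, Set.indicator_apply]
  split_ifs <;> simp

theorem integrableOn_softThreshold (hφ : IsSmoothStep φ) (hI : Continuous I) (hD : volume D ≠ ⊤) :
    IntegrableOn (softThreshold φ h η I) D := by
  have hc : Continuous (softThreshold φ h η I) := by
    have := hφ.smooth.continuous
    unfold softThreshold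
    fun_prop
  refine Measure.integrableOn_of_bounded (M := 1) hD hc.aestronglyMeasurable
    (ae_of_all _ fun x => ?_)
  have := hφ.mem_Icc ((I x - h) / η)
  exact abs_le.2 ⟨by simp only [softThreshold]; linarith, this.2⟩

/-- This holds for every η, without transversality: φ' is bounded, so the gradient is bounded, and D
has finite area. -/
theorem memBV_softThreshold (hφ : IsSmoothStep φ) {B : ℝ} (hI : BddC2 B I) (hD : volume D ≠ ⊤)
    (h η : ℝ) : MemBV D (softThreshold φ h η I) := by
  refine ⟨integrableOn_softThreshold hφ hI.contDiff.continuous hD, ?_⟩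
  have hI1 : ContDiff ℝ 1 I := hI.contDiff.of_le (by norm_num)
  have hs := contDiff_softThreshold (n := 1) (by simp) hφ hI1 h η
  refine (totalVar_le_integral_fderiv hs ?_).trans_lt ENNReal.ofReal_lt_top
  obtain ⟨A, hA⟩ := ((isCompact_Icc (a := (-(1 / 2) : ℝ)) (b := 1 / 2)).image
    (hφ.smooth.continuous_deriv (by simp))).isBounded.exists_norm_le
  refine Measure.integrableOn_of_bounded (M := max A 0 * |η⁻¹| * B) hD
    (hs.continuous_fderiv (by norm_num)).norm.aestronglyMeasurable (ae_of_all _ fun x => ?_)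
  rw [norm_norm, fderiv_softThreshold hφ (hI.differentiable x), norm_smul, norm_mul]
  have h1 : ‖deriv φ ((I x - h) / η)‖ ≤ max A 0 := by
    by_cases hx : |(I x - h) / η| ≤ 1 / 2
    · exact (hA _ ⟨_, abs_le.1 hx, rfl⟩).trans (le_max_left _ _)
    · rw [hφ.deriv_eq_zero (not_le.1 hx), norm_zero]
      exact le_max_right _ _
  have h2 := hI.bound_fderiv x
  rw [Real.norm_eq_abs η⁻¹]
  gcongr

theorem setIntegral_band_indicator_le (hI : Continuous I) (hD : volume D ≠ ⊤) (a : ℝ)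
    (hsub : {x | |I x - h| ≤ a} ⊆ D) {F : Plane → ℝ} (C : ℝ)
    (hF : ∀ x, |F x| ≤ C * {x | |I x - h| ≤ a}.indicator (fun _ => (1 : ℝ)) x) :
    |∫ x in D, F x| ≤ C * volume.real {x | |I x - h| ≤ a} := by
  have hm := measurableSet_band hI h a
  have hi : IntegrableOn ({x | |I x - h| ≤ a}.indicator fun _ => (1 : ℝ)) D :=
    (integrableOn_const hD).indicator hm
  rw [← Real.norm_eq_abs]
  refine (norm_integral_le_of_norm_le (hi.const_mul C) (ae_of_all _ hF)).trans_eq ?_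
  rw [integral_const_mul, setIntegral_indicator hm, Set.inter_eq_self_of_subset_right hsub,
    setIntegral_const, smul_eq_mul, mul_one]

/-- The gradient of the soft threshold is a nonnegative multiple of ∇I and vanishes unless |I - h| ≤
η/2, where X points along -∇I. So the integral against div X equals the L¹ norm of the gradient,
which also bounds the total variation from above. -/
theorem totalVar_softThreshold_eq (hφ : IsSmoothStep φ) {B : ℝ} (hI : BddC2 B I) (hη : 0 < η)
    (hηη : η ≤ η₁) (hX : ContDiff ℝ 1 X) (hXc : HasCompactSupport X) (hXD : tsupport X ⊆ D)
    (hXn : ∀ x, ‖X x‖ ≤ 1)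
    (hX1 : ∀ x, |I x - h| ≤ η₁ / 2 → fderiv ℝ I x (X x) = -‖fderiv ℝ I x‖) :
    totalVar D (softThreshold φ h η I) =
      ENNReal.ofReal (∫ x in D, softThreshold φ h η I x * divergence X x) ∧
    0 ≤ ∫ x in D, softThreshold φ h η I x * divergence X x := by
  have hI1 : ContDiff ℝ 1 I := hI.contDiff.of_le (by norm_num)
  have hs := contDiff_softThreshold (n := 1) (by simp) hφ hI1 h η
  have hpt : ∀ x, ‖fderiv ℝ (softThreshold φ h η I) x‖ =
      -(fderiv ℝ (softThreshold φ h η I) x (X x)) := fun x => by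
    rw [fderiv_softThreshold hφ (hI.differentiable x), norm_smul, norm_mul,
      Real.norm_of_nonneg (hφ.deriv_nonneg _), Real.norm_of_nonneg (inv_nonneg.2 hη.le),
      smul_apply, smul_eq_mul]
    by_cases hx : |(I x - h) / η| ≤ 1 / 2
    · rw [abs_div, abs_of_pos hη, div_le_iff₀ hη] at hx
      rw [hX1 x (by linarith)]
      ring
    · rw [hφ.deriv_eq_zero (not_le.1 hx)]
      simp
  have heq : ∫ x in D, softThreshold φ h η I x * divergence X x =
      ∫ x in D, ‖fderiv ℝ (softThreshold φ h η I) x‖ := by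
    rw [setIntegral_mul_divergence hs hX hXc hXD, ← integral_neg]
    simp only [hpt]
  refine ⟨le_antisymm ?_ (le_totalVar hX hXc hXD hXn), ?_⟩
  · rw [heq]
    refine totalVar_le_integral_fderiv hs ?_
    have hXcont := hX.continuous
    have hs' := hs.continuous_fderiv (by norm_num)
    have hcs : HasCompactSupport fun x => ‖fderiv ℝ (softThreshold φ h η I) x‖ :=
      HasCompactSupport.intro hXc fun x hx => by
        rw [hpt, image_eq_zero_of_notMem_tsupport hx, map_zero, neg_zero]
    exact (hs'.norm.integrable_of_hasCompactSupport hcs).integrableOn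
  · rw [heq]
    exact integral_nonneg fun x => norm_nonneg _

/-- Quantitative strict closeness of the two thresholds. -/
theorem exists_dSt_threshold_le (B h : ℝ) {c η₁ R' R'' : ℝ} (hc : 0 < c) (hη₁ : 0 < η₁)
    (hR : R' < R'') (hφ : IsSmoothStep φ) :
    ∃ C : ℝ, 0 ≤ C ∧ ∀ I : Plane → ℝ, BddC2 B I →
      (∀ x, |I x - h| < η₁ → ‖x‖ ≤ R' ∧ c ≤ ‖fderiv ℝ I x‖) →
      MemBV (ball 0 R'') (hardThreshold h I) ∧
      ∀ η, 0 < η → η ≤ η₁ →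
        dSt (ball 0 R'') (hardThreshold h I) (softThreshold φ h η I) ≤ C * η := by
  obtain ⟨S, hS0, hcal⟩ := exists_calibration B h hc hη₁
  set D : Set Plane := ball 0 R'' with hD
  have hDfin : volume D ≠ ⊤ := measure_ball_lt_top.ne
  set A : ℝ := Real.pi * S * volume.real D / c / 2 with hA
  have hA0 : 0 ≤ A := by positivity
  -- The summand 1 accounts for the L¹ distance and S for the difference of variations; A·η bounds
  -- the area of the band of half-width η/2.
  refine ⟨(1 + S) * A, by positivity, fun I hI hband => ?_⟩
  obtain ⟨X, hX, hXs, hXn, hXdiv, hX1, hX2⟩ := hcal I hI fun x hx => (hband x hx).2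
  have hI1 : ContDiff ℝ 1 I := hI.contDiff.of_le (by norm_num)
  have hIc := hI.contDiff.continuous
  have hbD : ∀ x, |I x - h| < η₁ → x ∈ D := fun x hx => by
    rw [hD, mem_ball_zero_iff]; exact (hband x hx).1.trans_lt hR
  have hXD : tsupport X ⊆ D := fun x hx => hbD x (hXs hx)
  have hXc : HasCompactSupport X :=
    (isCompact_closedBall (0 : Plane) R').of_isClosed_subset (isClosed_tsupport X) fun x hx => by
      rw [mem_closedBall_zero_iff]; exact (hband x (hXs hx)).1
  have harea : ∀ η, 0 < η → η ≤ η₁ → volume.real {x | |I x - h| ≤ η / 2} ≤ A * η := by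
    intro η hη hηη
    have h1 := band_area_le hI1 (half_pos hη) hc (by linarith) (fun x hx => (hband x hx).2) hX hXc
      hXD hDfin hbD hXdiv hX1 hX2
    rw [mul_comm, ← le_div_iff₀ hc] at h1
    refine h1.trans_eq ?_
    rw [hA]; ring
  have hsubD : ∀ η, 0 < η → η ≤ η₁ → {x | |I x - h| ≤ η / 2} ⊆ D :=
    fun η hη hηη x (hx : |I x - h| ≤ η / 2) => hbD x (by linarith)
  have hih : IntegrableOn (hardThreshold h I) D := integrableOn_hardThreshold hIc hDfin
  have his : ∀ η, IntegrableOn (softThreshold φ h η I) D := fun η =>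
    integrableOn_softThreshold hφ hIc hDfin
  have hmul : ∀ {f : Plane → ℝ}, IntegrableOn f D → ∀ {Y : Plane → Plane}, ContDiff ℝ 1 Y →
      HasCompactSupport Y → IntegrableOn (fun x => f x * divergence Y x) D := by
    intro f hf Y hY hYc
    obtain ⟨M, hM⟩ := (continuous_divergence hY).bounded_above_of_compact_support
      (hasCompactSupport_divergence hYc)
    exact hf.mul_bdd (c := M) (continuous_divergence hY).aestronglyMeasurable (ae_of_all _ hM)
  have hcmp : ∀ η, 0 < η → η ≤ η₁ → ∀ {Y : Plane → Plane} {M : ℝ}, ContDiff ℝ 1 Y →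
      HasCompactSupport Y → 0 ≤ M → (∀ x, |divergence Y x| ≤ M) →
      |(∫ x in D, hardThreshold h I x * divergence Y x) -
        ∫ x in D, softThreshold φ h η I x * divergence Y x| ≤ M * (A * η) := by
    intro η hη hηη Y M hY hYc hM0 hM
    rw [← integral_sub (hmul hih hY hYc) (hmul (his η) hY hYc)]
    refine (setIntegral_band_indicator_le hIc hDfin (η / 2) (hsubD η hη hηη) M fun x => ?_).trans
      (mul_le_mul_of_nonneg_left (harea η hη hηη) hM0)
    rw [← sub_mul, abs_mul, mul_comm]
    exact mul_le_mul (hM x) (abs_hardThreshold_sub_softThreshold_le hφ hη x) (abs_nonneg _) hM0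
  have hsoft := fun η (hη : 0 < η) (hηη : η ≤ η₁) =>
    totalVar_softThreshold_eq hφ hI hη hηη hX hXc hXD hXn hX1 (h := h)
  -- The field X also calibrates the hard threshold: for a competitor Y, both integrals are within
  -- O(η) of those for the soft threshold, where X is optimal, and η is arbitrarily small. The
  -- constant may depend on Y here, since only the limit matters.
  have hhard : totalVar D (hardThreshold h I) =
      ENNReal.ofReal (∫ x in D, hardThreshold h I x * divergence X x) := by
    refine le_antisymm (totalVar_le fun Y hY hYc hYD hYn => ?_) (le_totalVar hX hXc hXD hXn)
    obtain ⟨M, hM⟩ := (continuous_divergence hY).bounded_above_of_compact_support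
      (hasCompactSupport_divergence hYc)
    have hM0 : 0 ≤ M := (norm_nonneg _).trans (hM 0)
    refine le_of_forall_pos_le_add fun ε hε => ?_
    obtain ⟨η, hη, hηη, hηε⟩ : ∃ η, 0 < η ∧ η ≤ η₁ ∧ (M + S) * (A * η) ≤ ε := by
      refine ⟨min η₁ (ε / ((M + S) * A + 1)), by positivity, min_le_left _ _, ?_⟩
      have h1 : min η₁ (ε / ((M + S) * A + 1)) ≤ ε / ((M + S) * A + 1) := min_le_right _ _
      rw [le_div_iff₀ (by positivity)] at h1
      have h2 : 0 < min η₁ (ε / ((M + S) * A + 1)) := by positivity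
      nlinarith
    have h1 := abs_le.1 (hcmp η hη hηη hY hYc hM0 hM)
    have h2 := abs_le.1 (hcmp η hη hηη hX hXc hS0 hXdiv)
    have h3 : ∫ x in D, softThreshold φ h η I x * divergence Y x ≤
        ∫ x in D, softThreshold φ h η I x * divergence X x := by
      obtain ⟨h4, h5⟩ := hsoft η hη hηη
      have h6 := le_totalVar (u := softThreshold φ h η I) hY hYc hYD hYn
      rw [h4] at h6
      exact (ENNReal.ofReal_le_ofReal_iff h5).1 h6
    linarith
  refine ⟨⟨hih, hhard ▸ ENNReal.ofReal_lt_top⟩, fun η hη hηη => ?_⟩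
  obtain ⟨h4, h5⟩ := hsoft η hη hηη
  have h1 : ∫ x in D, |hardThreshold h I x - softThreshold φ h η I x| ≤ A * η := by
    refine (le_abs_self _).trans ((setIntegral_band_indicator_le hIc hDfin (η / 2)
      (hsubD η hη hηη) 1 fun x => ?_).trans ((one_mul _).trans_le (harea η hη hηη)))
    rw [abs_abs, one_mul]
    exact abs_hardThreshold_sub_softThreshold_le hφ hη x
  have h2 : |(totalVar D (hardThreshold h I)).toReal -
      (totalVar D (softThreshold φ h η I)).toReal| ≤ S * (A * η) := by
    rw [hhard, h4, ENNReal.toReal_ofReal', ENNReal.toReal_ofReal']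
    exact (abs_max_sub_max_le_abs _ _ _).trans (hcmp η hη hηη hX hXc hS0 hXdiv)
  rw [dSt]
  linarith

end Thresholds


/-! ### The Bessel function and the mutual intensity -/

theorem abs_cos_sub_sub_le (τ a : ℝ) :
    |Real.cos (τ - a) - (Real.cos τ + a * Real.sin τ)| ≤ a ^ 2 := by
  have hd : ∀ b ∈ Set.uIcc 0 a, HasDerivWithinAt
      (fun b => Real.cos (τ - b) - (Real.cos τ + b * Real.sin τ))
      (Real.sin (τ - b) - Real.sin τ) (Set.uIcc 0 a) b := fun b _ => by
    have h1 := ((hasDerivAt_id b).const_sub τ).cos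
    have h2 := ((hasDerivAt_id b).mul_const (Real.sin τ)).const_add (Real.cos τ)
    refine ((h1.sub h2).congr_deriv ?_).hasDerivWithinAt
    simp
  have hb : ∀ b ∈ Set.uIcc 0 a, ‖Real.sin (τ - b) - Real.sin τ‖ ≤ |a| := fun b hb => by
    refine (Real.abs_sin_sub_sin_le _ _).trans ?_
    rw [sub_sub_cancel_left, abs_neg]
    simpa using Set.abs_sub_left_of_mem_uIcc hb
  have := (convex_uIcc 0 a).norm_image_sub_le_of_norm_hasDerivWithin_le hd hb
    Set.left_mem_uIcc Set.right_mem_uIcc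
  simpa [← sq] using this

theorem continuous_besselJ1 : Continuous besselJ1 := by
  refine continuous_const.mul ?_
  exact intervalIntegral.continuous_parametric_intervalIntegral_of_continuous'
    (f := fun t τ => Real.cos (τ - t * Real.sin τ)) (by fun_prop) 0 Real.pi

theorem abs_besselJ1_le_one (t : ℝ) : |besselJ1 t| ≤ 1 := by
  have h := intervalIntegral.norm_integral_le_of_norm_le_const (a := 0) (b := Real.pi) (C := 1)
    (f := fun τ => Real.cos (τ - t * Real.sin τ)) fun τ _ => Real.abs_cos_le_one _
  rw [sub_zero, abs_of_pos Real.pi_pos, one_mul, Real.norm_eq_abs] at h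
  rw [besselJ1, abs_mul, abs_inv, abs_of_pos Real.pi_pos]
  exact inv_mul_le_one_of_le₀ h Real.pi_pos.le

/-- Expanding the cosine in Bessel's integral to first order in t, the zeroth-order term integrates
to 0 and the linear one to πt/2. -/
theorem abs_besselJ1_sub_le (t : ℝ) : |besselJ1 t - t / 2| ≤ t ^ 2 := by
  have h1 : ∫ τ in (0 : ℝ)..Real.pi, (Real.cos τ + t * Real.sin τ * Real.sin τ) =
      Real.pi * (t / 2) := by
    rw [intervalIntegral.integral_add (Continuous.intervalIntegrable (by fun_prop) _ _)
      (Continuous.intervalIntegrable (by fun_prop) _ _)]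
    simp only [mul_assoc, ← sq]
    rw [intervalIntegral.integral_const_mul, integral_cos, integral_sin_sq]
    simp
    ring
  have h2 : besselJ1 t - t / 2 = Real.pi⁻¹ * ∫ τ in (0 : ℝ)..Real.pi,
      (Real.cos (τ - t * Real.sin τ) - (Real.cos τ + t * Real.sin τ * Real.sin τ)) := by
    rw [intervalIntegral.integral_sub (Continuous.intervalIntegrable (by fun_prop) _ _)
      (Continuous.intervalIntegrable (by fun_prop) _ _), h1, besselJ1, mul_sub,
      inv_mul_cancel_left₀ Real.pi_ne_zero]
  have h3 := intervalIntegral.norm_integral_le_of_norm_le_const (a := 0) (b := Real.pi)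
    (C := t ^ 2) (f := fun τ => Real.cos (τ - t * Real.sin τ) -
      (Real.cos τ + t * Real.sin τ * Real.sin τ)) fun τ _ => by
    refine (abs_cos_sub_sub_le τ (t * Real.sin τ)).trans ?_
    rw [mul_pow]
    exact mul_le_of_le_one_right (sq_nonneg _) (Real.sin_sq_le_one τ)
  rw [sub_zero, abs_of_pos Real.pi_pos, Real.norm_eq_abs] at h3
  rw [h2, abs_mul, abs_inv, abs_of_pos Real.pi_pos, inv_mul_le_iff₀ Real.pi_pos]
  linarith

theorem measurable_mutualIntensity (κ : ℝ) : Measurable (mutualIntensity κ) := by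
  have := continuous_besselJ1.measurable
  refine Measurable.ite (measurableSet_singleton 0) measurable_const ?_
  fun_prop

theorem abs_mutualIntensity_sub_one_le {κ : ℝ} (hκ : 0 < κ) (x : Plane) :
    |mutualIntensity κ x - 1| ≤ 2 * (κ * ‖x‖) := by
  unfold mutualIntensity
  split_ifs with hx
  · simp [hx]
  · have ht : 0 < κ * ‖x‖ := mul_pos hκ (norm_pos_iff.2 hx)
    have h := abs_besselJ1_sub_le (κ * ‖x‖)
    rw [show 2 * besselJ1 (κ * ‖x‖) / (κ * ‖x‖) - 1 =
      2 * (besselJ1 (κ * ‖x‖) - κ * ‖x‖ / 2) / (κ * ‖x‖) by field_simp, abs_div, abs_mul,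
      abs_of_pos ht, abs_two, div_le_iff₀ ht]
    nlinarith

/-- For κ|x| ≤ 1 the expansion at 0 gives |J - 1| ≤ 2; for κ|x| ≥ 1 the bound |J₁| ≤ 1 suffices. -/
theorem abs_mutualIntensity_le {κ : ℝ} (hκ : 0 < κ) (x : Plane) : |mutualIntensity κ x| ≤ 3 := by
  rcases le_total (κ * ‖x‖) 1 with h | h
  · have h1 := abs_le.1 (abs_mutualIntensity_sub_one_le hκ x)
    exact abs_le.2 ⟨by linarith, by linarith⟩
  · unfold mutualIntensity
    split_ifs with hx
    · simp
    · have h1 := abs_besselJ1_le_one (κ * ‖x‖)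
      rw [abs_div, abs_mul, abs_two, abs_of_pos (zero_lt_one.trans_le h),
        div_le_iff₀ (zero_lt_one.trans_le h)]
      linarith


/-! ### Point spread functions as Schwartz functions; the Sobolev embedding -/

section Schwartz

/-- Rescaling a Schwartz function. -/
theorem exists_schwartz_comp_smul {F : Type*} [NormedAddCommGroup F] [NormedSpace ℝ F]
    (f : SchwartzMap Plane F) {a : ℝ} (ha : a ≠ 0) :
    ∃ g : SchwartzMap Plane F, ∀ x, g x = f (a • x) :=
  ⟨SchwartzMap.compCLMOfContinuousLinearEquiv ℝ
    (ContinuousLinearEquiv.smulLeft (Units.mk0 a ha)) f, fun _ => rfl⟩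

/-- The point spread function is the real part of a Fourier transform of a smooth compactly
supported function. The rescaling by (2π)⁻¹ converts from the convention with exp(-2πi⟨ξ, x⟩). -/
theorem IsAperture.exists_schwartz {That : Plane → ℝ} {s₀ : ℝ} (h : IsAperture That s₀) :
    ∃ T : SchwartzMap Plane ℝ, ⇑T = pointSpread That := by
  have hs : HasCompactSupport fun x => (That x : ℂ) :=
    h.compact.comp_left (g := fun t : ℝ => (t : ℂ)) Complex.ofReal_zero
  have hd : ContDiff ℝ ∞ fun x => (That x : ℂ) := Complex.ofRealCLM.contDiff.comp h.smooth
  obtain ⟨g, hg⟩ := exists_schwartz_comp_smul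
    (SchwartzMap.postcompCLM (𝕜 := ℝ) Complex.reCLM
      (FourierTransform.fourier (hs.toSchwartzMap hd)))
    (a := (2 * Real.pi)⁻¹) (by positivity)
  refine ⟨((2 * Real.pi) ^ 2)⁻¹ • g, ?_⟩
  funext x
  rw [smul_apply, hg, SchwartzMap.postcompCLM_apply, SchwartzMap.fourier_coe,
    Real.fourier_eq', pointSpread, smul_eq_mul,
    Complex.reCLM_apply]
  refine congrArg (fun z : ℂ => ((2 * Real.pi) ^ 2)⁻¹ * z.re)
    (integral_congr_ae (ae_of_all _ fun ξ => ?_))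
  change Complex.exp _ • (That ξ : ℂ) = _
  rw [smul_eq_mul, inner_smul_right, mul_comm]
  congr 2
  have hpi : -2 * Real.pi * ((2 * Real.pi)⁻¹ * inner ℝ ξ x) = -inner ℝ ξ x := by
    have := Real.pi_ne_zero
    field_simp
  rw [hpi]
  push_cast
  ring

theorem exists_schwartz_dilate (T : SchwartzMap Plane ℝ) {ρ : ℝ} (hρ : 0 < ρ) :
    ∃ K : SchwartzMap Plane ℝ, ⇑K = dilate T ρ := by
  obtain ⟨g, hg⟩ := exists_schwartz_comp_smul T (inv_ne_zero hρ.ne')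
  refine ⟨(ρ ^ 2)⁻¹ • g, ?_⟩
  funext x
  rw [smul_apply, hg, dilate, smul_eq_mul]

theorem integrable_fderiv_schwartz (K : SchwartzMap Plane ℝ) : Integrable (fderiv ℝ K) :=
  (SchwartzMap.fderivCLM ℝ Plane ℝ K).integrable

theorem exists_bddC2_schwartz (K : SchwartzMap Plane ℝ) : ∃ C, BddC2 C K := by
  have hb : ∀ {F : Type} [NormedAddCommGroup F] [NormedSpace ℝ F] (f : SchwartzMap Plane F),
      ∃ C, ∀ x, ‖f x‖ ≤ C := fun f => by
    obtain ⟨C, -, hC⟩ := f.decay 0 0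
    exact ⟨C, fun x => by simpa using hC x⟩
  obtain ⟨C₀, h₀⟩ := hb K
  obtain ⟨C₁, h₁⟩ := hb (SchwartzMap.fderivCLM ℝ Plane ℝ K)
  obtain ⟨C₂, h₂⟩ := hb (SchwartzMap.fderivCLM ℝ Plane _ (SchwartzMap.fderivCLM ℝ Plane ℝ K))
  exact ⟨max C₀ (max C₁ C₂), K.smooth 2, fun x => (h₀ x).trans (le_max_left _ _),
    fun x => (h₁ x).trans ((le_max_left _ _).trans (le_max_right _ _)),
    fun x => (h₂ x).trans ((le_max_right _ _).trans (le_max_right _ _))⟩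

end Schwartz

section Sobolev

/-- The embedding of `W^{1,1}(ℝ²)` into `L²(ℝ²)`. -/
theorem exists_eLpNorm_two_le :
    ∃ C : ℝ≥0, ∀ (F : Type) [NormedAddCommGroup F] [NormedSpace ℝ F] (f : Plane → F),
      ContDiff ℝ 1 f →
        eLpNorm f 2 volume ≤ C * ((∫⁻ x, ‖f x‖ₑ) + ∫⁻ x, ‖fderiv ℝ f x‖ₑ) := by
  let β : ContDiffBump (0 : Plane) := ⟨1, 2, one_pos, one_lt_two⟩
  have hβ : ContDiff ℝ 1 β := β.contDiff
  obtain ⟨A, hA⟩ := (hβ.continuous_fderiv (by norm_num)).bounded_above_of_compact_support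
    (β.hasCompactSupport.fderiv (𝕜 := ℝ))
  -- Adding 1 lets the single constant A' dominate both the gradients of the cutoffs and the cutoffs
  -- themselves.
  set A' : ℝ≥0 := A.toNNReal + 1 with hA'
  have hAe : ∀ x, ‖fderiv ℝ β x‖ₑ ≤ A' := fun x => by
    rw [enorm_le_coe, ← NNReal.coe_le_coe, coe_nnnorm, hA']
    push_cast
    exact (hA x).trans (by linarith [Real.le_coe_toNNReal A])
  set S : ℝ≥0 := eLpNormLESNormFDerivOneConst (volume : Measure Plane) (2 : ℝ≥0) with hS
  refine ⟨S * A', fun F _ _ f hf => ?_⟩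
  have hp : NNReal.HolderConjugate (Module.finrank ℝ Plane : ℝ≥0) 2 := by
    rw [finrank_euclideanSpace_fin]
    rw [NNReal.holderConjugate_iff]
    norm_num
  let χ : ℕ → Plane → ℝ := fun n x => β ((n + 1 : ℝ)⁻¹ • x)
  have hχ : ∀ n, ContDiff ℝ 1 (χ n) := fun n => hβ.comp (contDiff_const_smul _)
  have hχc : ∀ n, HasCompactSupport (χ n) := fun n =>
    β.hasCompactSupport.comp_smul (inv_ne_zero (by positivity))
  have hχd : ∀ n x, ‖fderiv ℝ (χ n) x‖ₑ ≤ A' := fun n x => by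
    have h1 : fderiv ℝ (χ n) x = (n + 1 : ℝ)⁻¹ • fderiv ℝ β ((n + 1 : ℝ)⁻¹ • x) :=
      fderiv_comp_smul (f := β) _
    have h2 : ‖(n + 1 : ℝ)⁻¹‖ₑ ≤ 1 := by
      rw [← enorm_one (G := ℝ)]
      refine enorm_le_iff_norm_le.2 ?_
      rw [norm_one, norm_inv, Real.norm_of_nonneg (by positivity)]
      exact inv_le_one_of_one_le₀ (by linarith [n.cast_nonneg (α := ℝ)])
    rw [h1, enorm_smul]
    exact (mul_le_mul' h2 (hAe _)).trans_eq (one_mul _)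
  have hχ1 : ∀ n x, ‖χ n x‖ₑ ≤ 1 := fun n x => by
    rw [← enorm_one (G := ℝ)]
    refine enorm_le_iff_norm_le.2 ?_
    rw [norm_one, Real.norm_of_nonneg β.nonneg]
    exact β.le_one
  have hbound : ∀ n, eLpNorm (fun x => χ n x • f x) 2 volume ≤
      S * A' * ((∫⁻ x, ‖f x‖ₑ) + ∫⁻ x, ‖fderiv ℝ f x‖ₑ) := fun n => by
    have h1 := eLpNorm_le_eLpNorm_fderiv_one (volume : Measure Plane) ((hχ n).smul hf)
      (hχc n).smul_right hp
    refine (show eLpNorm (fun x => χ n x • f x) 2 volume ≤ _ from h1).trans ?_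
    rw [mul_assoc, eLpNorm_one_eq_lintegral_enorm]
    refine mul_le_mul_right ?_ _
    rw [← lintegral_add_left hf.continuous.enorm.measurable,
      ← lintegral_const_mul' _ _ ENNReal.coe_ne_top]
    refine lintegral_mono fun x => ?_
    have h2 : fderiv ℝ (χ n • f) x = χ n x • fderiv ℝ f x + (fderiv ℝ (χ n) x).smulRight (f x) :=
      fderiv_smul ((hχ n).differentiable (by norm_num) x) (hf.differentiable (by norm_num) x)
    have h3 : ‖(fderiv ℝ (χ n) x).smulRight (f x)‖ₑ = ‖fderiv ℝ (χ n) x‖ₑ * ‖f x‖ₑ := by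
      rw [← ofReal_norm, ContinuousLinearMap.norm_smulRight_apply,
        ENNReal.ofReal_mul (norm_nonneg _), ofReal_norm, ofReal_norm]
    rw [h2]
    refine (enorm_add_le _ _).trans ?_
    rw [enorm_smul, h3, mul_add, add_comm]
    have hA1 : (1 : ℝ≥0∞) ≤ A' := by
      rw [← ENNReal.coe_one, ENNReal.coe_le_coe, hA']
      exact le_add_self
    gcongr
    · exact hχd n x
    · exact (hχ1 n x).trans hA1
  -- Compact support is removed by Fatou's lemma: the truncations satisfy a bound independent of n
  -- and converge pointwise to f.
  refine (Lp.eLpNorm_lim_le_liminf_eLpNorm (f := fun n x => χ n x • f x)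
    (fun n => ((hχ n).continuous.smul hf.continuous).aestronglyMeasurable) f
    (ae_of_all _ fun x => ?_)).trans ?_
  · have hlim : Tendsto (fun n : ℕ => (n + 1 : ℝ)⁻¹ • x) atTop (𝓝 0) := by
      have := (tendsto_inv_atTop_zero.comp
        (tendsto_natCast_atTop_atTop.atTop_add (tendsto_const_nhds (x := (1 : ℝ))))).smul_const x
      simpa using this
    have hev : ∀ᶠ n : ℕ in atTop, χ n x • f x = f x := by
      filter_upwards [hlim (ball_mem_nhds 0 one_pos)] with n hn
      rw [show χ n x = 1 from β.one_of_mem_closedBall (ball_subset_closedBall hn), one_smul]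
    exact tendsto_const_nhds.congr' (hev.mono fun n hn => hn.symm)
  · push_cast
    refine liminf_le_of_le (by isBoundedDefault) fun b hb => ?_
    obtain ⟨n, hn⟩ := hb.exists
    exact hn.trans (hbound n)

theorem exists_integral_sq_norm_le :
    ∃ C : ℝ, 0 ≤ C ∧ ∀ (F : Type) [NormedAddCommGroup F] [NormedSpace ℝ F] (f : Plane → F) (a : ℝ),
      ContDiff ℝ 1 f → 0 ≤ a →
        (∫⁻ x, ‖f x‖ₑ) + (∫⁻ x, ‖fderiv ℝ f x‖ₑ) ≤ ENNReal.ofReal a →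
        Integrable (fun x => ‖f x‖ ^ 2) ∧ ∫ x, ‖f x‖ ^ 2 ≤ (C * a) ^ 2 := by
  obtain ⟨C, hC⟩ := exists_eLpNorm_two_le
  refine ⟨C, C.coe_nonneg, fun F _ _ f a hf ha h => ?_⟩
  have h1 : eLpNorm f 2 volume ≤ ENNReal.ofReal (C * a) := by
    rw [ENNReal.ofReal_mul C.coe_nonneg, ENNReal.ofReal_coe_nnreal]
    exact (hC F f hf).trans (mul_le_mul_right h _)
  have hm : MemLp f 2 volume := ⟨hf.continuous.aestronglyMeasurable, h1.trans_lt ENNReal.ofReal_lt_top⟩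
  refine ⟨(memLp_two_iff_integrable_sq_norm hf.continuous.aestronglyMeasurable).1 hm, ?_⟩
  rw [hm.eLpNorm_eq_integral_rpow_norm two_ne_zero (by simp),
    ENNReal.ofReal_le_ofReal_iff (by positivity)] at h1
  simp only [ENNReal.toReal_ofNat, Real.rpow_ofNat] at h1
  have h2 : 0 ≤ ∫ x, ‖f x‖ ^ 2 := integral_nonneg fun x => sq_nonneg _
  rw [show (2 : ℝ)⁻¹ = 1 / 2 by norm_num, ← Real.sqrt_eq_rpow] at h1
  exact (Real.sqrt_le_left (by positivity)).1 h1

end Sobolev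


/-! ### Masks -/

section Masks

variable {R r L γ : ℝ} {u v : Plane → ℝ}

theorem abs_le_one_of_mem_maskSet (hu : u ∈ maskSet R) : ∀ᵐ x, |u x| ≤ 1 := by
  filter_upwards [hu.2.1, hu.2.2] with x h1 h2
  by_cases hx : x ∈ ball (0 : Plane) R
  · exact abs_le.2 ⟨by linarith [(h2 hx).1], (h2 hx).2⟩
  · simp [h1 hx]

theorem integral_abs_le_of_mem_maskSet (hu : u ∈ maskSet R) :
    ∫ x, |u x| ≤ volume.real (ball (0 : Plane) R) := by
  have hi : Integrable ((ball (0 : Plane) R).indicator fun _ => (1 : ℝ)) :=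
    (integrable_indicator_iff measurableSet_ball).2 (integrableOn_const measure_ball_lt_top.ne)
  have h : ∫ x, |u x| ≤ ∫ x, (ball (0 : Plane) R).indicator (fun _ => (1 : ℝ)) x := by
    refine integral_mono_ae hu.1.abs hi ?_
    filter_upwards [hu.2.1, abs_le_one_of_mem_maskSet hu] with x h1 h2
    by_cases hx : x ∈ ball (0 : Plane) R
    · rwa [Set.indicator_of_mem hx]
    · rw [h1 hx, abs_zero]
      exact Set.indicator_nonneg (fun _ _ => zero_le_one) _
  rwa [integral_indicator measurableSet_ball, setIntegral_const, smul_eq_mul, mul_one] at h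

theorem l1Dist_eq_integral (hu : ∀ᵐ x, x ∉ ball (0 : Plane) R → u x = 0)
    (hv : ∀ᵐ x, x ∉ ball (0 : Plane) R → v x = 0) : l1Dist R u v = ∫ x, |u x - v x| := by
  refine setIntegral_eq_integral_of_ae_compl_eq_zero ?_
  filter_upwards [hu, hv] with x h1 h2 hx
  rw [h1 hx, h2 hx, sub_zero, abs_zero]

theorem indicator_mem_maskSet {D : Set Plane} (hD : MeasurableSet D) (hDR : D ⊆ ball 0 R) :
    D.indicator (1 : Plane → ℝ) ∈ maskSet R := by
  classical
  refine ⟨(integrable_indicator_iff hD).2 (integrableOn_const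
    ((measure_mono hDR).trans_lt measure_ball_lt_top).ne), ae_of_all _ fun x hx => ?_,
    ae_of_all _ fun x _ => ?_⟩
  · exact Set.indicator_of_notMem (fun h => hx (hDR h)) _
  · simp only [Set.indicator_apply, Pi.one_apply]
    split_ifs <;> norm_num

end Masks

/-! ### The image intensity as a weighted integral of product kernels -/

section Hopkins

variable {R C : ℝ} {u v K J : Plane → ℝ}

/-- The weight `u(ξ) u(η) J(ξ - η)` of the image intensity. -/
def hopkinsWeight (J u : Plane → ℝ) (z : Plane × Plane) : ℝ := u z.1 * u z.2 * J (z.1 - z.2)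

/-- The product kernel `K(x - ξ) K(x - η)`. -/
def hopkinsKernel (K : Plane → ℝ) (z : Plane × Plane) (x : Plane) : ℝ := K (x - z.1) * K (x - z.2)

theorem integrable_hopkinsWeight (hu : Integrable u) (hJ : Measurable J)
    (hJb : ∀ x, |J x| ≤ C) : Integrable (hopkinsWeight J u) :=
  (hu.mul_prod hu).mul_bdd (c := C)
    (hJ.comp (measurable_fst.sub measurable_snd)).aestronglyMeasurable (ae_of_all _ fun _ => hJb _)

theorem contDiff_hopkinsKernel {n : WithTop ℕ∞} (hK : ContDiff ℝ n K) :
    ContDiff ℝ n (Function.uncurry (hopkinsKernel K)) :=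
  (hK.comp (contDiff_snd.sub (contDiff_fst.comp contDiff_fst))).mul
    (hK.comp (contDiff_snd.sub (contDiff_snd.comp contDiff_fst)))

theorem bddC2_hopkinsKernel (hK : BddC2 C K) (z : Plane × Plane) :
    BddC2 (4 * (C * C)) (hopkinsKernel K z) :=
  (hK.comp_sub_right z.1).mul (hK.comp_sub_right z.2)

theorem fderiv_hopkinsKernel (hK : Differentiable ℝ K) (z : Plane × Plane) (x : Plane) :
    fderiv ℝ (hopkinsKernel K z) x =
      K (x - z.1) • fderiv ℝ K (x - z.2) + K (x - z.2) • fderiv ℝ K (x - z.1) := by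
  have hd : ∀ a : Plane, HasFDerivAt (fun x => K (x - a)) (fderiv ℝ K (x - a)) x := fun a =>
    (hasFDerivAt_comp_sub a).2 (hK _).hasFDerivAt
  exact ((hd z.1).mul (hd z.2)).fderiv

theorem hopkins_eq (hw : Integrable (hopkinsWeight J u)) (hK : BddC2 C K) (x : Plane) :
    hopkins K J u x = ∫ z, hopkinsWeight J u z • hopkinsKernel K z x := by
  have hk : Continuous fun z => hopkinsKernel K z x :=
    (contDiff_hopkinsKernel hK.contDiff).continuous.comp (Continuous.prodMk_left x)
  have hi := integrable_smul_of_bound hw hk fun z => (bddC2_hopkinsKernel hK z).bound x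
  refine (?_ : _ = _).trans (integral_prod _ hi).symm
  refine integral_congr_ae (ae_of_all _ fun ξ => integral_congr_ae (ae_of_all _ fun η => ?_))
  simp only [hopkinsWeight, hopkinsKernel, smul_eq_mul]
  ring

theorem bddC2_hopkins (hw : Integrable (hopkinsWeight J u)) (hK : BddC2 C K) :
    BddC2 ((∫ z, |hopkinsWeight J u z|) * (4 * (C * C))) (hopkins K J u) := by
  rw [funext (hopkins_eq hw hK)]
  exact BddC2.integral_smul hw (contDiff_hopkinsKernel hK.contDiff) (bddC2_hopkinsKernel hK)

theorem fderiv_hopkins (hw : Integrable (hopkinsWeight J u)) (hK : BddC2 C K) (x : Plane) :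
    fderiv ℝ (hopkins K J u) x = ∫ z, hopkinsWeight J u z • fderiv ℝ (hopkinsKernel K z) x := by
  rw [funext (hopkins_eq hw hK)]
  exact (hasFDerivAt_integral_smul hw ((contDiff_hopkinsKernel hK.contDiff).of_le (by norm_num))
    (fun z => (bddC2_hopkinsKernel hK z).bound)
    (fun z => (bddC2_hopkinsKernel hK z).bound_fderiv) x).fderiv

/-- The quadratic weight is split as u⊗u - v⊗v = u⊗(u - v) + (u - v)⊗v, and each product integral
factors. -/
theorem integral_abs_hopkinsWeight_sub_le (hC : 0 ≤ C) (hu : Integrable u) (hv : Integrable v)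
    (hJ : Measurable J) (hJb : ∀ x, |J x| ≤ C) :
    ∫ z, |hopkinsWeight J u z - hopkinsWeight J v z| ≤
      C * (((∫ x, |u x|) + ∫ x, |v x|) * ∫ x, |u x - v x|) := by
  have hd : Integrable fun x => |u x - v x| := (hu.sub hv).abs
  have h1 : Integrable fun z : Plane × Plane => |u z.1| * |u z.2 - v z.2| := hu.abs.mul_prod hd
  have h2 : Integrable fun z : Plane × Plane => |u z.1 - v z.1| * |v z.2| := hd.mul_prod hv.abs
  calc ∫ z, |hopkinsWeight J u z - hopkinsWeight J v z|
      ≤ ∫ z : Plane × Plane, C * (|u z.1| * |u z.2 - v z.2| + |u z.1 - v z.1| * |v z.2|) := by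
        refine integral_mono ((integrable_hopkinsWeight hu hJ hJb).sub
          (integrable_hopkinsWeight hv hJ hJb)).abs ((h1.add h2).const_mul C) fun z => ?_
        simp only [hopkinsWeight]
        rw [← sub_mul, abs_mul, mul_comm]
        refine mul_le_mul (hJb _) ?_ (abs_nonneg _) hC
        rw [show u z.1 * u z.2 - v z.1 * v z.2 =
          u z.1 * (u z.2 - v z.2) + (u z.1 - v z.1) * v z.2 by ring, ← abs_mul, ← abs_mul]
        exact abs_add_le _ _
    _ = C * (((∫ x, |u x|) + ∫ x, |v x|) * ∫ x, |u x - v x|) := by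
        rw [integral_const_mul, integral_add h1 h2]
        have e1 : ∫ z : Plane × Plane, |u z.1| * |u z.2 - v z.2| =
            (∫ x, |u x|) * ∫ x, |u x - v x| :=
          integral_prod_mul (fun x => |u x|) fun x => |u x - v x|
        have e2 : ∫ z : Plane × Plane, |u z.1 - v z.1| * |v z.2| =
            (∫ x, |u x - v x|) * ∫ x, |v x| :=
          integral_prod_mul (fun x => |u x - v x|) fun x => |v x|
        rw [e1, e2]
        ring

theorem exists_bddC2_hopkins (R : ℝ) (hK : BddC2 C K) (hJ : Measurable J)
    {A : ℝ} (hJb : ∀ x, |J x| ≤ A) :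
    ∃ B, ∀ u ∈ maskSet R, BddC2 B (hopkins K J u) := by
  have hA : 0 ≤ A := (abs_nonneg _).trans (hJb 0)
  set V := volume.real (ball (0 : Plane) R)
  refine ⟨A * ((V + 0) * V) * (4 * (C * C)), fun u hu => ?_⟩
  refine (bddC2_hopkins (integrable_hopkinsWeight hu.1 hJ hJb) hK).mono ?_
  -- Comparison with the zero mask bounds the L¹ norm of the weight by the area of the disc alone.
  have h := integral_abs_hopkinsWeight_sub_le (v := fun _ => 0) hA hu.1 (integrable_zero _ _ _)
    hJ hJb
  have hV := integral_abs_le_of_mem_maskSet hu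
  have hn : 0 ≤ ∫ x, |u x| := integral_nonneg fun x => abs_nonneg _
  simp only [hopkinsWeight, zero_mul, sub_zero, abs_zero, integral_zero] at h ⊢
  have h2 : ((∫ x, |u x|) + 0) * ∫ x, |u x| ≤ (V + 0) * V := by gcongr
  have h3 := h.trans (mul_le_mul_of_nonneg_left h2 hA)
  exact mul_le_mul_of_nonneg_right h3 (by nlinarith [hK.nonneg])

theorem exists_hopkins_sub_le (R : ℝ) (hK : BddC2 C K) (hJ : Measurable J)
    {A : ℝ} (hJb : ∀ x, |J x| ≤ A) :
    ∃ B, 0 ≤ B ∧ ∀ u ∈ maskSet R, ∀ v ∈ maskSet R, ∀ x,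
      |hopkins K J u x - hopkins K J v x| ≤ B * l1Dist R u v ∧
      ‖fderiv ℝ (hopkins K J u) x - fderiv ℝ (hopkins K J v) x‖ ≤ B * l1Dist R u v := by
  have hA : 0 ≤ A := (abs_nonneg _).trans (hJb 0)
  have hC := hK.nonneg
  set V := volume.real (ball (0 : Plane) R)
  have hV0 : 0 ≤ V := measureReal_nonneg
  refine ⟨A * (V + V) * (4 * (C * C)), by positivity, fun u hu v hv x => ?_⟩
  have hwu := integrable_hopkinsWeight hu.1 hJ hJb
  have hwv := integrable_hopkinsWeight hv.1 hJ hJb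
  have hk : Continuous fun z => hopkinsKernel K z x :=
    (contDiff_hopkinsKernel hK.contDiff).continuous.comp (Continuous.prodMk_left x)
  have hk' : Continuous fun z => fderiv ℝ (hopkinsKernel K z) x :=
    ((contDiff_hopkinsKernel hK.contDiff).fderiv (contDiff_const (c := x)) (n := 0)
      (by norm_num)).continuous
  have hb := fun z => bddC2_hopkinsKernel hK z
  have hW : ∫ z, |hopkinsWeight J u z - hopkinsWeight J v z| ≤ A * (V + V) * l1Dist R u v := by
    rw [l1Dist_eq_integral hu.2.1 hv.2.1, mul_assoc]
    refine (integral_abs_hopkinsWeight_sub_le hA hu.1 hv.1 hJ hJb).trans ?_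
    have h1 := integral_abs_le_of_mem_maskSet hu
    have h2 := integral_abs_le_of_mem_maskSet hv
    have h3 : 0 ≤ ∫ x, |u x - v x| := integral_nonneg fun x => abs_nonneg _
    gcongr
  have hfin : (∫ z, |hopkinsWeight J u z - hopkinsWeight J v z|) * (4 * (C * C)) ≤
      A * (V + V) * (4 * (C * C)) * l1Dist R u v := by
    rw [mul_right_comm]
    exact mul_le_mul_of_nonneg_right hW (by positivity)
  constructor
  · rw [hopkins_eq hwu hK, hopkins_eq hwv hK,
      ← integral_sub (integrable_smul_of_bound hwu hk fun z => (hb z).bound x)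
        (integrable_smul_of_bound hwv hk fun z => (hb z).bound x)]
    simp only [← sub_smul]
    exact (norm_integral_smul_le (hwu.sub hwv) fun z => (hb z).bound x).trans hfin
  · rw [fderiv_hopkins hwu hK, fderiv_hopkins hwv hK,
      ← integral_sub (integrable_smul_of_bound hwu hk' fun z => (hb z).bound_fderiv x)
        (integrable_smul_of_bound hwv hk' fun z => (hb z).bound_fderiv x)]
    simp only [← sub_smul]
    exact (norm_integral_smul_le (hwu.sub hwv) fun z => (hb z).bound_fderiv x).trans hfin

end Hopkins


/-! ### Hölder continuity of the smoothed threshold -/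

section Holder

/-- Interpolation: an increment t of the gradient is at most 2b and at most c|x - y|, and t =
t^(1-α)·t^α uses the first bound in one factor and the second in the other. -/
theorem c1AlphaNorm_le {f : Plane → ℝ} {a b c α : ℝ} (hα0 : 0 ≤ α) (hα1 : α ≤ 1)
    (ha0 : 0 ≤ a) (hb0 : 0 ≤ b) (hc0 : 0 ≤ c)
    (ha : ∀ x, |f x| ≤ a) (hb : ∀ x, ‖fderiv ℝ f x‖ ≤ b)
    (hc : ∀ x y, ‖fderiv ℝ f x - fderiv ℝ f y‖ ≤ c * ‖x - y‖) :
    c1AlphaNorm α f ≤ ENNReal.ofReal (a + b + (2 * b) ^ (1 - α) * c ^ α) := by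
  have hH : 0 ≤ (2 * b) ^ (1 - α) * c ^ α := by positivity
  rw [c1AlphaNorm, ENNReal.ofReal_add (by positivity) hH, ENNReal.ofReal_add ha0 hb0]
  refine add_le_add (add_le_add (iSup_le fun x => ?_) (iSup_le fun x => ?_)) ?_
  · rw [← ofReal_norm]; exact ENNReal.ofReal_le_ofReal (ha x)
  · rw [← ofReal_norm]; exact ENNReal.ofReal_le_ofReal (hb x)
  · refine (HolderWith.eHolderNorm_le (C := ((2 * b) ^ (1 - α) * c ^ α).toNNReal) ?_)
    intro x y
    rw [edist_dist, edist_dist, Real.coe_toNNReal _ hα0,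
      ENNReal.ofReal_rpow_of_nonneg dist_nonneg hα0]
    change _ ≤ ENNReal.ofReal _ * _
    rw [← ENNReal.ofReal_mul hH]
    refine ENNReal.ofReal_le_ofReal ?_
    rw [dist_eq_norm, dist_eq_norm]
    set t := ‖fderiv ℝ f x - fderiv ℝ f y‖
    have ht : 0 ≤ t := norm_nonneg _
    have ht1 : t ≤ 2 * b := (norm_sub_le _ _).trans (by linarith [hb x, hb y])
    have e : t = t ^ (1 - α) * t ^ α := by
      rw [← Real.rpow_add_of_nonneg ht (by linarith) hα0, sub_add_cancel, Real.rpow_one]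
    rw [e, mul_assoc, ← Real.mul_rpow hc0 (norm_nonneg _)]
    exact mul_le_mul (Real.rpow_le_rpow ht ht1 (by linarith))
      (Real.rpow_le_rpow ht (hc x y) hα0) (by positivity) (by positivity)

theorem BddC2.norm_fderiv_sub_le {C : ℝ} {f : Plane → ℝ} (h : BddC2 C f) (x y : Plane) :
    ‖fderiv ℝ f x - fderiv ℝ f y‖ ≤ C * ‖x - y‖ :=
  convex_univ.norm_image_sub_le_of_norm_fderiv_le
    (fun z _ => h.contDiff_fderiv.differentiable (by norm_num) z)
    (fun z _ => h.bound_fderiv_two z) (Set.mem_univ y) (Set.mem_univ x)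

theorem IsSmoothStep.exists_deriv_bound {φ : ℝ → ℝ} (hφ : IsSmoothStep φ) :
    ∃ A, 0 ≤ A ∧ (∀ t, |deriv φ t| ≤ A) ∧ ∀ t, |deriv (deriv φ) t| ≤ A := by
  have hs : HasCompactSupport (deriv φ) :=
    HasCompactSupport.intro (isCompact_Icc (a := (-(1 / 2) : ℝ)) (b := 1 / 2)) fun t ht =>
      hφ.deriv_eq_zero (not_le.1 fun h => ht (abs_le.1 h))
  have hd : ContDiff ℝ ∞ (deriv φ) := by
    have := (contDiff_infty_iff_deriv (𝕜 := ℝ)).1 hφ.smooth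
    exact this.2
  obtain ⟨A, hA⟩ := hd.continuous.bounded_above_of_compact_support hs
  obtain ⟨B, hB⟩ := (hd.continuous_deriv (by simp)).bounded_above_of_compact_support hs.deriv
  exact ⟨max A B, (norm_nonneg _).trans ((hA 0).trans (le_max_left _ _)),
    fun t => (hA t).trans (le_max_left _ _), fun t => (hB t).trans (le_max_right _ _)⟩

/-- The chain rule gives a bound depending on I only through B, because φ' and φ'' are bounded; for
fixed η the smoothed images are thus uniformly C². -/
theorem exists_bddC2_softThreshold {φ : ℝ → ℝ} (hφ : IsSmoothStep φ) (B h η : ℝ) :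
    ∃ B', ∀ I : Plane → ℝ, BddC2 B I → BddC2 B' (softThreshold φ h η I) := by
  obtain ⟨A, hA0, hA1, hA2⟩ := hφ.exists_deriv_bound
  set e := |η⁻¹|
  refine ⟨max 1 (max (A * e * B) (A * e * B + A * e * B * (e * B))), fun I hI => ?_⟩
  have hB0 := hI.nonneg
  have hd1 : fderiv ℝ (softThreshold φ h η I) =
      fun x => (deriv φ ((I x - h) / η) * η⁻¹) • fderiv ℝ I x :=
    funext fun x => fderiv_softThreshold hφ (hI.differentiable x) h η
  have hφ' : Differentiable ℝ (deriv φ) :=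
    ((contDiff_infty_iff_deriv (𝕜 := ℝ)).1 hφ.smooth).2.differentiable (by simp)
  have hder : ∀ x, HasFDerivAt (fun x => deriv φ ((I x - h) / η) * η⁻¹)
      ((deriv (deriv φ) ((I x - h) / η) * η⁻¹ * η⁻¹) • fderiv ℝ I x) x := fun x => by
    have h1 : HasFDerivAt (fun x => (I x - h) / η) (η⁻¹ • fderiv ℝ I x) x := by
      simp only [div_eq_mul_inv]
      exact ((hI.differentiable x).hasFDerivAt.sub_const h).mul_const η⁻¹
    refine (((hφ' _).hasDerivAt.comp_hasFDerivAt x h1).mul_const η⁻¹).congr_fderiv ?_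
    simp only [smul_smul]
    congr 1
    ring
  have hd2 : ∀ x, fderiv ℝ (fderiv ℝ (softThreshold φ h η I)) x =
      (deriv φ ((I x - h) / η) * η⁻¹) • fderiv ℝ (fderiv ℝ I) x +
      ((deriv (deriv φ) ((I x - h) / η) * η⁻¹ * η⁻¹) • fderiv ℝ I x).smulRight
        (fderiv ℝ I x) := fun x => by
    rw [hd1]
    exact ((hder x).fun_smul
      (hI.contDiff_fderiv.differentiable (by norm_num) x).hasFDerivAt).fderiv
  have hc1 : ∀ x, ‖deriv φ ((I x - h) / η) * η⁻¹‖ ≤ A * e := fun x => by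
    rw [norm_mul]; exact mul_le_mul (hA1 _) le_rfl (norm_nonneg _) hA0
  refine ⟨contDiff_softThreshold (by norm_cast) hφ hI.contDiff h η,
    fun x => le_max_of_le_left ?_, fun x => le_max_of_le_right (le_max_of_le_left ?_),
    fun x => le_max_of_le_right (le_max_of_le_right ?_)⟩
  · have := hφ.mem_Icc ((I x - h) / η)
    exact abs_le.2 ⟨by simp only [softThreshold]; linarith, this.2⟩
  · rw [hd1, norm_smul]
    exact mul_le_mul (hc1 x) (hI.bound_fderiv x) (norm_nonneg _) (by positivity)
  · rw [hd2]
    refine (norm_add_le _ _).trans (add_le_add ?_ ?_)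
    · rw [norm_smul]
      exact mul_le_mul (hc1 x) (hI.bound_fderiv_two x) (norm_nonneg _) (by positivity)
    · rw [ContinuousLinearMap.norm_smulRight_apply, norm_smul, norm_mul, norm_mul]
      have h1 := hA2 ((I x - h) / η)
      have h2 := hI.bound_fderiv x
      calc ‖deriv (deriv φ) ((I x - h) / η)‖ * ‖η⁻¹‖ * ‖η⁻¹‖ * ‖fderiv ℝ I x‖ * ‖fderiv ℝ I x‖
          ≤ A * e * e * B * B := by
            gcongr <;> first | exact h1 | exact le_rfl
        _ = _ := by ring

theorem BddC2.memC1Alpha {C α : ℝ} {f : Plane → ℝ} (h : BddC2 C f) (hα0 : 0 ≤ α) (hα1 : α ≤ 1) :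
    MemC1Alpha α f :=
  ⟨h.contDiff.of_le (by norm_num), (c1AlphaNorm_le hα0 hα1 h.nonneg h.nonneg h.nonneg h.bound
    h.bound_fderiv h.norm_fderiv_sub_le).trans_lt ENNReal.ofReal_lt_top⟩

theorem exists_softThreshold_sub_le {φ : ℝ → ℝ} (hφ : IsSmoothStep φ) (B h η : ℝ) :
    ∃ C, 0 ≤ C ∧ ∀ (I₁ I₂ : Plane → ℝ) (d : ℝ), BddC2 B I₁ → BddC2 B I₂ →
      (∀ x, |I₁ x - I₂ x| ≤ d) → (∀ x, ‖fderiv ℝ I₁ x - fderiv ℝ I₂ x‖ ≤ d) →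
      (∀ x, |softThreshold φ h η I₁ x - softThreshold φ h η I₂ x| ≤ C * d) ∧
      ∀ x, ‖fderiv ℝ (softThreshold φ h η I₁) x - fderiv ℝ (softThreshold φ h η I₂) x‖ ≤
        C * d := by
  obtain ⟨A, hA0, hA1, hA2⟩ := hφ.exists_deriv_bound
  set e := |η⁻¹| with he
  have he0 : 0 ≤ e := abs_nonneg _
  have hlip : ∀ (f : ℝ → ℝ), Differentiable ℝ f → (∀ t, |deriv f t| ≤ A) → ∀ s t,
      |f ((s - h) / η) - f ((t - h) / η)| ≤ A * e * |s - t| := fun f hf hfA s t => by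
    have h1 := convex_univ.norm_image_sub_le_of_norm_deriv_le (fun z _ => hf z)
      (fun z _ => hfA z) (Set.mem_univ ((t - h) / η)) (Set.mem_univ ((s - h) / η))
    rw [Real.norm_eq_abs, Real.norm_eq_abs, ← sub_div, sub_sub_sub_cancel_right, abs_div,
      div_eq_mul_inv |s - t|, ← abs_inv] at h1
    linarith
  have hφd : Differentiable ℝ φ := hφ.smooth.differentiable (by simp)
  have hφ' : Differentiable ℝ (deriv φ) :=
    ((contDiff_infty_iff_deriv (𝕜 := ℝ)).1 hφ.smooth).2.differentiable (by simp)
  refine ⟨A * e + A * e * e * |B|, by positivity, fun I₁ I₂ d hI₁ hI₂ hd hd' => ⟨fun x => ?_,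
    fun x => ?_⟩⟩
  · have hd0 : 0 ≤ d := (abs_nonneg _).trans (hd x)
    refine (hlip φ hφd hA1 (I₁ x) (I₂ x)).trans ?_
    have h1 : A * e * |I₁ x - I₂ x| ≤ A * e * d := by gcongr; exact hd x
    have h2 : 0 ≤ A * e * e * |B| * d := by positivity
    linarith
  · have hd0 : 0 ≤ d := (abs_nonneg _).trans (hd x)
    rw [fderiv_softThreshold hφ (hI₁.differentiable x), fderiv_softThreshold hφ
      (hI₂.differentiable x)]
    have hsplit : (deriv φ ((I₁ x - h) / η) * η⁻¹) • fderiv ℝ I₁ x -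
        (deriv φ ((I₂ x - h) / η) * η⁻¹) • fderiv ℝ I₂ x =
        ((deriv φ ((I₁ x - h) / η) - deriv φ ((I₂ x - h) / η)) * η⁻¹) • fderiv ℝ I₁ x +
        (deriv φ ((I₂ x - h) / η) * η⁻¹) • (fderiv ℝ I₁ x - fderiv ℝ I₂ x) := by
      rw [sub_mul, sub_smul, smul_sub]
      abel
    rw [hsplit]
    refine (norm_add_le _ _).trans ?_
    rw [norm_smul, norm_smul, norm_mul, norm_mul, Real.norm_eq_abs η⁻¹, ← he]
    have h1 : ‖deriv φ ((I₁ x - h) / η) - deriv φ ((I₂ x - h) / η)‖ ≤ A * e * d :=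
      (hlip _ hφ' hA2 (I₁ x) (I₂ x)).trans (by gcongr; exact hd x)
    have h2 : ‖fderiv ℝ I₁ x‖ ≤ |B| := (hI₁.bound_fderiv x).trans (le_abs_self B)
    have h3 : ‖deriv φ ((I₂ x - h) / η)‖ ≤ A := hA1 _
    have h4 := hd' x
    calc _ ≤ A * e * d * e * |B| + A * e * d := by gcongr
      _ = _ := by ring

/-- Hölder continuity of the smooth threshold, for a `C²`-bounded family `I` of intensities
depending on the mask in a Lipschitz way. -/
theorem exists_c1AlphaNorm_softThreshold_sub_le {φ : ℝ → ℝ} (hφ : IsSmoothStep φ) (h η R : ℝ)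
    {p B B₁ : ℝ} (hp : 4 < p) (hB₁ : 0 ≤ B₁) {I : (Plane → ℝ) → Plane → ℝ}
    (hI : ∀ u ∈ maskSet R, BddC2 B (I u))
    (hlip : ∀ u ∈ maskSet R, ∀ v ∈ maskSet R, ∀ x, |I u x - I v x| ≤ B₁ * l1Dist R u v ∧
      ‖fderiv ℝ (I u) x - fderiv ℝ (I v) x‖ ≤ B₁ * l1Dist R u v) :
    ∃ C : ℝ, 0 ≤ C ∧ ∀ u₁ ∈ maskSet R, ∀ u₂ ∈ maskSet R,
      c1AlphaNorm (1 - 4 / p) (fun x =>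
        softThreshold φ h η (I u₁) x - softThreshold φ h η (I u₂) x) ≤
      ENNReal.ofReal (C * l1Dist R u₁ u₂ ^ (1 / p)) := by
  obtain ⟨B', hB'⟩ := exists_bddC2_softThreshold hφ B h η
  obtain ⟨C₀, hC₀, hsub⟩ := exists_softThreshold_sub_le hφ B h η
  have hp0 : 0 < p := by linarith
  have hα1 : 1 - 4 / p ≤ 1 := by have : 0 < 4 / p := by positivity
                                 linarith
  have hα0 : 0 ≤ 1 - 4 / p := by
    rw [sub_nonneg, div_le_one hp0]; exact hp.le
  set V := volume.real (ball (0 : Plane) R) with hV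
  have hV0 : 0 ≤ V := measureReal_nonneg
  set E := C₀ * B₁ with hE
  have hE0 : 0 ≤ E := by positivity
  refine ⟨2 * E * (V + V) ^ (1 - 1 / p) +
    (2 * E) ^ (4 / p) * (2 * |B'|) ^ (1 - 4 / p) * (V + V) ^ (3 / p), by positivity, ?_⟩
  intro u₁ hu₁ u₂ hu₂
  have h1 := hB' _ (hI u₁ hu₁)
  have h2 := hB' _ (hI u₂ hu₂)
  set d := l1Dist R u₁ u₂ with hd
  have hd0 : 0 ≤ d := integral_nonneg fun x => abs_nonneg _
  -- The boundedness of d on A lets the powers d and d^(4/p) be traded for d^(1/p), at the cost of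
  -- the factors (V + V)^(1 - 1/p) and (V + V)^(3/p).
  have hdV : d ≤ V + V := by
    rw [hd, l1Dist_eq_integral hu₁.2.1 hu₂.2.1]
    calc ∫ x, |u₁ x - u₂ x| ≤ ∫ x, (|u₁ x| + |u₂ x|) :=
          integral_mono (hu₁.1.sub hu₂.1).abs (hu₁.1.abs.add hu₂.1.abs) fun x => abs_sub _ _
      _ ≤ V + V := by
          rw [integral_add hu₁.1.abs hu₂.1.abs]
          exact add_le_add (integral_abs_le_of_mem_maskSet hu₁) (integral_abs_le_of_mem_maskSet hu₂)
  obtain ⟨hs0, hs1⟩ := hsub _ _ (B₁ * d) (hI u₁ hu₁) (hI u₂ hu₂)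
    (fun x => (hlip u₁ hu₁ u₂ hu₂ x).1) (fun x => (hlip u₁ hu₁ u₂ hu₂ x).2)
  simp only [← mul_assoc, ← hE] at hs0 hs1
  have hfd : ∀ x, fderiv ℝ (fun x => softThreshold φ h η (I u₁) x -
      softThreshold φ h η (I u₂) x) x =
      fderiv ℝ (softThreshold φ h η (I u₁)) x - fderiv ℝ (softThreshold φ h η (I u₂)) x :=
    fun x => fderiv_fun_sub (h1.differentiable x) (h2.differentiable x)
  -- The difference is of size d in C¹, while its second derivatives are only bounded; hence c =
  -- 2|B'| carries no power of d.
  refine (c1AlphaNorm_le (a := E * d) (b := E * d) (c := 2 * |B'|) hα0 hα1 (by positivity)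
    (by positivity) (by positivity) hs0 (fun x => by rw [hfd]; exact hs1 x)
    fun x y => ?_).trans (ENNReal.ofReal_le_ofReal ?_)
  · rw [hfd, hfd, sub_sub_sub_comm]
    refine (norm_sub_le _ _).trans ?_
    have h3 := h1.norm_fderiv_sub_le x y
    have h4 := h2.norm_fderiv_sub_le x y
    have h5 : B' * ‖x - y‖ ≤ |B'| * ‖x - y‖ := by gcongr; exact le_abs_self _
    linarith
  · have hip : 1 / p ≤ 1 := by rw [div_le_one hp0]; linarith
    have e1 : d ≤ (V + V) ^ (1 - 1 / p) * d ^ (1 / p) := by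
      calc d = d ^ (1 - 1 / p) * d ^ (1 / p) := by
            rw [← Real.rpow_add_of_nonneg hd0 (by linarith) (by positivity), sub_add_cancel,
              Real.rpow_one]
        _ ≤ _ := by gcongr
    have e2 : d ^ (4 / p) ≤ (V + V) ^ (3 / p) * d ^ (1 / p) := by
      calc d ^ (4 / p) = d ^ (3 / p) * d ^ (1 / p) := by
            rw [← Real.rpow_add_of_nonneg hd0 (by positivity) (by positivity)]
            congr 1
            ring
        _ ≤ _ := by gcongr
    rw [sub_sub_cancel, ← mul_assoc 2 E d, Real.mul_rpow (by positivity) hd0]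
    have e3 := mul_le_mul_of_nonneg_left e1 (by positivity : 0 ≤ 2 * E)
    have e4 := mul_le_mul_of_nonneg_left e2
      (by positivity : 0 ≤ (2 * E) ^ (4 / p) * (2 * |B'|) ^ (1 - 4 / p))
    calc _ = 2 * E * d + (2 * E) ^ (4 / p) * (2 * |B'|) ^ (1 - 4 / p) * d ^ (4 / p) := by ring
      _ ≤ _ := add_le_add e3 e4
      _ = _ := by ring

end Holder


/-! ### Bounds for kernels close to the Gaussian -/

section Kernels

/-- A Schwartz kernel whose `L¹` and squared `L²` norms, and those of its gradient, are at most
`A`. -/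
structure KernelBound (A : ℝ) (K : SchwartzMap Plane ℝ) : Prop where
  l1 : ∫ x, |K x| ≤ A
  l1_fderiv : ∫ x, ‖fderiv ℝ K x‖ ≤ A
  sq : ∫ x, |K x| ^ 2 ≤ A
  sq_fderiv : ∫ x, ‖fderiv ℝ K x‖ ^ 2 ≤ A

theorem KernelBound.mono {A A' : ℝ} {K : SchwartzMap Plane ℝ} (h : KernelBound A K)
    (hA : A ≤ A') : KernelBound A' K :=
  ⟨h.l1.trans hA, h.l1_fderiv.trans hA, h.sq.trans hA, h.sq_fderiv.trans hA⟩

theorem contDiff_sub_gauss (T : SchwartzMap Plane ℝ) : ContDiff ℝ ∞ fun x => T x - gauss x :=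
  (T.smooth ⊤).sub contDiff_gauss

theorem fderiv_sub_gauss (T : SchwartzMap Plane ℝ) (x : Plane) :
    fderiv ℝ (fun x => T x - gauss x) x = fderiv ℝ T x - fderiv ℝ gauss x :=
  fderiv_fun_sub (T.differentiable x) (hasFDerivAt_gauss x).differentiableAt

theorem integral_norm_le_of_lintegral_le {F : Type*} [NormedAddCommGroup F] {f : Plane → F}
    (hf : Integrable f) {a : ℝ} (ha : 0 ≤ a) (h : ∫⁻ x, ‖f x‖ₑ ≤ ENNReal.ofReal a) :
    ∫ x, ‖f x‖ ≤ a := by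
  rw [integral_norm_eq_lintegral_enorm hf.aestronglyMeasurable]
  exact ENNReal.toReal_le_of_le_ofReal ha h

theorem integral_abs_sub_gauss_le {T : SchwartzMap Plane ℝ} {δ : ℝ} (hδ : 0 ≤ δ)
    (h : w11Norm (fun x => T x - gauss x) ≤ ENNReal.ofReal δ) :
    ∫ x, |T x - gauss x| ≤ δ ∧ ∫ x, ‖fderiv ℝ T x - fderiv ℝ gauss x‖ ≤ δ := by
  constructor
  · exact integral_norm_le_of_lintegral_le (T.integrable.sub integrable_gauss) hδ
      (le_self_add.trans h)
  · refine integral_norm_le_of_lintegral_le (f := fun x => fderiv ℝ T x - fderiv ℝ gauss x)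
      ((integrable_fderiv_schwartz T).sub integrable_fderiv_gauss) hδ ?_
    simp only [← fderiv_sub_gauss]
    exact le_add_self.trans h

theorem integrable_and_integral_le_of_le_wideGauss {f : Plane → ℝ} (hc : Continuous f)
    (h0 : ∀ x, 0 ≤ f x) (h : ∀ x, f x ≤ wideGauss x) :
    Integrable f ∧ ∫ x, f x ≤ 8 * Real.pi := by
  have hi : Integrable f := integrable_wideGauss.mono' hc.aestronglyMeasurable
    (ae_of_all _ fun x => by rw [Real.norm_of_nonneg (h0 x)]; exact h x)
  exact ⟨hi, integral_wideGauss ▸ integral_mono hi integrable_wideGauss h⟩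

theorem integral_sq_norm_add_le {F : Type*} [NormedAddCommGroup F] {f g : Plane → F} {a b : ℝ}
    (hg : Integrable fun x => ‖g x‖ ^ 2)
    (hfg : Integrable fun x => ‖f x - g x‖ ^ 2) (ha : ∫ x, ‖f x - g x‖ ^ 2 ≤ a)
    (hb : ∫ x, ‖g x‖ ^ 2 ≤ b) : ∫ x, ‖f x‖ ^ 2 ≤ 2 * a + 2 * b := by
  have hpt : ∀ x, ‖f x‖ ^ 2 ≤ 2 * ‖f x - g x‖ ^ 2 + 2 * ‖g x‖ ^ 2 := fun x => by
    have h1 : ‖f x‖ ≤ ‖f x - g x‖ + ‖g x‖ := by simpa using norm_add_le (f x - g x) (g x)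
    nlinarith [norm_nonneg (f x), sq_nonneg (‖f x - g x‖ - ‖g x‖)]
  calc ∫ x, ‖f x‖ ^ 2 ≤ ∫ x, (2 * ‖f x - g x‖ ^ 2 + 2 * ‖g x‖ ^ 2) :=
        integral_mono_of_nonneg (ae_of_all _ fun x => sq_nonneg _)
          ((hfg.const_mul 2).add (hg.const_mul 2)) (ae_of_all _ hpt)
    _ ≤ _ := by
        rw [integral_add (hfg.const_mul 2) (hg.const_mul 2), integral_const_mul,
          integral_const_mul]
        linarith

theorem integral_norm_add_le {F : Type*} [NormedAddCommGroup F] {f g : Plane → F} {a b : ℝ}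
    (hf : Integrable f) (hg : Integrable g) (ha : ∫ x, ‖f x - g x‖ ≤ a)
    (hb : ∫ x, ‖g x‖ ≤ b) : ∫ x, ‖f x‖ ≤ a + b := by
  calc ∫ x, ‖f x‖ ≤ ∫ x, (‖f x - g x‖ + ‖g x‖) :=
        integral_mono hf.norm ((hf.sub hg).norm.add hg.norm) fun x => by
          simpa using norm_add_le (f x - g x) (g x)
    _ = (∫ x, ‖f x - g x‖) + ∫ x, ‖g x‖ := integral_add (hf.sub hg).norm hg.norm
    _ ≤ _ := add_le_add ha hb

/-- Kernels close to the Gaussian in `W^{1,1}`, with bounded Hessian in `L¹`, are uniformly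
bounded in `W^{1,1} ∩ W^{1,2}`. -/
theorem exists_kernelBound {M : ℝ} (hM : 0 ≤ M) :
    ∃ A : ℝ, 0 ≤ A ∧ ∀ (T : SchwartzMap Plane ℝ) (δ : ℝ), 0 ≤ δ → δ ≤ 1 →
      w11Norm (fun x => T x - gauss x) ≤ ENNReal.ofReal δ →
      hessL1Norm (fun x => T x - gauss x) ≤ ENNReal.ofReal M → KernelBound A T := by
  obtain ⟨C, hC0, hC⟩ := exists_integral_sq_norm_le
  have hpi := Real.pi_gt_three
  -- One constant serves all four norms: the first term covers the squared L² norms of T - G and its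
  -- gradient, via the Sobolev embedding and δ ≤ 1; the second covers the Gaussian, whose majorant
  -- has integral 8π.
  refine ⟨2 * (C * (1 + M)) ^ 2 + 2 * (8 * Real.pi), by positivity, fun T δ hδ0 hδ1 hw hh => ?_⟩
  obtain ⟨h1, h2⟩ := integral_abs_sub_gauss_le hδ0 hw
  have gc := contDiff_gauss.continuous
  have gc' := continuous_fderiv_gauss
  have gw : ∀ x, ‖gauss x‖ ≤ wideGauss x := fun x => by
    rw [Real.norm_of_nonneg (gauss_pos x).le]; exact gauss_le_wideGauss x
  have gw' : ∀ x, ‖fderiv ℝ gauss x‖ ≤ wideGauss x := fun x => by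
    rw [norm_fderiv_gauss]; exact gauss_mul_norm_le_wideGauss x
  obtain ⟨-, g1⟩ := integrable_and_integral_le_of_le_wideGauss gc.norm (fun x => norm_nonneg _) gw
  obtain ⟨-, g2⟩ := integrable_and_integral_le_of_le_wideGauss gc'.norm (fun x => norm_nonneg _) gw'
  obtain ⟨j3, g3⟩ := integrable_and_integral_le_of_le_wideGauss
    (f := fun x => ‖gauss x‖ ^ 2) (gc.norm.pow 2)
    (fun x => sq_nonneg _) fun x => by
      nlinarith [norm_gauss_le_one x, gw x, norm_nonneg (gauss x)]
  obtain ⟨j4, g4⟩ := integrable_and_integral_le_of_le_wideGauss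
    (f := fun x => ‖fderiv ℝ gauss x‖ ^ 2) (gc'.norm.pow 2)
    (fun x => sq_nonneg _) fun x => by
      nlinarith [norm_fderiv_gauss_le_one x, gw' x, norm_nonneg (fderiv ℝ gauss x)]
  have hE := contDiff_sub_gauss T
  have hE' : ContDiff ℝ 1 (fderiv ℝ fun x => T x - gauss x) := hE.fderiv_right (by norm_cast)
  obtain ⟨i1, b1⟩ := hC ℝ _ δ (hE.of_le (by norm_cast)) hδ0 hw
  have hw' : (∫⁻ x, ‖fderiv ℝ (fun x => T x - gauss x) x‖ₑ) +
      (∫⁻ x, ‖fderiv ℝ (fderiv ℝ fun x => T x - gauss x) x‖ₑ) ≤ ENNReal.ofReal (δ + M) := by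
    rw [ENNReal.ofReal_add hδ0 hM]
    refine add_le_add (le_add_self.trans hw) (le_trans (le_of_eq ?_) hh)
    refine lintegral_congr fun x => ?_
    rw [← ofReal_norm, ← ofReal_norm, ← norm_iteratedFDeriv_one, norm_iteratedFDeriv_fderiv]
  obtain ⟨i2, b2⟩ := hC _ _ (δ + M) hE' (by positivity) hw'
  simp only [fderiv_sub_gauss] at i2 b2
  have t1 := integral_norm_add_le T.integrable integrable_gauss h1 g1
  have t2 := integral_norm_add_le (integrable_fderiv_schwartz T) integrable_fderiv_gauss h2 g2
  have t3 := integral_sq_norm_add_le j3 i1 b1 g3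
  have t4 := integral_sq_norm_add_le j4 i2 b2 g4
  have hCM : (C * δ) ^ 2 ≤ (C * (1 + M)) ^ 2 := by gcongr; linarith
  have hCM' : (C * (δ + M)) ^ 2 ≤ (C * (1 + M)) ^ 2 := by gcongr
  have hsq : 0 ≤ (C * (1 + M)) ^ 2 := sq_nonneg _
  exact ⟨t1.trans (by linarith), t2.trans (by linarith), t3.trans (by linarith),
    t4.trans (by linarith)⟩

theorem fderiv_dilate (f : Plane → ℝ) (ρ : ℝ) (x : Plane) (hf : Differentiable ℝ f) :
    fderiv ℝ (dilate f ρ) x = ((ρ ^ 2)⁻¹ * ρ⁻¹) • fderiv ℝ f (ρ⁻¹ • x) := by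
  have h : DifferentiableAt ℝ (fun x => f (ρ⁻¹ • x)) x :=
    (hf.comp (differentiable_id.const_smul ρ⁻¹)) x
  have h2 : fderiv ℝ (dilate f ρ) x = (ρ ^ 2)⁻¹ • fderiv ℝ (fun x => f (ρ⁻¹ • x)) x :=
    fderiv_const_mul h _
  rw [h2, fderiv_comp_smul, smul_smul]

theorem integral_comp_inv_smul_plane (f : Plane → ℝ) {ρ : ℝ} (hρ : 0 < ρ) :
    ∫ x, f (ρ⁻¹ • x) = ρ ^ 2 * ∫ x, f x := by
  rw [Measure.integral_comp_inv_smul_of_nonneg volume f hρ.le, finrank_euclideanSpace_fin,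
    smul_eq_mul]

/-- The four quantities scale by ρ to the powers 0, -1, -2 and -4, and ρ ≤ 1 makes the last the
worst. -/
theorem KernelBound.dilate {A ρ : ℝ} {T K : SchwartzMap Plane ℝ} (h : KernelBound A T)
    (hA : 0 ≤ A) (hρ0 : 0 < ρ) (hρ1 : ρ ≤ 1) (hK : ⇑K = Litho.dilate T ρ) :
    KernelBound (A * (ρ⁻¹) ^ 4) K := by
  have hinv : 1 ≤ ρ⁻¹ := (one_le_inv₀ hρ0).2 hρ1
  have hρne := hρ0.ne'
  have key : ∀ (n : ℕ) {I : ℝ}, n ≤ 4 → I ≤ A → ρ⁻¹ ^ n * I ≤ A * ρ⁻¹ ^ 4 := fun n I hn hI => by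
    have h1 : ρ⁻¹ ^ n ≤ ρ⁻¹ ^ 4 := pow_le_pow_right₀ hinv hn
    calc ρ⁻¹ ^ n * I ≤ ρ⁻¹ ^ n * A := by gcongr
      _ ≤ ρ⁻¹ ^ 4 * A := by gcongr
      _ = _ := mul_comm _ _
  have e0 : ∀ x, |K x| = ρ⁻¹ ^ 2 * |T (ρ⁻¹ • x)| := fun x => by
    rw [hK, Litho.dilate, abs_mul, abs_of_pos (by positivity), inv_pow]
  have e1 : ∀ x, ‖fderiv ℝ K x‖ = ρ⁻¹ ^ 3 * ‖fderiv ℝ T (ρ⁻¹ • x)‖ := fun x => by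
    rw [hK, fderiv_dilate _ _ _ T.differentiable, norm_smul, Real.norm_of_nonneg (by positivity)]
    congr 1
    rw [← inv_pow, ← pow_succ]
  refine ⟨?_, ?_, ?_, ?_⟩
  · simp only [e0]
    rw [integral_const_mul, integral_comp_inv_smul_plane (fun x => |T x|) hρ0]
    refine le_trans (le_of_eq ?_) (key 0 (by norm_num) h.l1)
    field_simp
  · simp only [e1]
    rw [integral_const_mul, integral_comp_inv_smul_plane (fun x => ‖fderiv ℝ T x‖) hρ0]
    refine le_trans (le_of_eq ?_) (key 1 (by norm_num) h.l1_fderiv)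
    field_simp
  · simp only [e0, mul_pow]
    rw [integral_const_mul, integral_comp_inv_smul_plane (fun x => |T x| ^ 2) hρ0]
    refine le_trans (le_of_eq ?_) (key 2 (by norm_num) h.sq)
    field_simp
  · simp only [e1, mul_pow]
    rw [integral_const_mul, integral_comp_inv_smul_plane (fun x => ‖fderiv ℝ T x‖ ^ 2) hρ0]
    refine le_trans (le_of_eq ?_) (key 4 (by norm_num) h.sq_fderiv)
    field_simp

end Kernels


/-! ### Stability of the intensity under changes of mask and of mutual intensity -/

section Perturbation

variable {R A ε γ θ C : ℝ} {u J d a b : Plane → ℝ} {D : Set Plane}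

/-- The three terms come from replacing J by 1, then each factor u by the indicator of D, everything
else being bounded by 1. The hypothesis on J is needed only for points of the disc, as u vanishes
almost everywhere outside it. -/
theorem abs_hopkinsWeight_sub_le (hu : u ∈ maskSet R) (hε : 0 ≤ ε)
    (hJ : ∀ x ∈ ball (0 : Plane) R, ∀ y ∈ ball (0 : Plane) R, |J (x - y) - 1| ≤ ε) :
    ∀ᵐ z : Plane × Plane, |hopkinsWeight J u z - hopkinsWeight (fun _ => 1) (D.indicator 1) z| ≤
      ε + |u z.1 - D.indicator 1 z.1| + |u z.2 - D.indicator 1 z.2| := by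
  have h1 := abs_le_one_of_mem_maskSet hu
  have h0 := hu.2.1
  have q1 := Measure.quasiMeasurePreserving_fst (μ := (volume : Measure Plane))
    (ν := (volume : Measure Plane))
  have q2 := Measure.quasiMeasurePreserving_snd (μ := (volume : Measure Plane))
    (ν := (volume : Measure Plane))
  filter_upwards [q1.ae h1, q1.ae h0, q2.ae h1, q2.ae h0] with z a1 a0 b1 b0
  have hχ : |D.indicator (1 : Plane → ℝ) z.2| ≤ 1 := by
    classical
    simp only [Set.indicator_apply, Pi.one_apply]
    split_ifs <;> simp
  simp only [hopkinsWeight, mul_one]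
  set χ₁ : ℝ := D.indicator 1 z.1
  set χ₂ : ℝ := D.indicator 1 z.2
  have e : u z.1 * u z.2 * J (z.1 - z.2) - χ₁ * χ₂ = u z.1 * u z.2 * (J (z.1 - z.2) - 1) +
      ((u z.1 - χ₁) * χ₂ + u z.1 * (u z.2 - χ₂)) := by ring
  have t1 : |u z.1 * u z.2 * (J (z.1 - z.2) - 1)| ≤ ε := by
    by_cases hz1 : z.1 ∈ ball (0 : Plane) R
    · by_cases hz2 : z.2 ∈ ball (0 : Plane) R
      · rw [abs_mul, abs_mul]
        have h := hJ _ hz1 _ hz2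
        calc |u z.1| * |u z.2| * |J (z.1 - z.2) - 1| ≤ 1 * 1 * ε := by gcongr
          _ = ε := by ring
      · simpa [b0 hz2] using hε
    · simpa [a0 hz1] using hε
  have t2 : |(u z.1 - χ₁) * χ₂| ≤ |u z.1 - χ₁| := by
    rw [abs_mul]; exact mul_le_of_le_one_right (abs_nonneg _) hχ
  have t3 : |u z.1 * (u z.2 - χ₂)| ≤ |u z.2 - χ₂| := by
    rw [abs_mul]; exact mul_le_of_le_one_left (abs_nonneg _) a1
  rw [e]
  refine (abs_add_le _ _).trans ?_
  have t4 := abs_add_le ((u z.1 - χ₁) * χ₂) (u z.1 * (u z.2 - χ₂))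
  linarith

/-- Young's inequality d·a ≤ θa² + d²/(4θ), followed by d² ≤ d. It makes L¹-smallness of a bounded
function effective against a kernel controlled only in L². -/
theorem integral_mul_le_add (hθ : 0 < θ) (hd : Integrable d) (hd0 : ∀ x, 0 ≤ d x)
    (hd1 : ∀ᵐ x, d x ≤ 1) (hdγ : ∫ x, d x ≤ γ) (ha0 : ∀ x, 0 ≤ a x)
    (ha : Integrable fun x => a x ^ 2) (haA : ∫ x, a x ^ 2 ≤ A) :
    ∫ x, d x * a x ≤ θ * A + γ / (4 * θ) := by
  calc ∫ x, d x * a x ≤ ∫ x, (θ * a x ^ 2 + d x / (4 * θ)) := by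
        refine integral_mono_of_nonneg (ae_of_all _ fun x => mul_nonneg (hd0 x) (ha0 x))
          ((ha.const_mul θ).add (hd.div_const _)) ?_
        filter_upwards [hd1] with x hx
        have h1 : d x ^ 2 ≤ d x := by nlinarith [hd0 x]
        have h2 : d x * a x ≤ θ * a x ^ 2 + d x ^ 2 / (4 * θ) := by
          have h3 : θ * a x ^ 2 + d x ^ 2 / (4 * θ) - d x * a x =
              (2 * θ * a x - d x) ^ 2 / (4 * θ) := by field_simp; ring
          have h4 : 0 ≤ (2 * θ * a x - d x) ^ 2 / (4 * θ) := by positivity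
          linarith
        have h5 : d x ^ 2 / (4 * θ) ≤ d x / (4 * θ) := by gcongr
        linarith
    _ = θ * (∫ x, a x ^ 2) + (∫ x, d x) / (4 * θ) := by
        rw [integral_add (ha.const_mul θ) (hd.div_const _), integral_const_mul, integral_div]
    _ ≤ _ := by gcongr

theorem integral_add_mul_mul_le {τ : ℝ} (hε : 0 ≤ ε) (ha0 : ∀ x, 0 ≤ a x)
    (hb0 : ∀ x, 0 ≤ b x) (hd0 : ∀ x, 0 ≤ d x) (ha : Integrable a) (hb : Integrable b)
    (hda : Integrable fun x => d x * a x) (hdb : Integrable fun x => d x * b x)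
    (haA : ∫ x, a x ≤ A) (hbA : ∫ x, b x ≤ A) (haτ : ∫ x, d x * a x ≤ τ)
    (hbτ : ∫ x, d x * b x ≤ τ) :
    (Integrable fun z : Plane × Plane => (ε + d z.1 + d z.2) * (a z.1 * b z.2)) ∧
    ∫ z : Plane × Plane, (ε + d z.1 + d z.2) * (a z.1 * b z.2) ≤ A * (ε * A + 2 * τ) := by
  have i1 : Integrable fun z : Plane × Plane => a z.1 * b z.2 := ha.mul_prod hb
  have i2 : Integrable fun z : Plane × Plane => (d z.1 * a z.1) * b z.2 := hda.mul_prod hb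
  have i3 : Integrable fun z : Plane × Plane => a z.1 * (d z.2 * b z.2) := ha.mul_prod hdb
  have e : (fun z : Plane × Plane => (ε + d z.1 + d z.2) * (a z.1 * b z.2)) = fun z =>
      ε * (a z.1 * b z.2) + ((d z.1 * a z.1) * b z.2 + a z.1 * (d z.2 * b z.2)) := by
    funext z; ring
  have e1 : ∫ z : Plane × Plane, a z.1 * b z.2 = (∫ x, a x) * ∫ x, b x :=
    integral_prod_mul a b
  have e2 : ∫ z : Plane × Plane, (d z.1 * a z.1) * b z.2 = (∫ x, d x * a x) * ∫ x, b x :=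
    integral_prod_mul (fun x => d x * a x) b
  have e3 : ∫ z : Plane × Plane, a z.1 * (d z.2 * b z.2) = (∫ x, a x) * ∫ x, d x * b x :=
    integral_prod_mul a fun x => d x * b x
  have n1 : 0 ≤ ∫ x, a x := integral_nonneg ha0
  have n2 : 0 ≤ ∫ x, b x := integral_nonneg hb0
  have n3 : 0 ≤ ∫ x, d x * a x := integral_nonneg fun x => mul_nonneg (hd0 x) (ha0 x)
  have n4 : 0 ≤ ∫ x, d x * b x := integral_nonneg fun x => mul_nonneg (hd0 x) (hb0 x)
  have nA : 0 ≤ A := n1.trans haA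
  have nτ : 0 ≤ τ := n3.trans haτ
  rw [e]
  refine ⟨(i1.const_mul ε).add (i2.add i3), ?_⟩
  have i23 : Integrable fun z : Plane × Plane =>
      (d z.1 * a z.1) * b z.2 + a z.1 * (d z.2 * b z.2) := i2.add i3
  rw [integral_add (i1.const_mul ε) i23, integral_add i2 i3, integral_const_mul, e1, e2, e3]
  calc _ ≤ ε * (A * A) + (τ * A + A * τ) := by gcongr
    _ = _ := by ring

theorem integrable_sq_of_bound {F : Type*} [NormedAddCommGroup F] {f : Plane → F}
    (hf : Integrable f) (hC : ∀ x, ‖f x‖ ≤ C) : Integrable fun x => ‖f x‖ ^ 2 := by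
  simp only [sq]
  exact hf.norm.mul_bdd (c := C) hf.aestronglyMeasurable.norm (ae_of_all _ fun x => by
    rw [norm_norm]; exact hC x)

/-- Stability of the image intensity and of its gradient under a change of the weight. -/
theorem norm_integral_hopkinsWeight_sub_le {K : SchwartzMap Plane ℝ} (hK : KernelBound A K)
    (hu : u ∈ maskSet R) (hD : MeasurableSet D) (hDR : D ⊆ ball 0 R)
    (hγ : l1Dist R u (D.indicator 1) ≤ γ) (hε : 0 ≤ ε) (hJm : Measurable J)
    (hJb : ∀ x, |J x| ≤ C)
    (hJ : ∀ x ∈ ball (0 : Plane) R, ∀ y ∈ ball (0 : Plane) R, |J (x - y) - 1| ≤ ε)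
    (hθ : 0 < θ) (x : Plane) :
    |hopkins K J u x - hopkins K (fun _ => 1) (D.indicator 1) x| ≤
      A * (ε * A + 2 * (θ * A + γ / (4 * θ))) ∧
    ‖fderiv ℝ (hopkins K J u) x - fderiv ℝ (hopkins K (fun _ => 1) (D.indicator 1)) x‖ ≤
      2 * (A * (ε * A + 2 * (θ * A + γ / (4 * θ)))) := by
  obtain ⟨B, hB⟩ := exists_bddC2_schwartz K
  have hχ := indicator_mem_maskSet hD hDR
  have hw := integrable_hopkinsWeight hu.1 hJm hJb
  have hw₀ := integrable_hopkinsWeight (J := fun _ => (1 : ℝ)) (C := 1) hχ.1 measurable_const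
    (by simp)
  set d : Plane → ℝ := fun x => |u x - D.indicator 1 x| with hd
  have hdi : Integrable d := (hu.1.sub hχ.1).abs
  have hd0 : ∀ x, 0 ≤ d x := fun x => abs_nonneg _
  have hd1 : ∀ᵐ x, d x ≤ 1 := by
    filter_upwards [hu.2.1, hu.2.2] with x h1 h2
    by_cases hx : x ∈ ball (0 : Plane) R
    · obtain ⟨h3, h4⟩ := h2 hx
      classical
      simp only [hd, Set.indicator_apply, Pi.one_apply]
      split_ifs <;> exact abs_le.2 ⟨by linarith, by linarith⟩
    · simp only [hd, h1 hx, Set.indicator_of_notMem fun h => hx (hDR h)]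
      simp
  have hdγ : ∫ x, d x ≤ γ := by rwa [← l1Dist_eq_integral hu.2.1 hχ.2.1]
  set τ : ℝ := θ * A + γ / (4 * θ)
  set a : Plane → ℝ := fun y => |K (x - y)| with ha
  set b : Plane → ℝ := fun y => ‖fderiv ℝ K (x - y)‖ with hb
  have hKi := K.integrable (μ := volume)
  have hKi' := integrable_fderiv_schwartz K
  have ai : Integrable a := hKi.abs.comp_sub_left x
  have bi : Integrable b := hKi'.norm.comp_sub_left x
  have aA : ∫ y, a y ≤ A := by
    rw [ha, integral_sub_left_eq_self (fun y => |K y|) volume x]; exact hK.l1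
  have bA : ∫ y, b y ≤ A := by
    rw [hb, integral_sub_left_eq_self (fun y => ‖fderiv ℝ K y‖) volume x]; exact hK.l1_fderiv
  have asq : Integrable fun y => a y ^ 2 :=
    (integrable_sq_of_bound hKi hB.bound).comp_sub_left x
  have bsq : Integrable fun y => b y ^ 2 :=
    (integrable_sq_of_bound hKi' hB.bound_fderiv).comp_sub_left x
  have aτ : ∫ y, d y * a y ≤ τ := by
    refine integral_mul_le_add hθ hdi hd0 hd1 hdγ (fun y => abs_nonneg _) asq ?_
    rw [ha, integral_sub_left_eq_self (fun y => |K y| ^ 2) volume x]; exact hK.sq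
  have bτ : ∫ y, d y * b y ≤ τ := by
    refine integral_mul_le_add hθ hdi hd0 hd1 hdγ (fun y => norm_nonneg _) bsq ?_
    rw [hb, integral_sub_left_eq_self (fun y => ‖fderiv ℝ K y‖ ^ 2) volume x]
    exact hK.sq_fderiv
  have dai : Integrable fun y => d y * a y :=
    hdi.mul_bdd (c := B) ai.aestronglyMeasurable (ae_of_all _ fun y => by
      rw [ha, Real.norm_eq_abs, abs_abs]; exact hB.bound _)
  have dbi : Integrable fun y => d y * b y :=
    hdi.mul_bdd (c := B) bi.aestronglyMeasurable (ae_of_all _ fun y => by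
      rw [hb, norm_norm]; exact hB.bound_fderiv _)
  have a0 : ∀ y, 0 ≤ a y := fun y => abs_nonneg _
  have b0 : ∀ y, 0 ≤ b y := fun y => norm_nonneg _
  have hwt := abs_hopkinsWeight_sub_le hu hε hJ (D := D)
  have hk : Continuous fun z => hopkinsKernel K z x :=
    (contDiff_hopkinsKernel hB.contDiff).continuous.comp (Continuous.prodMk_left x)
  have hk' : Continuous fun z => fderiv ℝ (hopkinsKernel K z) x :=
    ((contDiff_hopkinsKernel hB.contDiff).fderiv (contDiff_const (c := x)) (n := 0)
      (by norm_num)).continuous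
  have hbk := fun z => bddC2_hopkinsKernel hB z
  obtain ⟨iaa, haa⟩ := integral_add_mul_mul_le hε a0 a0 hd0 ai ai dai dai aA aA aτ aτ
  obtain ⟨iab, hab⟩ := integral_add_mul_mul_le hε a0 b0 hd0 ai bi dai dbi aA bA aτ bτ
  obtain ⟨iba, hba⟩ := integral_add_mul_mul_le hε b0 a0 hd0 bi ai dbi dai bA aA bτ aτ
  constructor
  · rw [hopkins_eq hw hB, hopkins_eq hw₀ hB,
      ← integral_sub (integrable_smul_of_bound hw hk fun z => (hbk z).bound x)
        (integrable_smul_of_bound hw₀ hk fun z => (hbk z).bound x)]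
    simp only [← sub_smul]
    rw [← Real.norm_eq_abs]
    refine (norm_integral_le_of_norm_le iaa ?_).trans haa
    filter_upwards [hwt] with z hz
    rw [norm_smul, hopkinsKernel, norm_mul]
    exact mul_le_mul_of_nonneg_right hz (by positivity)
  · rw [fderiv_hopkins hw hB, fderiv_hopkins hw₀ hB,
      ← integral_sub (integrable_smul_of_bound hw hk' fun z => (hbk z).bound_fderiv x)
        (integrable_smul_of_bound hw₀ hk' fun z => (hbk z).bound_fderiv x)]
    simp only [← sub_smul]
    refine (norm_integral_le_of_norm_le (iab.add iba) ?_).trans ?_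
    · filter_upwards [hwt] with z hz
      have h1 : ‖fderiv ℝ (hopkinsKernel K z) x‖ ≤ a z.1 * b z.2 + b z.1 * a z.2 := by
        rw [fderiv_hopkinsKernel hB.differentiable]
        refine (norm_add_le _ _).trans_eq ?_
        rw [norm_smul, norm_smul, mul_comm ‖K (x - z.2)‖]
        rfl
      rw [norm_smul, Pi.add_apply, ← mul_add]
      exact mul_le_mul hz h1 (norm_nonneg _) (by have := hd0 z.1; have := hd0 z.2; positivity)
    · have := integral_add iab iba
      refine (le_of_eq this).trans ?_
      linarith

/-- With J = 1 illumination is fully coherent: the double integral factors into the square of one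
convolution. -/
theorem hopkins_one_indicator (K : Plane → ℝ) (hD : MeasurableSet D) (x : Plane) :
    hopkins K (fun _ => 1) (D.indicator 1) x = (∫ z in D, K (x - z)) ^ 2 := by
  have e : ∀ z, D.indicator (1 : Plane → ℝ) z * K (x - z) =
      D.indicator (fun z => K (x - z)) z := fun z => by
    classical
    simp [Set.indicator_apply]
  have h : ∀ ξ η, D.indicator (1 : Plane → ℝ) ξ * K (x - ξ) * 1 * K (x - η) *
      D.indicator (1 : Plane → ℝ) η =
      D.indicator (fun z => K (x - z)) ξ * D.indicator (fun z => K (x - z)) η := fun ξ η => by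
    rw [← e, ← e]; ring
  simp only [hopkins, h]
  simp only [integral_const_mul, integral_mul_const, integral_indicator hD, sq]

end Perturbation



/-! ### Uniform transversality at the threshold level -/

section Transversality

variable {R L ρ R₀ δ₁ δ₂ m₁ h' a₁ δ' : ℝ} {D : Set Plane}

theorem frontier_preimage_smul (hρ : ρ ≠ 0) (D : Set Plane) :
    frontier ((fun z : Plane => ρ • z) ⁻¹' D) = (fun z : Plane => ρ • z) ⁻¹' frontier D :=
  ((Homeomorph.smulOfNeZero ρ hρ).preimage_frontier D).symm

/-- Rescaling the graph in both variables leaves its Lipschitz constant unchanged; only the radius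
of the chart scales. -/
theorem IsLipChart.preimage_smul (hρ : 0 < ρ) {x : Plane} {Q : Plane ≃ₗᵢ[ℝ] Plane}
    {φ : ℝ → ℝ} (hc : IsLipChart D (ρ * R₀) L (ρ • x) Q φ) :
    IsLipChart ((fun z : Plane => ρ • z) ⁻¹' D) R₀ L x Q fun t => ρ⁻¹ * φ (ρ * t) where
  lip := by
    have h1 : LipschitzWith ‖ρ‖₊ fun t : ℝ => ρ * t := lipschitzWith_smul ρ
    have h2 : LipschitzWith ‖ρ⁻¹‖₊ fun t : ℝ => ρ⁻¹ * t := lipschitzWith_smul ρ⁻¹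
    have h3 := h2.comp (hc.lip.comp h1)
    have e : ‖ρ⁻¹‖₊ * (L.toNNReal * ‖ρ‖₊) = L.toNNReal := by
      rw [mul_left_comm, ← nnnorm_mul, inv_mul_cancel₀ hρ.ne', nnnorm_one, mul_one]
    rwa [e] at h3
  zero := by simp [hc.zero]
  mem_iff := fun y hy => by
    have h1 : ρ • y ∈ ball (ρ • x) (ρ * R₀) := by
      rw [mem_ball, dist_smul₀, Real.norm_of_nonneg hρ.le]
      exact mul_lt_mul_of_pos_left hy hρ
    have h2 := hc.mem_iff _ h1
    rw [← smul_sub, map_smul] at h2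
    simp only [PiLp.smul_apply, smul_eq_mul] at h2
    rw [Set.mem_preimage, h2, lt_inv_mul_iff₀ hρ]

theorem IsLipDomain.preimage_smul (hρ : 0 < ρ) (hD : IsLipDomain D (ρ * R₀) L) :
    IsLipDomain ((fun z : Plane => ρ • z) ⁻¹' D) R₀ L where
  isOpen := hD.isOpen.preimage (continuous_const_smul ρ)
  isBounded := by
    rw [Set.preimage_smul₀ hρ.ne']
    exact hD.isBounded.smul₀ _
  chart := fun x hx => by
    rw [frontier_preimage_smul hρ.ne'] at hx
    obtain ⟨Q, φ, hc⟩ := hD.chart _ hx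
    exact ⟨Q, _, hc.preimage_smul hρ⟩

open scoped Pointwise in
theorem setIntegral_dilate_sub (T : Plane → ℝ) (hρ : 0 < ρ) (D : Set Plane) (x : Plane) :
    ∫ z in D, dilate T ρ (x - z) =
      ∫ z in (fun z : Plane => ρ • z) ⁻¹' D, T (ρ⁻¹ • x - z) := by
  have h := Measure.setIntegral_comp_smul_of_pos volume (fun z => T (ρ⁻¹ • x - ρ⁻¹ • z))
    ((fun z : Plane => ρ • z) ⁻¹' D) hρ
  simp only [smul_smul, inv_mul_cancel₀ hρ.ne', one_smul, finrank_euclideanSpace_fin] at h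
  rw [h, Set.preimage_smul₀ hρ.ne', smul_inv_smul₀ hρ.ne', smul_eq_mul, ← integral_const_mul]
  simp only [dilate, smul_sub]

theorem norm_setIntegral_sub_sub_le {F : Type*} [NormedAddCommGroup F] [NormedSpace ℝ F]
    {f g : Plane → F} (hf : Integrable f) (hg : Integrable g) (D : Set Plane) (x : Plane) :
    ‖(∫ z in D, f (x - z)) - ∫ z in D, g (x - z)‖ ≤ ∫ z, ‖f z - g z‖ := by
  have hi : Integrable fun z => ‖f (x - z) - g (x - z)‖ := ((hf.sub hg).norm).comp_sub_left x
  rw [← integral_sub (hf.comp_sub_left x).integrableOn (hg.comp_sub_left x).integrableOn]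
  refine (norm_integral_le_integral_norm _).trans ?_
  refine (setIntegral_le_integral hi (ae_of_all _ fun z => norm_nonneg _)).trans_eq ?_
  exact integral_sub_left_eq_self (fun z => ‖f z - g z‖) volume x

theorem fderiv_setIntegral_schwartz_sub (T : SchwartzMap Plane ℝ) (hD : volume D ≠ ⊤)
    (x : Plane) : HasFDerivAt (fun x => ∫ z in D, T (x - z)) (∫ z in D, fderiv ℝ T (x - z)) x := by
  obtain ⟨C, hC⟩ := exists_bddC2_schwartz T
  exact hasFDerivAt_setIntegral_sub hD (hC.contDiff.of_le (by norm_num)) hC.bound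
    hC.bound_fderiv x

theorem blur_nonneg (D : Set Plane) (x : Plane) : 0 ≤ blur D x :=
  integral_nonneg fun z => by unfold gauss; positivity

/-- Near the level `1/2` the Gaussian blur of a Lipschitz domain has a nonvanishing gradient. -/
theorem GaussConstants.le_norm_fderiv_blur (hgc : GaussConstants L δ₁ δ₂ m₁ R₀ h' a₁)
    (hgeo : GeomConstants L δ₁ δ₂ m₁) (hD : IsLipDomain D R₀ L) {y : Plane}
    (h1 : h' < blur D y) (h2 : blur D y < 1 - h') :
    (∃ x ∈ frontier D, dist y x ≤ m₁ * (δ₂ / 4) * R₀) ∧ a₁ ≤ ‖fderiv ℝ (blur D) y‖ := by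
  have hR₀ : 0 < R₀ := one_pos.trans_le hgc.R₀_ge
  have hδ₁ := hgeo.δ₁_pos
  have hδ₂ := hgeo.δ₂_pos
  have hm := hgeo.m₁_pos
  have hpos : 0 ≤ m₁ * (δ₂ / 4) * R₀ := by positivity
  have hy := hgc.near_boundary D hD y h1 h2
  -- Compactness gives a boundary point at distance at most the thickening radius itself. A chart is
  -- then taken at that point, so y is controlled by one chart.
  have hcomp : IsCompact (frontier D) :=
    isCompact_of_isClosed_isBounded isClosed_frontier
      (hD.isBounded.closure.subset frontier_subset_closure)
  rw [hcomp.cthickening_eq_biUnion_closedBall hpos] at hy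
  simp only [Set.mem_iUnion, mem_closedBall, exists_prop] at hy
  obtain ⟨x, hx, hyx⟩ := hy
  refine ⟨⟨x, hx, hyx⟩, ?_⟩
  obtain ⟨Q, φ, hc⟩ := hD.chart x hx
  have hxg : x ∈ graphPiece x Q φ (δ₁ / 2 * R₀) := by
    simp only [graphPiece, Set.mem_ofPred_eq, sub_self, map_zero, PiLp.zero_apply, abs_zero, hc.zero]
    exact ⟨by positivity, trivial⟩
  have hyt : y ∈ cthickening (m₁ * (δ₂ / 4) * R₀) (graphPiece x Q φ (δ₁ / 2 * R₀)) :=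
    mem_cthickening_of_dist_le y x _ _ hxg hyx
  have hstrip := (hgeo.strip R₀ D x Q φ (δ₂ / 4) hR₀ hD hx hc (by positivity)
    (by linarith)).2.2.1 hyt
  have hg := hgc.gradient D hD x hx Q φ hc y hstrip
  calc a₁ ≤ ‖fderiv ℝ (blur D) y (-(Q.symm e2))‖ := hg.trans (Real.le_norm_self _)
    _ ≤ ‖fderiv ℝ (blur D) y‖ * ‖-(Q.symm e2)‖ := ContinuousLinearMap.le_opNorm _ _
    _ = ‖fderiv ℝ (blur D) y‖ := by simp [e2]

/-- Where the coherent image of a Lipschitz domain is neither dark nor bright, it has a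
nonvanishing gradient, and such points are near the domain. -/
theorem le_norm_fderiv_coherent (hgc : GaussConstants L δ₁ δ₂ m₁ R₀ h' a₁)
    (hgeo : GeomConstants L δ₁ δ₂ m₁) (hρ0 : 0 < ρ) (hρ1 : ρ ≤ 1)
    (hD : IsLipDomain D (ρ * R₀) L) (hDR : D ⊆ ball 0 R) {T : SchwartzMap Plane ℝ} (hδ0 : 0 ≤ δ')
    (hδ : δ' ≤ min h' (a₁ / 2)) (hT : w11Norm (fun x => T x - gauss x) ≤ ENNReal.ofReal δ')
    {x : Plane} (h1 : 31 / 100 < (∫ z in D, dilate T ρ (x - z)) ^ 2)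
    (h2 : (∫ z in D, dilate T ρ (x - z)) ^ 2 < 69 / 100) :
    ‖x‖ ≤ R + m₁ * (δ₂ / 4) * R₀ ∧
      a₁ / 2 ≤ ‖fderiv ℝ (fun x => (∫ z in D, dilate T ρ (x - z)) ^ 2) x‖ := by
  have hδh : δ' ≤ 1 / 24 := (hδ.trans (min_le_left _ _)).trans hgc.h'_le
  have hδa : δ' ≤ a₁ / 2 := hδ.trans (min_le_right _ _)
  have hh' := hgc.h'_le
  have ha₁ := hgc.a₁_pos
  have hR₀ : 0 < R₀ := one_pos.trans_le hgc.R₀_ge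
  have hδ₂ := hgeo.δ₂_pos
  have hm := hgeo.m₁_pos
  set E : Set Plane := (fun z : Plane => ρ • z) ⁻¹' D with hE
  have hEL : IsLipDomain E R₀ L := hD.preimage_smul hρ0
  set F : Plane → ℝ := fun y => ∫ z in E, T (y - z) with hF
  obtain ⟨hT1, hT2⟩ := integral_abs_sub_gauss_le hδ0 hT
  set y : Plane := ρ⁻¹ • x with hy
  have hFd := fderiv_setIntegral_schwartz_sub T hEL.volume_ne_top y
  have c0 : |F y - blur E y| ≤ δ' :=
    (norm_setIntegral_sub_sub_le T.integrable integrable_gauss E y).trans hT1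
  have c1 : ‖fderiv ℝ F y - fderiv ℝ (blur E) y‖ ≤ δ' := by
    rw [hFd.fderiv, fderiv_blur hEL.volume_ne_top]
    exact (norm_setIntegral_sub_sub_le (integrable_fderiv_schwartz T) integrable_fderiv_gauss E
      y).trans hT2
  have ef : (fun x => ∫ z in D, dilate T ρ (x - z)) = fun x => F (ρ⁻¹ • x) :=
    funext fun x => setIntegral_dilate_sub T hρ0 D x
  have ef' : ∀ x, ∫ z in D, dilate T ρ (x - z) = F (ρ⁻¹ • x) := fun x => congrFun ef x
  simp only [ef'] at h1 h2 ⊢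
  rw [← hy] at h1 h2
  obtain ⟨c2, c3⟩ := abs_le.1 c0
  have hb := blur_nonneg E y
  -- The square determines F because F ≥ -1/24: from 1/4 < 0.31 and 0.69 < 25/36 follows 1/2 < F <
  -- 5/6. As δ' ≤ 1/24, the blur then stays well inside (h', 1 - h').
  have f1 : 1 / 2 < F y := by nlinarith
  have f2 : F y < 5 / 6 := by nlinarith
  obtain ⟨⟨z, hz, hyz⟩, hgrad⟩ := hgc.le_norm_fderiv_blur hgeo hEL (y := y)
    (by linarith) (by linarith)
  constructor
  · rw [hE, frontier_preimage_smul hρ0.ne'] at hz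
    have hzR : ‖ρ • z‖ ≤ R := by
      have := closure_ball_subset_closedBall (closure_mono hDR (frontier_subset_closure hz))
      simpa using this
    have hx : x = ρ • z + ρ • (y - z) := by
      rw [← smul_add, add_sub_cancel, hy, smul_inv_smul₀ hρ0.ne']
    rw [hx]
    refine (norm_add_le _ _).trans (add_le_add hzR ?_)
    rw [norm_smul, Real.norm_of_nonneg hρ0.le, ← dist_eq_norm]
    calc ρ * dist y z ≤ 1 * (m₁ * (δ₂ / 4) * R₀) := by gcongr
      _ = _ := one_mul _
  · have hFdiff : DifferentiableAt ℝ F (ρ⁻¹ • x) := hFd.differentiableAt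
    have hfd : DifferentiableAt ℝ (fun x => F (ρ⁻¹ • x)) x :=
      hFdiff.comp x (differentiableAt_id.const_smul ρ⁻¹)
    have e2 : fderiv ℝ (fun x => F (ρ⁻¹ • x) ^ 2) x = (2 * F y * ρ⁻¹) • fderiv ℝ F y := by
      have := (hfd.hasFDerivAt.pow 2).fderiv
      rw [this, fderiv_comp_smul, smul_smul]
      simp [hy]
    have hinv : 1 ≤ ρ⁻¹ := (one_le_inv₀ hρ0).2 hρ1
    have g1 : a₁ / 2 ≤ ‖fderiv ℝ F y‖ := by
      have := norm_sub_norm_le (fderiv ℝ (blur E) y) (fderiv ℝ F y)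
      rw [norm_sub_rev] at this
      linarith
    -- Squaring and scaling do not weaken the gradient bound: the chain-rule factor 2F/ρ is at least
    -- 1, since F > 1/2 and ρ ≤ 1.
    have g2 : 1 ≤ 2 * F y * ρ⁻¹ := by nlinarith
    rw [e2, norm_smul, Real.norm_of_nonneg (by linarith)]
    nlinarith

/-- The coherent image of D has gradient at least a₁/2 at the intermediate levels. Passing to u and
J changes the intensity by at most μ and its gradient by at most 2μ ≤ a₁/4, so a₁/4 survives. -/
theorem exists_transversality (hgc : GaussConstants L δ₁ δ₂ m₁ R₀ h' a₁)
    (hgeo : GeomConstants L δ₁ δ₂ m₁) {M : ℝ} (hR : 0 < R) (hM : 0 ≤ M) (hρ0 : 0 < ρ)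
    (hρ1 : ρ ≤ 1) :
    ∃ σ₀ γ₀ : ℝ, 0 < σ₀ ∧ σ₀ ≤ 1 ∧ 0 < γ₀ ∧ ∀ (δ' : ℝ) (T K : SchwartzMap Plane ℝ) (κ h : ℝ),
      0 < δ' → δ' ≤ min h' (a₁ / 2) →
      w11Norm (fun x => T x - gauss x) ≤ ENNReal.ofReal δ' →
      hessL1Norm (fun x => T x - gauss x) ≤ ENNReal.ofReal M →
      ⇑K = dilate T ρ → 0 < κ → κ ≤ σ₀ → 1 / 3 ≤ h → h ≤ 2 / 3 →
      ∀ u ∈ nearMaskSet (ρ * R₀) L R γ₀, ∀ x,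
        |hopkins K (mutualIntensity κ) u x - h| < 1 / 100 →
        ‖x‖ ≤ R + m₁ * (δ₂ / 4) * R₀ ∧
          a₁ / 4 ≤ ‖fderiv ℝ (hopkins K (mutualIntensity κ) u) x‖ := by
  obtain ⟨A₀, hA₀, hKB⟩ := exists_kernelBound hM
  have ha₁ := hgc.a₁_pos
  set A : ℝ := max 1 (A₀ * ρ⁻¹ ^ 4) with hA
  have hA1 : 1 ≤ A := le_max_left _ _
  have hA0 : 0 < A := one_pos.trans_le hA1
  set μ : ℝ := min (1 / 100) (a₁ / 8) with hμ
  have hμ0 : 0 < μ := lt_min (by norm_num) (by positivity)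
  have hμ1 : μ ≤ 1 / 100 := min_le_left _ _
  have hμ2 : μ ≤ a₁ / 8 := min_le_right _ _
  -- The error εA² + 2θA² + Aγ₀/(2θ), with ε = 4Rσ₀, is split evenly: θ, σ₀ and γ₀ are chosen so
  -- that each term is at most μ/3.
  set θ : ℝ := μ / (6 * A ^ 2) with hθ
  have hθ0 : 0 < θ := by positivity
  set σ₀ : ℝ := min 1 (μ / (12 * A ^ 2 * R)) with hσ₀
  set γ₀ : ℝ := 2 * μ * θ / (3 * A) with hγ₀
  refine ⟨σ₀, γ₀, lt_min one_pos (by positivity), min_le_left _ _, by positivity, ?_⟩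
  rintro δ' T K κ h hδ0 hδ hw hh hK hκ0 hκ hh1 hh2 u ⟨hu, D, hDR, hD, hγ⟩ x hx
  have hδ1 : δ' ≤ 1 := by
    have := (hδ.trans (min_le_left _ _)).trans hgc.h'_le
    linarith
  have hKb : KernelBound A K :=
    ((hKB T δ' hδ0.le hδ1 hw hh).dilate hA₀ hρ0 hρ1 hK).mono (le_max_right _ _)
  have hDm := hD.isOpen.measurableSet
  have hJ : ∀ x ∈ ball (0 : Plane) R, ∀ y ∈ ball (0 : Plane) R,
      |mutualIntensity κ (x - y) - 1| ≤ 4 * R * σ₀ := fun x hx y hy => by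
    have h1 : ‖x - y‖ ≤ 2 * R := by
      have := norm_sub_le x y
      rw [mem_ball_zero_iff] at hx hy
      linarith
    calc _ ≤ 2 * (κ * ‖x - y‖) := abs_mutualIntensity_sub_one_le hκ0 _
      _ ≤ 2 * (σ₀ * (2 * R)) := by gcongr
      _ = _ := by ring
  have hσ₀0 : 0 < σ₀ := hκ0.trans_le hκ
  obtain ⟨p1, p2⟩ := norm_integral_hopkinsWeight_sub_le hKb hu hDm hDR hγ (ε := 4 * R * σ₀)
    (by positivity) (measurable_mutualIntensity κ) (abs_mutualIntensity_le hκ0) hJ hθ0 x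
  have hbound : A * (4 * R * σ₀ * A + 2 * (θ * A + γ₀ / (4 * θ))) ≤ μ := by
    have s1 : 4 * R * σ₀ * A ^ 2 ≤ μ / 3 := by
      have : σ₀ ≤ μ / (12 * A ^ 2 * R) := min_le_right _ _
      calc 4 * R * σ₀ * A ^ 2 ≤ 4 * R * (μ / (12 * A ^ 2 * R)) * A ^ 2 := by gcongr
        _ = μ / 3 := by field_simp; norm_num
    have s2 : 2 * (A * (θ * A)) = μ / 3 := by rw [hθ]; field_simp; norm_num
    have s3 : 2 * (A * (γ₀ / (4 * θ))) = μ / 3 := by rw [hγ₀]; field_simp; norm_num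
    nlinarith
  have e : hopkins K (fun _ => 1) (D.indicator 1) =
      fun x => (∫ z in D, dilate T ρ (x - z)) ^ 2 := by
    rw [hK]
    exact funext fun x => hopkins_one_indicator _ hDm x
  rw [e] at p1 p2
  obtain ⟨q1, q2⟩ := abs_le.1 (p1.trans hbound)
  obtain ⟨q3, q4⟩ := abs_lt.1 hx
  -- With h in [1/3, 2/3], a band of 1/100 and an error of at most 1/100, the coherent level stays
  -- between 0.31 and 0.69.
  obtain ⟨r1, r2⟩ := le_norm_fderiv_coherent hgc hgeo hρ0 hρ1 hD hDR hδ0.le hδ hw (x := x)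
    (by linarith) (by linarith)
  refine ⟨r1, ?_⟩
  have := norm_sub_norm_le (fderiv ℝ (fun x => (∫ z in D, dilate T ρ (x - z)) ^ 2) x)
    (fderiv ℝ (hopkins K (mutualIntensity κ) u) x)
  rw [norm_sub_rev] at this
  linarith

end Transversality

end Litho

/-! ### Proof of the proposition -/

open Litho in
theorem proposition5p1 :
    ∀ L : ℝ, 0 < L →
    -- constants depending on `L` only
    ∃ δ₁ δ₂ m₁ R₀ h' a₁ : ℝ,
      GeomConstants L δ₁ δ₂ m₁ ∧ GaussConstants L δ₁ δ₂ m₁ R₀ h' a₁ ∧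
      ∀ R p M ρ : ℝ, 10 * R₀ ≤ R → 4 < p → 0 ≤ M → 0 < ρ → ρ ≤ 1 →
      -- constants depending on `L`, `R`, the bound `M` on the Hessian, `p` and `ρ = s s₀` only
      ∃ σ₀ γ₀ : ℝ, 0 < σ₀ ∧ σ₀ ≤ 1 ∧ 0 < γ₀ ∧
      ∀ (δ' : ℝ) (That : Plane → ℝ) (s₀ s σ γ h : ℝ) (φ : ℝ → ℝ),
        0 < δ' → δ' ≤ min h' (a₁ / 2) →
        0 < s₀ → s₀ ≤ 1 → IsAperture That s₀ →
        w11Norm (fun x => pointSpread That x - gauss x) ≤ ENNReal.ofReal δ' →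
        hessL1Norm (fun x => pointSpread That x - gauss x) ≤ ENNReal.ofReal M →
        0 < s → s ≤ 1 / s₀ → s * s₀ = ρ →
        0 < σ → σ ≤ σ₀ * s → 0 < γ → γ ≤ γ₀ →
        1 / 3 ≤ h → h ≤ 2 / 3 →
        IsSmoothStep φ →
        -- the map `Φ_η` takes its values in `C^{1,α}` and is Hölder continuous
        (∀ η : ℝ, 0 < η → ∀ u ∈ maskSet R,
          MemC1Alpha (1 - 4 / p) (softThreshold φ h η (intensity That s₀ s σ u))) ∧
        (∀ η : ℝ, 0 < η → η ≤ h → ∃ C : ℝ, 0 ≤ C ∧ ∀ u₁ ∈ maskSet R, ∀ u₂ ∈ maskSet R,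
          c1AlphaNorm (1 - 4 / p) (fun x =>
            softThreshold φ h η (intensity That s₀ s σ u₁) x -
            softThreshold φ h η (intensity That s₀ s σ u₂) x) ≤
          ENNReal.ofReal (C * l1Dist R u₁ u₂ ^ (1 / p))) ∧
        -- both maps take `𝒜_γ` into `BV`, and they are uniformly close for small `η`
        (∀ u ∈ nearMaskSet (s * s₀ * R₀) L R γ,
          MemBV (ball 0 (R + 2 * m₁ * (δ₂ / 4) * R₀))
            (hardThreshold h (intensity That s₀ s σ u))) ∧
        (∀ η : ℝ, 0 < η → ∀ u ∈ nearMaskSet (s * s₀ * R₀) L R γ,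
          MemBV (ball 0 (R + 2 * m₁ * (δ₂ / 4) * R₀))
            (softThreshold φ h η (intensity That s₀ s σ u))) ∧
        (∀ ε : ℝ, 0 < ε → ∃ η₀ : ℝ, 0 < η₀ ∧ ∀ η : ℝ, 0 < η → η < η₀ →
          ∀ u ∈ nearMaskSet (s * s₀ * R₀) L R γ,
            dSt (ball 0 (R + 2 * m₁ * (δ₂ / 4) * R₀))
              (hardThreshold h (intensity That s₀ s σ u))
              (softThreshold φ h η (intensity That s₀ s σ u)) ≤ ε) := by
  intro L hL
  set δ₁ : ℝ := 1 / (8 * (2 + L)) with hδ₁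
  set m₁ : ℝ := 1 / (4 * (1 + L)) with hm₁
  have hgeo : GeomConstants L δ₁ δ₁ m₁ := geomConstants hL hδ₁ rfl hm₁
  have hδ₁0 := hgeo.δ₁_pos
  have hδ₁L : (1 + L) * δ₁ + δ₁ / 4 ≤ 1 / 2 := by
    have h1 : (2 + L) * δ₁ = 1 / 8 := by rw [hδ₁]; field_simp
    linarith
  obtain ⟨R₀, h', a₁, hgc⟩ := exists_gaussConstants hL hδ₁0 hgeo.m₁_pos hgeo.δ₁_le hδ₁L
  refine ⟨δ₁, δ₁, m₁, R₀, h', a₁, hgeo, hgc, fun R p M ρ hR hp hM hρ0 hρ1 => ?_⟩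
  have hR₀ : 0 < R₀ := one_pos.trans_le hgc.R₀_ge
  have ha₁ := hgc.a₁_pos
  have hm₁0 := hgeo.m₁_pos
  obtain ⟨σ₀, γ₀, hσ₀, hσ₀1, hγ₀, htrans⟩ :=
    exists_transversality hgc hgeo (R := R) (by linarith) hM hρ0 hρ1
  refine ⟨σ₀, γ₀, hσ₀, hσ₀1, hγ₀, ?_⟩
  intro δ' That s₀ s σ γ h φ hδ'0 hδ' _ _ hap hw hh hs _ hsρ hσ0 hσ _ hγ hh1 hh2 hφ
  have hp0 : 0 < p := by linarith
  have hα1 : 1 - 4 / p ≤ 1 := sub_le_self _ (by positivity)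
  have hα0 : 0 ≤ 1 - 4 / p := sub_nonneg.2 ((div_le_one hp0).2 hp.le)
  obtain ⟨T, hT⟩ := hap.exists_schwartz
  obtain ⟨K, hK⟩ := exists_schwartz_dilate T hρ0
  obtain ⟨C, hC⟩ := exists_bddC2_schwartz K
  have hκ0 : 0 < σ / s := div_pos hσ0 hs
  have hJm := measurable_mutualIntensity (σ / s)
  have hJb := abs_mutualIntensity_le hκ0
  have hI : ∀ u, intensity That s₀ s σ u = hopkins K (mutualIntensity (σ / s)) u := fun u => by
    rw [intensity, hsρ, hK, hT]
  obtain ⟨B, hB⟩ := exists_bddC2_hopkins R hC hJm hJb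
  obtain ⟨B₁, hB₁, hlip⟩ := exists_hopkins_sub_le R hC hJm hJb
  have hband := htrans δ' T K (σ / s) h hδ'0 hδ' (by rwa [hT]) (by rwa [hT]) hK hκ0
    ((div_le_iff₀ hs).2 hσ) hh1 hh2
  -- The band lies in the closed disc of radius R + m₁δR₀; the strictly larger radius R + 2m₁δR₀
  -- leaves room for the calibrating field to have compact support in the disc.
  obtain ⟨C', hC'0, hC'⟩ := exists_dSt_threshold_le B h (c := a₁ / 4) (η₁ := 1 / 100)
    (R' := R + m₁ * (δ₁ / 4) * R₀) (R'' := R + 2 * m₁ * (δ₁ / 4) * R₀) (by positivity)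
    (by norm_num) (by have : 0 < m₁ * (δ₁ / 4) * R₀ := by positivity
                      linarith) hφ
  have hBV : ∀ u ∈ nearMaskSet (s * s₀ * R₀) L R γ, _ := fun u hu =>
    hC' _ (hB u hu.1) (hband u ⟨hu.1, by
      obtain ⟨-, D, hDR, hD, hl⟩ := hu
      exact ⟨D, hDR, hsρ ▸ hD, hl.trans hγ⟩⟩)
  simp only [hI]
  refine ⟨fun η _ u hu => ?_, fun η _ _ => ?_, fun u hu => (hBV u hu).1, fun η _ u hu => ?_,
    fun ε hε => ?_⟩
  · obtain ⟨B', hB'⟩ := exists_bddC2_softThreshold hφ B h η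
    exact (hB' _ (hB u hu)).memC1Alpha hα0 hα1
  · exact exists_c1AlphaNorm_softThreshold_sub_le hφ h η R hp hB₁ hB hlip
  · exact memBV_softThreshold hφ (hB u hu.1) measure_ball_lt_top.ne h η
  · refine ⟨min (1 / 100) (ε / (C' + 1)), lt_min (by norm_num) (by positivity),
      fun η hη hη' u hu => ((hBV u hu).2 η hη (hη'.le.trans (min_le_left _ _))).trans ?_⟩
    have h1 : η * (C' + 1) ≤ ε :=
      (le_div_iff₀ (by positivity)).1 (hη'.le.trans (min_le_right _ _))
    linarith
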